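/- Let $G$ be a finite simple connected graph with $10$ or $11$ vertices. Suppose that $G$ is claw-free (no induced subgraph of $G$ is isomorphic to the claw $K_{1,3}$) and claw-contractible-free (no graph obtained from $G$ by contracting edges, and removing the resulting loops and multiple edges, is isomorphic to $K_{1,3}$). Then $G$ is $e$-positive: its chromatic symmetric function $$X_G=\sum_{\kappa}\ \prod_{v\in V(G)} x_{\kappa(v)}\in\mathbb{Q}[[x_1,x_2,\dots]],$$ where $\kappa$ runs over all proper colourings $\kappa:V(G)\to\{1,2,3,\dots\}$ of $G$, is a linear combination with nonnegative rational coefficients of the elementary symmetric functions $e_\lambda=e_{\lambda_1}e_{\lambda_2}\cdots e_{\lambda_l}$, where $\lambda=(\lambda_1,\dots,\lambda_l)$ runs over the partitions of $|V(G)|$ and $e_k=\sum_{i_1<\dots<i_k}x_{i_1}\cdots x_{i_k}$. -/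

import Mathlib

noncomputable section

/-- The exponent vector of the monomial `∏ v, x_{κ v}`: the variable `x_i` occurs in it as often
as the colour `i` is used by `κ`. -/
def colorContent {V : Type*} [Fintype V] (κ : V → ℕ) : ℕ →₀ ℕ :=
  ∑ v, Finsupp.single (κ v) 1

/-- Only finitely many colourings have a given content, so the coefficients of the chromatic
symmetric function below are genuine cardinalities. -/
theorem finite_coloring_of_content {V : Type*} [Fintype V] (G : SimpleGraph V) (d : ℕ →₀ ℕ) :
    Finite {κ : G.Coloring ℕ // colorContent κ = d} := by
  classical
  refine Finite.of_injective
    (β := V → d.support)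
    (fun κ v => ⟨κ.1 v, ?_⟩) ?_
  · have h : d (κ.1 v) = colorContent κ.1 (κ.1 v) := by rw [κ.2]
    rw [Finsupp.mem_support_iff, h]
    simp only [colorContent, Finsupp.finsetSum_apply]
    intro h0
    have := (Finset.sum_eq_zero_iff.mp h0) v (Finset.mem_univ v)
    simp at this
  · intro κ κ' h
    apply Subtype.ext
    apply RelHom.ext
    intro v
    exact congrArg Subtype.val (congrFun h v)

/-- The chromatic symmetric function `X_G = ∑_κ ∏_{v ∈ V} x_{κ(v)}` in `ℚ[[x_0, x_1, …]]`, where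
`κ` runs over the proper colourings of `G` with colours in `ℕ`. The coefficient of a monomial `x^d`
in this sum is the number of proper colourings `κ` with `∏ v, x_{κ v} = x^d`. -/
def chromaticSymmetricFunction {V : Type*} [Fintype V] (G : SimpleGraph V) : MvPowerSeries ℕ ℚ :=
  fun d => (Nat.card {κ : G.Coloring ℕ // colorContent κ = d} : ℚ)

open Classical in
/-- The elementary symmetric function `e_k = ∑_{i_1 < ⋯ < i_k} x_{i_1} ⋯ x_{i_k}` in
`ℚ[[x_0, x_1, …]]`: the sum of all square-free monomials of degree `k`. -/
def elementarySymm (k : ℕ) : MvPowerSeries ℕ ℚ :=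
  fun d => if (∀ i, d i ≤ 1) ∧ d.degree = k then 1 else 0

/-- `e_λ = e_{λ_1} e_{λ_2} ⋯ e_{λ_l}` for a partition `λ = (λ_1, …, λ_l)`. -/
def elementarySymmPart {n : ℕ} (p : n.Partition) : MvPowerSeries ℕ ℚ :=
  (p.parts.map elementarySymm).prod

/-- `G` is `e`-positive: `X_G` is a linear combination of elementary symmetric functions `e_λ` with
nonnegative coefficients. Since `X_G` is homogeneous of degree `|V|`, only the partitions of `|V|`
can occur. -/
def IsEPositive {V : Type*} [Fintype V] (G : SimpleGraph V) : Prop :=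
  ∃ c : (Fintype.card V).Partition → ℚ,
    (∀ p, 0 ≤ c p) ∧ chromaticSymmetricFunction G = ∑ p, c p • elementarySymmPart p

/-- The claw `K_{1,3}`. -/
abbrev clawGraph : SimpleGraph (Fin 1 ⊕ Fin 3) := completeBipartiteGraph (Fin 1) (Fin 3)

/-- `G` is claw-free: no induced subgraph of `G` is a claw. -/
def IsClawFree {V : Type*} (G : SimpleGraph V) : Prop :=
  ¬ SimpleGraph.IsIndContained clawGraph G

/-- `G` can be contracted to `H`: contracting a set of edges of `G` (and deleting the resulting
loops and multiple edges) gives a graph isomorphic to `H`. The map `f` sends a vertex of `G` to the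
vertex of `H` it is merged into: each set of merged vertices is nonempty and connected, and two
distinct vertices of `H` are adjacent if and only if `G` has an edge between the two sets. -/
def IsContractibleTo {V W : Type*} (G : SimpleGraph V) (H : SimpleGraph W) : Prop :=
  ∃ f : V → W,
    (∀ w, (G.induce (f ⁻¹' {w})).Connected) ∧
    ∀ w w', w ≠ w' → (H.Adj w w' ↔ ∃ v v', f v = w ∧ f v' = w' ∧ G.Adj v v')

/-- `G` is claw-contractible-free: `G` cannot be contracted to a claw. -/
def IsClawContractibleFree {V : Type*} (G : SimpleGraph V) : Prop :=
  ¬ IsContractibleTo G clawGraph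

end

/-!
The proof splits according to whether `G` has three pairwise nonadjacent vertices.

*Stable partitions.* The chromatic symmetric function of `G` only depends on the polynomial
`blockPoly`, the sum of `∏ X_{|B|}` over the partitions of the vertices into stable blocks `B`: the
coefficient of a monomial is obtained from `blockPoly` by differentiating once for every colour, since
differentiating with respect to `X_b` removes a stable set of `b` vertices (`pderiv_blockPoly`,
`exists_functional`). For a disjoint union of complete graphs of sizes `λ` the chromatic symmetric
function is a multiple of `e_λ`. So `G` is `e`-positive if a multiple of its block polynomial is a
nonnegative combination of block polynomials of disjoint unions of complete graphs
(`isEPositive_of_blockPoly`).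

*No three independent vertices.* Then blocks have at most two elements, and the block polynomial is a
combination of those of two disjoint cliques on `i` and `j` vertices. The coefficients are given by a
recursion that removes pairs of nonadjacent vertices, which reduces their positivity to that of the
coefficients of `e_m`. The latter are differences between signed counts of ways to remove all vertices one
by one or in nonadjacent pairs, and they are nonnegative by the inequality `sum_removalCount_le`, whose
proof uses that the vertices not adjacent to a given one form a clique. This case needs no further
hypothesis (`isEPositive_of_card_le_two`).

*Three independent vertices.* If `G` is connected and claw-free, and `x`, `y`, `z` are independent
vertices whose complement is connected, then contracting the complement gives a claw; so every such
complement is disconnected (`IsClawContractibleFree.cut`). Connected claw-free graphs with this property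
and with an independent triple are called good (`IsGood`). A good graph with at least six vertices has a
vertex whose removal leaves a good graph (`IsGood.exists_delete`), and the only good graph with five
vertices is the path. So all good graphs are obtained from the path by adding vertices, and the
conditions on the neighbourhood of a new vertex can be evaluated for all neighbourhoods at once, as digits
of one number (`Admissible.goodSets`). Together with a heuristic renumbering of the vertices, which need
not be canonical, this gives complete lists of 178 and 289 graphs with ten and eleven vertices
(`complete10`, `complete11`).

For these graphs the expansion is found and certified by kernel computation (`checkCodes`). The block
polynomial is evaluated at powers of two that are so far apart that the value determines the polynomial
(`eq_of_eval_eq`); the values for all sets of vertices are stored as blocks of digits of one number, such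
that removing a stable set from all sets at once is a shift (`encode_blockSum`, `topValue_eq`). A greedy
algorithm writes the value as a nonnegative combination of those of the disjoint unions of complete
graphs (`exists_of_greedy`).
-/

/-! ### Connected sets of vertices -/

section Connectivity

variable {V W : Type*} {G : SimpleGraph V} {H : SimpleGraph W} {S T A B Y : Set V} {a b s t v w x y : V}

/-- `S` induces a connected subgraph of `G`: it is nonempty, and a nonempty subset of `S` that is
closed under taking neighbours in `S` is all of `S`. -/
def ConnOn (G : SimpleGraph V) (S : Set V) : Prop :=
  S.Nonempty ∧ ∀ A ⊆ S, A.Nonempty → (∀ a ∈ A, ∀ b ∈ S, G.Adj a b → b ∈ A) → S ⊆ A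

theorem connOn_iff_connected : ConnOn G S ↔ (G.induce S).Connected := by
  constructor
  · rintro ⟨⟨s, hs⟩, h⟩
    have key : ∀ a b : S, (G.induce S).Reachable a b := by
      intro a b
      have := h {x | ∃ hx : x ∈ S, (G.induce S).Reachable a ⟨x, hx⟩} (fun x hx => hx.1)
        ⟨a, a.2, SimpleGraph.Reachable.refl _⟩ (by
          rintro p ⟨hp, hr⟩ q hq hpq
          exact ⟨hq, hr.trans (SimpleGraph.Adj.reachable (by simpa using hpq))⟩) b.2
      exact this.2
    exact { preconnected := key, nonempty := ⟨⟨s, hs⟩⟩ }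
  · intro h
    obtain ⟨⟨s, hs⟩⟩ := h.nonempty
    refine ⟨⟨s, hs⟩, fun A hA ⟨a, ha⟩ hcl x hx => ?_⟩
    obtain ⟨p⟩ := h.preconnected ⟨a, hA ha⟩ ⟨x, hx⟩
    have : ∀ (u v : S), (G.induce S).Walk u v → (u : V) ∈ A → (v : V) ∈ A := by
      intro u v p
      induction p with
      | nil => exact id
      | cons hadj _ ih => exact fun hu => ih (hcl _ hu _ (Subtype.coe_prop _) (by simpa using hadj))
    exact this _ _ p ha

theorem connOn_univ_iff : ConnOn G Set.univ ↔ G.Connected := by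
  rw [connOn_iff_connected]
  exact (SimpleGraph.induceUnivIso G).connected_iff

theorem connOn_image (e : G ↪g H) : ConnOn H (e '' S) ↔ ConnOn G S := by
  constructor
  · rintro ⟨hne, h⟩
    refine ⟨Set.image_nonempty.mp hne, fun A hA hAne hcl => ?_⟩
    have := h (e '' A) (Set.image_mono hA) (hAne.image _) (by
      rintro _ ⟨a, ha, rfl⟩ _ ⟨b, hb, rfl⟩ hab
      exact ⟨b, hcl a ha b hb (e.map_adj_iff.mp hab), rfl⟩)
    exact (Set.image_subset_image_iff e.injective).mp this
  · rintro ⟨hne, h⟩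
    refine ⟨hne.image _, fun A hA hAne hcl => ?_⟩
    have hA' : e '' (e ⁻¹' A ∩ S) = A := by
      ext x
      constructor
      · rintro ⟨y, ⟨hy, _⟩, rfl⟩; exact hy
      · intro hx
        obtain ⟨y, hy, rfl⟩ := hA hx
        exact ⟨y, ⟨hx, hy⟩, rfl⟩
    rw [← hA']
    refine Set.image_mono (h _ Set.inter_subset_right ?_ ?_)
    · rw [← hA'] at hAne; exact Set.image_nonempty.mp hAne
    · rintro a ⟨ha, _⟩ b hb hab
      exact ⟨hcl _ ha _ ⟨b, hb, rfl⟩ (e.map_adj_iff.mpr hab), hb⟩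

theorem ConnOn.singleton (v : V) : ConnOn G {v} := by
  refine ⟨⟨v, rfl⟩, fun A hA ⟨a, ha⟩ _ => ?_⟩
  rintro x rfl
  have := hA ha
  rw [Set.mem_singleton_iff] at this
  exact this ▸ ha

/-- Two connected sets that meet or are joined by an edge have a connected union. -/
theorem ConnOn.union (hS : ConnOn G S) (hT : ConnOn G T) (hs : s ∈ S) (ht : t ∈ T)
    (hst : s = t ∨ G.Adj s t) : ConnOn G (S ∪ T) := by
  refine ⟨⟨s, Or.inl hs⟩, fun A hA ⟨a, ha⟩ hcl => ?_⟩
  have h1 : (A ∩ S).Nonempty → S ⊆ A := fun hne => (hS.2 (A ∩ S) Set.inter_subset_right hne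
    (fun p hp q hq hpq => ⟨hcl p hp.1 q (Or.inl hq) hpq, hq⟩)).trans Set.inter_subset_left
  have h2 : (A ∩ T).Nonempty → T ⊆ A := fun hne => (hT.2 (A ∩ T) Set.inter_subset_right hne
    (fun p hp q hq hpq => ⟨hcl p hp.1 q (Or.inr hq) hpq, hq⟩)).trans Set.inter_subset_left
  have h12 : s ∈ A ↔ t ∈ A := by
    rcases hst with rfl | hst
    · rfl
    · exact ⟨fun h => hcl s h t (Or.inr ht) hst, fun h => hcl t h s (Or.inl hs) hst.symm⟩
  rcases hA ha with h | h
  · have hS' := h1 ⟨a, ha, h⟩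
    exact Set.union_subset hS' (h2 ⟨t, h12.mp (hS' hs), ht⟩)
  · have hT' := h2 ⟨a, ha, h⟩
    exact Set.union_subset (h1 ⟨s, h12.mpr (hT' ht), hs⟩) hT'

theorem ConnOn.insert (hS : ConnOn G S) (hs : s ∈ S) (hsw : G.Adj s w) :
    ConnOn G (insert w S) := by
  rw [Set.insert_eq, Set.union_comm]
  exact hS.union (ConnOn.singleton w) hs rfl (Or.inr hsw)

theorem ConnOn.exists_adj (hS : ConnOn G S) (hA : A ⊆ S) (hne : A.Nonempty) (hSA : ¬ S ⊆ A) :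
    ∃ a ∈ A, ∃ b ∈ S, b ∉ A ∧ G.Adj a b := by
  by_contra! h
  exact hSA (hS.2 A hA hne fun a ha b hb hab => by_contra fun hbA => h a ha b hb hbA hab)

/-- A connected set containing the connected set `Y` can be shrunk to `Y` by removing one vertex at
a time; here is the first removal. -/
theorem ConnOn.exists_diff_singleton [Finite V] (hY : ConnOn G Y) (hYB : ConnOn G (Y ∪ B))
    (hB : B.Nonempty) (hd : Disjoint Y B) : ∃ b ∈ B, ConnOn G ((Y ∪ B) \ {b}) := by
  induction hn : B.ncard using Nat.strong_induction_on generalizing Y B with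
  | _ n ih =>
    obtain ⟨b₀, hb₀⟩ := hB
    obtain ⟨y, hy, w, hw, hwY, hyw⟩ := hYB.exists_adj Set.subset_union_left hY.1
      (fun h => hd.notMem_of_mem_right hb₀ (h (Or.inr hb₀)))
    have hwB : w ∈ B := hw.resolve_left hwY
    by_cases hBw : B = {w}
    · refine ⟨w, hwB, ?_⟩
      rwa [hBw, Set.union_sdiff_right, sdiff_eq_left.mpr (Set.disjoint_singleton_right.mpr hwY)]
    · have hlt : (B \ {w}).ncard < n := hn ▸ Set.ncard_sdiff_singleton_lt_of_mem hwB
      have hU : Insert.insert w Y ∪ B \ {w} = Y ∪ B := by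
        ext z
        by_cases hz : z = w
        · subst hz; simp [hwB]
        · simp [hz]
      obtain ⟨b, hb, hc⟩ := ih _ hlt (hY.insert hy hyw) (hU ▸ hYB)
        (by
          rw [Set.nonempty_iff_ne_empty]
          intro h0
          exact hBw (Set.Subset.antisymm (Set.sdiff_eq_empty.mp h0) (by simpa using hwB)))
        (by
          rw [Set.disjoint_left] at hd ⊢
          rintro z (rfl | hz) ⟨hz1, hz2⟩
          · exact hz2 rfl
          · exact hd hz hz1) rfl
      exact ⟨b, hb.1, hU ▸ hc⟩

/-- Removing from a connected set a part that is attached at a single vertex `x` leaves a connected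
set. -/
theorem ConnOn.diff (hS : ConnOn G S) (hx : x ∈ S) (hxB : x ∉ B)
    (h : ∀ b ∈ B, ∀ s, s ∉ B → G.Adj b s → s = x) : ConnOn G (S \ B) := by
  refine ⟨⟨x, hx, hxB⟩, fun A hA ⟨a, ha⟩ hcl => ?_⟩
  by_cases hxA : x ∈ A
  · have := hS.2 (A ∪ (B ∩ S)) (Set.union_subset (hA.trans Set.sdiff_subset) Set.inter_subset_right)
      ⟨a, Or.inl ha⟩ (by
        rintro p (hp | hp) q hq hpq
        · by_cases hqB : q ∈ B
          · exact Or.inr ⟨hqB, hq⟩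
          · exact Or.inl (hcl p hp q ⟨hq, hqB⟩ hpq)
        · by_cases hqB : q ∈ B
          · exact Or.inr ⟨hqB, hq⟩
          · exact Or.inl (h p hp.1 q hqB hpq ▸ hxA))
    exact fun z hz => (this hz.1).resolve_right fun h' => hz.2 h'.1
  · refine absurd (hS.2 A (hA.trans Set.sdiff_subset) ⟨a, ha⟩ ?_ hx) hxA
    intro p hp q hq hpq
    refine hcl p hp q ⟨hq, fun hqB => hxA ?_⟩ hpq
    exact h q hqB p (hA hp).2 hpq.symm ▸ hp

/-- A cut vertex `x` has a branch: a nonempty set avoiding a given vertex `v ≠ x` whose neighbours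
outside it are at most `x`. -/
theorem exists_branch (hx : ¬ ConnOn G {x}ᶜ) (hv : v ≠ x) :
    ∃ B : Set V, B.Nonempty ∧ x ∉ B ∧ v ∉ B ∧ ∀ b ∈ B, ∀ s, s ∉ B → G.Adj b s → s = x := by
  have : ∃ A : Set V, A ⊆ {x}ᶜ ∧ A.Nonempty ∧ (∀ a ∈ A, ∀ b ∈ ({x}ᶜ : Set V), G.Adj a b → b ∈ A) ∧
      ¬ {x}ᶜ ⊆ A := by
    by_contra! h
    exact hx ⟨⟨v, hv⟩, fun A h1 h2 h3 => h A h1 h2 h3⟩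
  obtain ⟨A, hA, hne, hcl, hnot⟩ := this
  by_cases hvA : v ∈ A
  · obtain ⟨u, hu, huA⟩ := Set.not_subset.mp hnot
    refine ⟨{x}ᶜ \ A, ⟨u, hu, huA⟩, fun h => h.1 rfl, fun h => h.2 hvA, ?_⟩
    intro b hb s hs hbs
    by_contra hsx
    have hsA : s ∈ A := by_contra fun h => hs ⟨hsx, h⟩
    exact hb.2 (hcl s hsA b hb.1 hbs.symm)
  · refine ⟨A, hne, fun h => hA h rfl, hvA, fun b hb s hs hbs => ?_⟩
    by_contra hsx
    exact hs (hcl b hb s hsx hbs)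

end Connectivity

/-! ### Heredity of the structure of the graphs with three independent vertices -/

section Good

variable {V W : Type*} {G : SimpleGraph V} {H : SimpleGraph W}

/-- Three distinct, pairwise nonadjacent vertices. -/
def IndepTriple (G : SimpleGraph V) (x y z : V) : Prop :=
  x ≠ y ∧ x ≠ z ∧ y ≠ z ∧ ¬ G.Adj x y ∧ ¬ G.Adj x z ∧ ¬ G.Adj y z

/-- No vertex has three distinct, pairwise nonadjacent neighbours. -/
def NoClaw (G : SimpleGraph V) : Prop :=
  ∀ c x y z, G.Adj c x → G.Adj c y → G.Adj c z → ¬ IndepTriple G x y z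

/-- The graphs to be enumerated: connected, claw-free, with independence number at least three, and
such that every independent triple is a cut set. -/
structure IsGood (G : SimpleGraph V) : Prop where
  conn : ConnOn G Set.univ
  noClaw : NoClaw G
  cut : ∀ x y z, IndepTriple G x y z → ¬ ConnOn G {x, y, z}ᶜ
  triple : ∃ x y z, IndepTriple G x y z

theorem IndepTriple.map (e : G ↪g H) {x y z : V} :
    IndepTriple H (e x) (e y) (e z) ↔ IndepTriple G x y z := by
  simp [IndepTriple]

theorem NoClaw.of_embedding (e : G ↪g H) (h : NoClaw H) : NoClaw G := by
  intro c x y z h1 h2 h3 ht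
  exact h (e c) (e x) (e y) (e z) (e.map_adj_iff.mpr h1) (e.map_adj_iff.mpr h2)
    (e.map_adj_iff.mpr h3) ((IndepTriple.map e).mpr ht)

theorem IsGood.of_iso (e : G ≃g H) (h : IsGood G) : IsGood H := by
  refine ⟨?_, h.noClaw.of_embedding e.symm.toEmbedding, ?_, ?_⟩
  · have := (connOn_image e.toEmbedding).mpr h.conn
    rwa [Set.image_univ, show Set.range e.toEmbedding = Set.univ from e.surjective.range_eq] at this
  · intro x y z ht hc
    refine h.cut _ _ _ ((IndepTriple.map e.symm.toEmbedding).mpr ht) ?_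
    have := (connOn_image e.symm.toEmbedding).mpr hc
    rw [show (e.symm.toEmbedding '' {x, y, z}ᶜ) = (e.symm '' {x, y, z})ᶜ from
      Set.image_compl_eq e.symm.bijective] at this
    simpa [Set.image_insert_eq, Set.image_singleton] using this
  · obtain ⟨x, y, z, ht⟩ := h.triple
    exact ⟨e x, e y, e z, (IndepTriple.map e.toEmbedding).mpr ht⟩

theorem IndepTriple.rotate {x y z : V} (h : IndepTriple G x y z) : IndepTriple G y z x := by
  obtain ⟨h1, h2, h3, h4, h5, h6⟩ := h
  exact ⟨h3, h1.symm, h2.symm, h6, fun h => h4 h.symm, fun h => h5 h.symm⟩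

/-- Three pairwise nonadjacent parts `B₁`, `B₂`, `B₃` attached to a connected remainder `R`
can be peeled off down to single vertices. -/
theorem exists_triple_of_parts [Finite V] {R B₁ B₂ B₃ : Set V} (hR : ConnOn G R)
    (h₁ : ConnOn G (R ∪ B₁)) (h₂ : ConnOn G (R ∪ B₂)) (h₃ : ConnOn G (R ∪ B₃))
    (n₁ : B₁.Nonempty) (n₂ : B₂.Nonempty) (n₃ : B₃.Nonempty)
    (d₁ : Disjoint R B₁) (d₂ : Disjoint R B₂) (d₃ : Disjoint R B₃)
    (d₁₂ : Disjoint B₁ B₂) (d₁₃ : Disjoint B₁ B₃) (d₂₃ : Disjoint B₂ B₃)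
    (hU : R ∪ B₁ ∪ B₂ ∪ B₃ = Set.univ)
    (a₁₂ : ∀ x ∈ B₁, ∀ y ∈ B₂, ¬ G.Adj x y) (a₁₃ : ∀ x ∈ B₁, ∀ y ∈ B₃, ¬ G.Adj x y)
    (a₂₃ : ∀ x ∈ B₂, ∀ y ∈ B₃, ¬ G.Adj x y) :
    ∃ x y z, IndepTriple G x y z ∧ ConnOn G {x, y, z}ᶜ := by
  obtain ⟨x, hx, cx⟩ := hR.exists_diff_singleton h₁ n₁ d₁
  obtain ⟨y, hy, cy⟩ := hR.exists_diff_singleton h₂ n₂ d₂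
  obtain ⟨z, hz, cz⟩ := hR.exists_diff_singleton h₃ n₃ d₃
  obtain ⟨r, hr⟩ := hR.1
  rw [Set.disjoint_left] at *
  have hxy : x ≠ y := fun h => d₁₂ hx (h ▸ hy)
  have hxz : x ≠ z := fun h => d₁₃ hx (h ▸ hz)
  have hyz : y ≠ z := fun h => d₂₃ hy (h ▸ hz)
  refine ⟨x, y, z, ⟨hxy, hxz, hyz, a₁₂ x hx y hy, a₁₃ x hx z hz, a₂₃ y hy z hz⟩, ?_⟩
  have hrx : r ∈ (R ∪ B₁) \ {x} := ⟨Or.inl hr, fun h => d₁ hr (h ▸ hx)⟩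
  have hry : r ∈ (R ∪ B₂) \ {y} := ⟨Or.inl hr, fun h => d₂ hr (h ▸ hy)⟩
  have hrz : r ∈ (R ∪ B₃) \ {z} := ⟨Or.inl hr, fun h => d₃ hr (h ▸ hz)⟩
  have := (cx.union cy hrx hry (Or.inl rfl)).union cz (Or.inl hrx) hrz (Or.inl rfl)
  convert this using 1
  ext u
  have hu : u ∈ R ∪ B₁ ∪ B₂ ∪ B₃ := hU ▸ Set.mem_univ u
  simp only [Set.mem_compl_iff, Set.mem_insert_iff, Set.mem_singleton_iff, Set.mem_union,
    Set.mem_sdiff] at hu ⊢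
  constructor
  · intro h
    push Not at h
    rcases hu with ((hu | hu) | hu) | hu
    · exact Or.inl (Or.inl ⟨Or.inl hu, h.1⟩)
    · exact Or.inl (Or.inl ⟨Or.inr hu, h.1⟩)
    · exact Or.inl (Or.inr ⟨Or.inr hu, h.2.1⟩)
    · exact Or.inr ⟨Or.inr hu, h.2.2⟩
  · rintro ((⟨hu, h⟩ | ⟨hu, h⟩) | ⟨hu, h⟩) (rfl | rfl | rfl)
    · exact h rfl
    · exact hu.elim (fun h => d₂ h hy) fun h => d₁₂ h hy
    · exact hu.elim (fun h => d₃ h hz) fun h => d₁₃ h hz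
    · exact hu.elim (fun h => d₁ h hx) fun h => d₁₂ hx h
    · exact h rfl
    · exact hu.elim (fun h => d₃ h hz) fun h => d₂₃ h hz
    · exact hu.elim (fun h => d₁ h hx) fun h => d₁₃ hx h
    · exact hu.elim (fun h => d₂ h hy) fun h => d₂₃ hy h
    · exact h rfl

/-- Branches at two different vertices that avoid each other's base are disjoint and not joined by
an edge. -/
theorem branches_separate (hG : ConnOn G Set.univ) {x y : V} {X Y : Set V} (hxy : x ≠ y)
    (hxX : x ∉ X) (hyX : y ∉ X) (hX : ∀ b ∈ X, ∀ s, s ∉ X → G.Adj b s → s = x)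
    (hxY : x ∉ Y) (hyY : y ∉ Y) (hY : ∀ b ∈ Y, ∀ s, s ∉ Y → G.Adj b s → s = y) :
    Disjoint X Y ∧ ∀ b ∈ X, ∀ c ∈ Y, ¬ G.Adj b c := by
  have hd : Disjoint X Y := by
    rw [Set.disjoint_iff_inter_eq_empty]
    by_contra hne
    refine hxX (hG.2 (X ∩ Y) (Set.subset_univ _) (Set.nonempty_iff_ne_empty.mpr hne) ?_
      (Set.mem_univ x)).1
    intro a ha b _ hab
    have h1 : b ∈ Y ∨ b = y := or_iff_not_imp_left.mpr fun h => hY a ha.2 b h hab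
    have h2 : b ∈ X ∨ b = x := or_iff_not_imp_left.mpr fun h => hX a ha.1 b h hab
    rcases h1 with h1 | rfl
    · exact ⟨h2.resolve_right fun h => hxY (h ▸ h1), h1⟩
    · exact (h2.elim hyX fun h => hxy h.symm).elim
  refine ⟨hd, fun b hb c hc hbc => ?_⟩
  rw [Set.disjoint_left] at hd
  exact hxY (hX b hb c (fun h => hd h hc) hbc ▸ hc)

/-- A triangle of a good graph contains at most one cut vertex: branches at two cut vertices
together with the third vertex, or a branch at it, would give an independent triple that is not a
cut set. -/
theorem IsGood.not_cut_of_triangle [Finite V] (hG : IsGood G) {a x y : V} (hax : G.Adj a x)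
    (hay : G.Adj a y) (hxy : G.Adj x y) : ConnOn G {x}ᶜ ∨ ConnOn G {y}ᶜ := by
  by_contra! h
  obtain ⟨X, nX, hxX, hyX, hX⟩ := exists_branch h.1 hxy.ne'
  obtain ⟨Y, nY, hyY, hxY, hY⟩ := exists_branch h.2 hxy.ne
  have haX : a ∉ X := fun ha => hxy.ne' (hX a ha y hyX hay)
  have haY : a ∉ Y := fun ha => hxy.ne (hY a ha x hxY hax)
  obtain ⟨dXY, aXY⟩ := branches_separate hG.conn hxy.ne hxX hyX hX hxY hyY hY
  obtain ⟨A, nA, hxA, hyA, cA, dAX, aAX, dAY, aAY⟩ : ∃ A : Set V, A.Nonempty ∧ x ∉ A ∧ y ∉ A ∧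
      ConnOn G (Set.univ \ A) ∧ Disjoint A X ∧ (∀ b ∈ A, ∀ c ∈ X, ¬ G.Adj b c) ∧
      Disjoint A Y ∧ (∀ b ∈ A, ∀ c ∈ Y, ¬ G.Adj b c) := by
    by_cases ha : ConnOn G {a}ᶜ
    · refine ⟨{a}, ⟨a, rfl⟩, hax.ne', hay.ne', by rwa [← Set.compl_eq_univ_sdiff], ?_, ?_, ?_, ?_⟩
      · exact Set.disjoint_singleton_left.mpr haX
      · rintro _ rfl c hc hac
        exact hax.ne (hX c hc _ haX hac.symm)
      · exact Set.disjoint_singleton_left.mpr haY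
      · rintro _ rfl c hc hac
        exact hay.ne (hY c hc _ haY hac.symm)
    · obtain ⟨A, nA, haA, hxA, hA⟩ := exists_branch ha hax.ne'
      have hyA : y ∉ A := fun hy => hax.ne' (hA y hy x hxA hxy.symm)
      obtain ⟨d1, a1⟩ := branches_separate hG.conn hax.ne haA hxA hA haX hxX hX
      obtain ⟨d2, a2⟩ := branches_separate hG.conn hay.ne haA hyA hA haY hyY hY
      exact ⟨A, nA, hxA, hyA, hG.conn.diff (Set.mem_univ a) haA hA, d1, a1, d2, a2⟩
  have e1 : (((Set.univ : Set V) \ A) \ X) \ Y ∪ A = ((Set.univ : Set V) \ X) \ Y := by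
    ext u
    have : u ∈ A → u ∉ X := fun h => Set.disjoint_left.mp dAX h
    have : u ∈ A → u ∉ Y := fun h => Set.disjoint_left.mp dAY h
    simp only [Set.mem_union, Set.mem_sdiff, Set.mem_univ, true_and]
    tauto
  have e2 : (((Set.univ : Set V) \ A) \ X) \ Y ∪ X = ((Set.univ : Set V) \ A) \ Y := by
    ext u
    have : u ∈ A → u ∉ X := fun h => Set.disjoint_left.mp dAX h
    have : u ∈ X → u ∉ Y := fun h => Set.disjoint_left.mp dXY h
    simp only [Set.mem_union, Set.mem_sdiff, Set.mem_univ, true_and]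
    tauto
  have e3 : (((Set.univ : Set V) \ A) \ X) \ Y ∪ Y = ((Set.univ : Set V) \ A) \ X := by
    ext u
    have : u ∈ A → u ∉ Y := fun h => Set.disjoint_left.mp dAY h
    have : u ∈ X → u ∉ Y := fun h => Set.disjoint_left.mp dXY h
    simp only [Set.mem_union, Set.mem_sdiff, Set.mem_univ, true_and]
    tauto
  have cAX := cA.diff ⟨Set.mem_univ x, hxA⟩ hxX hX
  obtain ⟨p, q, r, ht, hc⟩ := exists_triple_of_parts (R := (((Set.univ : Set V) \ A) \ X) \ Y)
    (cAX.diff ⟨⟨Set.mem_univ y, hyA⟩, hyX⟩ hyY hY)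
    (e1 ▸ (hG.conn.diff (Set.mem_univ x) hxX hX).diff ⟨Set.mem_univ y, hyX⟩ hyY hY)
    (e2 ▸ cA.diff ⟨Set.mem_univ y, hyA⟩ hyY hY) (e3.symm ▸ cAX) nA nX nY
    (Set.disjoint_left.mpr fun u hu h => hu.1.1.2 h)
    (Set.disjoint_left.mpr fun u hu h => hu.1.2 h)
    (Set.disjoint_left.mpr fun u hu h => hu.2 h) dAX dAY dXY
    (by
      ext u
      simp only [Set.mem_union, Set.mem_sdiff, Set.mem_univ, true_and, iff_true]
      tauto) aAX aAY aXY
  exact hG.cut p q r ht hc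

theorem connOn_induce {T : Set V} {S : Set T} :
    ConnOn (G.induce T) S ↔ ConnOn G (Subtype.val '' S) :=
  (connOn_image (SimpleGraph.Embedding.induce T)).symm

/-- The criterion by which a vertex of a good graph is deleted. -/
theorem IsGood.delete (hG : IsGood G) {v x y z : V} (hv : ConnOn G {v}ᶜ)
    (ht : IndepTriple G x y z) (hx : x ≠ v) (hy : y ≠ v) (hz : z ≠ v)
    (h : ∀ p q r, IndepTriple G p q r → p ≠ v → q ≠ v → r ≠ v → ¬ ConnOn G {v, p, q, r}ᶜ) :
    IsGood (G.induce {v}ᶜ) := by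
  refine ⟨?_, hG.noClaw.of_embedding (SimpleGraph.Embedding.induce _), ?_,
    ⟨x, hx⟩, ⟨y, hy⟩, ⟨z, hz⟩, ?_⟩
  · rw [connOn_induce, Set.image_univ, Subtype.range_coe]
    exact hv
  · rintro ⟨p, hp⟩ ⟨q, hq⟩ ⟨r, hr⟩ htr hc
    refine h p q r ((IndepTriple.map (SimpleGraph.Embedding.induce _)).mpr htr) hp hq hr ?_
    rw [connOn_induce] at hc
    convert hc using 1
    ext u
    simp [eq_comm]
  · exact (IndepTriple.map (SimpleGraph.Embedding.induce _)).mp ht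

/-- In a graph of maximum degree two, a connected set has at most two outer neighbours. -/
theorem ConnOn.not_three_nbrs [Finite V]
    (hdeg : ∀ c x y z, G.Adj c x → G.Adj c y → G.Adj c z → x ≠ y → x ≠ z → y ≠ z → False)
    {M : Set V} (hM : ConnOn G M) : ∀ x y z, x ≠ y → x ≠ z → y ≠ z → x ∉ M → y ∉ M → z ∉ M →
    (∃ m ∈ M, G.Adj m x) → (∃ m ∈ M, G.Adj m y) → (∃ m ∈ M, G.Adj m z) → False := by
  induction hn : M.ncard using Nat.strong_induction_on generalizing M with
  | _ n ih =>
    obtain ⟨u, hu⟩ := hM.1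
    by_cases hMu : M = {u}
    · subst hMu
      rintro x y z hxy hxz hyz - - - ⟨_, rfl, hx⟩ ⟨_, rfl, hy⟩ ⟨_, rfl, hz⟩
      exact hdeg _ x y z hx hy hz hxy hxz hyz
    · have hMU : {u} ∪ M \ {u} = M := Set.union_sdiff_cancel (Set.singleton_subset_iff.mpr hu)
      obtain ⟨w, hw, hc⟩ := (ConnOn.singleton (G := G) u).exists_diff_singleton (B := M \ {u})
        (by rwa [hMU]) (by
          rw [Set.nonempty_iff_ne_empty]
          intro h0
          exact hMu (Set.Subset.antisymm (Set.sdiff_eq_empty.mp h0) (by simpa using hu)))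
        Set.disjoint_sdiff_right
      rw [hMU] at hc
      have IH := ih _ (hn ▸ Set.ncard_sdiff_singleton_lt_of_mem hw.1) hc rfl
      obtain ⟨m', hm', b, hb, hb', hmb⟩ := hM.exists_adj Set.sdiff_subset hc.1
        (fun h => (h hw.1).2 rfl)
      have hbw : b = w := by_contra fun h => hb' ⟨hb, h⟩
      subst hbw
      -- If `x` is joined only to the removed vertex `b`, then `b` can take the place of `x`.
      have key : ∀ x y z, x ≠ y → x ≠ z → y ≠ z → x ∉ M → y ∉ M → z ∉ M →
          (∃ m ∈ M, G.Adj m x) → (∃ m ∈ M, G.Adj m y) → (∃ m ∈ M, G.Adj m z) →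
          (∃ m ∈ M \ {b}, G.Adj m x) := by
        intro x y z hxy hxz hyz hx hy hz ⟨m, hm, hmx⟩ ⟨p, hp, hpy⟩ ⟨q, hq, hqz⟩
        by_contra hno
        have hmb' : m = b := by_contra fun h => hno ⟨m, ⟨hm, h⟩, hmx⟩
        subst hmb'
        have h1 : ∀ t, t ∉ M → t ≠ x → ¬ G.Adj m t := fun t ht htx h =>
          hdeg m m' x t hmb.symm hmx h (fun h => hx (h ▸ hm'.1)) (fun h => ht (h ▸ hm'.1)) htx.symm
        refine IH m y z (fun h => hy (h ▸ hm)) (fun h => hz (h ▸ hm)) hyz (fun h => h.2 rfl)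
          (fun h => hy h.1) (fun h => hz h.1) ⟨m', hm', hmb⟩ ⟨p, ⟨hp, ?_⟩, hpy⟩ ⟨q, ⟨hq, ?_⟩, hqz⟩
        · rintro rfl; exact h1 y hy hxy.symm hpy
        · rintro rfl; exact h1 z hz hxz.symm hqz
      intro x y z hxy hxz hyz hx hy hz ex ey ez
      exact IH x y z hxy hxz hyz (fun h => hx h.1) (fun h => hy h.1) (fun h => hz h.1)
        (key x y z hxy hxz hyz hx hy hz ex ey ez)
        (key y x z hxy.symm hyz hxz hy hx hz ey ex ez)
        (key z x y hxz.symm hyz.symm hxy hz hx hy ez ex ey)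

/-- A good graph on at least six vertices stays good after deleting a suitable vertex. -/
theorem IsGood.exists_delete [Fintype V] (hG : IsGood G) (hcard : 6 ≤ Fintype.card V) :
    ∃ v, IsGood (G.induce {v}ᶜ) := by
  classical
  by_cases htri : ∃ a x y, G.Adj a x ∧ G.Adj a y ∧ G.Adj x y
  · -- A vertex of a triangle that is neither a cut vertex nor in every independent triple.
    have fin : ∀ v p q x y z, G.Adj v p → G.Adj v q → G.Adj p q → ConnOn G {v}ᶜ →
        IndepTriple G x y z → x ≠ v → y ≠ v → z ≠ v → ∃ v, IsGood (G.induce {v}ᶜ) := by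
      intro v p q x y z hvp hvq hpq hv ht hx hy hz
      refine ⟨v, hG.delete hv ht hx hy hz fun a b c habc ha hb hc hcon => hG.cut a b c habc ?_⟩
      have hpq' : p ∈ ({v, a, b, c}ᶜ : Set V) ∨ q ∈ ({v, a, b, c}ᶜ : Set V) := by
        by_contra! h
        have h1 : p = a ∨ p = b ∨ p = c := by
          have := not_not.mp h.1
          simpa [hvp.ne'] using this
        have h2 : q = a ∨ q = b ∨ q = c := by
          have := not_not.mp h.2
          simpa [hvq.ne'] using this
        obtain ⟨h3, h4, h5, h6, h7, h8⟩ := habc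
        rcases h1 with rfl | rfl | rfl <;> rcases h2 with rfl | rfl | rfl <;>
          first
            | exact hpq.ne rfl
            | exact h6 hpq
            | exact h7 hpq
            | exact h8 hpq
            | exact h6 hpq.symm
            | exact h7 hpq.symm
            | exact h8 hpq.symm
      have hins : ({a, b, c}ᶜ : Set V) = insert v {v, a, b, c}ᶜ := by
        ext u
        by_cases hu : u = v
        · subst hu; simp [ha.symm, hb.symm, hc.symm]
        · simp [hu]
      rw [hins]
      rcases hpq' with h | h
      · exact hcon.insert h hvp.symm
      · exact hcon.insert h hvq.symm
    -- Two adjacent vertices cannot both lie in the same independent triple.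
    have two : ∀ v p q, G.Adj v p → G.Adj v q → G.Adj p q → ConnOn G {v}ᶜ → ConnOn G {p}ᶜ →
        ∃ v, IsGood (G.induce {v}ᶜ) := by
      intro v p q hvp hvq hpq hv hp
      obtain ⟨x, y, z, ht⟩ := hG.triple
      by_cases h : x ≠ v ∧ y ≠ v ∧ z ≠ v
      · exact fin v p q x y z hvp hvq hpq hv ht h.1 h.2.1 h.2.2
      · refine fin p v q x y z hvp.symm hpq hvq hp ht ?_ ?_ ?_ <;> rintro rfl <;>
          obtain ⟨h3, h4, h5, h6, h7, h8⟩ := ht <;> apply h <;> refine ⟨?_, ?_, ?_⟩ <;> rintro rfl <;>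
          first
            | exact hvp.ne rfl
            | exact h6 hvp
            | exact h7 hvp
            | exact h8 hvp
            | exact h6 hvp.symm
            | exact h7 hvp.symm
            | exact h8 hvp.symm
    obtain ⟨a, x, y, hax, hay, hxy⟩ := htri
    rcases hG.not_cut_of_triangle hax hay hxy with hx | hy
    · rcases hG.not_cut_of_triangle hxy hax.symm hay.symm with hy | ha
      · exact two x y a hxy hax.symm hay.symm hx hy
      · exact two x a y hax.symm hxy hay hx ha
    · rcases hG.not_cut_of_triangle hxy.symm hay.symm hax.symm with hx | ha
      · exact two y x a hxy.symm hay.symm hax.symm hy hx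
      · exact two y a x hay.symm hxy.symm hax hy ha
  · have htf : ∀ a x y, G.Adj a x → G.Adj a y → ¬ G.Adj x y := fun a x y h1 h2 h3 =>
      htri ⟨a, x, y, h1, h2, h3⟩
    have hdeg : ∀ c x y z, G.Adj c x → G.Adj c y → G.Adj c z → x ≠ y → x ≠ z → y ≠ z → False :=
      fun c x y z h1 h2 h3 h4 h5 h6 => hG.noClaw c x y z h1 h2 h3
        ⟨h4, h5, h6, htf c x y h1 h2, htf c x z h1 h3, htf c y z h2 h3⟩
    obtain ⟨u₀⟩ : Nonempty V := Fintype.card_pos_iff.mp (by omega)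
    have huniv : ({u₀} ∪ {u₀}ᶜ : Set V) = Set.univ := Set.union_compl_self _
    obtain ⟨v, -, hv⟩ := (ConnOn.singleton (G := G) u₀).exists_diff_singleton (B := {u₀}ᶜ)
      (huniv ▸ hG.conn) (by
        obtain ⟨w, hw⟩ := Fintype.exists_ne_of_one_lt_card (by omega : 1 < Fintype.card V) u₀
        exact ⟨w, hw⟩) disjoint_compl_right
    rw [huniv, ← Set.compl_eq_univ_sdiff] at hv
    -- A neighbour `u` of `v` has at least three nonneighbours apart from `v`.
    obtain ⟨v', hv', u, -, huv, hvu⟩ := hG.conn.exists_adj (A := {v}) (Set.subset_univ _) ⟨v, rfl⟩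
      (fun h => by
        obtain ⟨w, hw⟩ := Fintype.exists_ne_of_one_lt_card (by omega : 1 < Fintype.card V) v
        exact hw (h (Set.mem_univ w)))
    rw [Set.mem_singleton_iff.mp hv'] at hvu
    obtain ⟨u', hu'⟩ : ∃ u', ∀ t, G.Adj u t → t = v ∨ t = u' := by
      by_cases h : ∃ u', u' ≠ v ∧ G.Adj u u'
      · obtain ⟨u', h1, h2⟩ := h
        refine ⟨u', fun t ht => ?_⟩
        by_contra! hne
        exact hdeg u v u' t hvu.symm h2 ht h1.symm hne.1.symm hne.2.symm
      · push Not at h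
        exact ⟨v, fun t ht => Or.inl (by_contra fun hne => h t hne ht)⟩
    have h3 : 2 < (Finset.univ \ {v, u, u'} : Finset V).card := by
      have := Finset.le_card_sdiff ({v, u, u'} : Finset V) Finset.univ
      have := Finset.card_le_three (a := v) (b := u) (c := u')
      rw [Finset.card_univ] at *
      omega
    obtain ⟨p, hp, q, hq, r, hr, hpq, hpr, hqr⟩ := Finset.two_lt_card.mp h3
    simp only [Finset.mem_sdiff, Finset.mem_univ, true_and, Finset.mem_insert,
      Finset.mem_singleton, not_or] at hp hq hr
    have hnon : ∀ t, t ≠ v → t ≠ u' → ¬ G.Adj u t := fun t h1 h2 h => (hu' t h).elim h1 h2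
    have main : ∀ p q, p ≠ v → p ≠ u → p ≠ u' → q ≠ v → q ≠ u → q ≠ u' → p ≠ q → ¬ G.Adj p q →
        ∃ v, IsGood (G.induce {v}ᶜ) := by
      intro p q p1 p2 p3 q1 q2 q3 hpq hnpq
      refine ⟨v, hG.delete hv (x := u) (y := p) (z := q)
        ⟨p2.symm, q2.symm, hpq, hnon p p1 p3, hnon q q1 q3, hnpq⟩ hvu.ne' p1 q1 ?_⟩
      intro a b c habc ha hb hc hcon
      have nb : ∀ a b c, IndepTriple G a b c → a ≠ v → b ≠ v → c ≠ v →
          ∃ m ∈ ({v, a, b, c}ᶜ : Set V), G.Adj m a := by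
        intro a b c habc ha hb hc
        obtain ⟨a', ha', m, hm, hma, ham⟩ := hv.exists_adj (A := {a}) (by simpa using ha.symm)
          ⟨a, rfl⟩ (fun h => habc.1.symm (h hb))
        rw [Set.mem_singleton_iff.mp ha'] at ham
        obtain ⟨h3, h4, h5, h6, h7, h8⟩ := habc
        refine ⟨m, ?_, ham.symm⟩
        simp only [Set.mem_compl_iff, Set.mem_insert_iff, Set.mem_singleton_iff, not_or]
        refine ⟨hm, hma, ?_, ?_⟩ <;> rintro rfl
        · exact h6 ham
        · exact h7 ham
      refine hcon.not_three_nbrs hdeg a b c habc.1 habc.2.1 habc.2.2.1 (by simp) (by simp) (by simp)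
        (nb a b c habc ha hb hc) ?_ ?_
      · obtain ⟨m, hm, h⟩ := nb b c a habc.rotate hb hc ha
        exact ⟨m, by simp only [Set.mem_compl_iff, Set.mem_insert_iff, Set.mem_singleton_iff] at hm ⊢
                     tauto, h⟩
      · obtain ⟨m, hm, h⟩ := nb c a b habc.rotate.rotate hc ha hb
        exact ⟨m, by simp only [Set.mem_compl_iff, Set.mem_insert_iff, Set.mem_singleton_iff] at hm ⊢
                     tauto, h⟩
    by_cases h : G.Adj p q
    · by_cases h' : G.Adj p r
      · exact main q r hq.1 hq.2.1 hq.2.2 hr.1 hr.2.1 hr.2.2 hqr (htf p q r h h')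
      · exact main p r hp.1 hp.2.1 hp.2.2 hr.1 hr.2.1 hr.2.2 hpr h'
    · exact main p q hp.1 hp.2.1 hp.2.2 hq.1 hq.2.1 hq.2.2 hpq h

end Good

/-! ### Contractions to the claw -/

section Claw

variable {V : Type*} {G : SimpleGraph V}

theorem IsClawFree.noClaw (h : IsClawFree G) : NoClaw G := by
  rintro c x y z hx hy hz ⟨h1, h2, h3, h4, h5, h6⟩
  have h4' : ¬ G.Adj y x := fun h => h4 h.symm
  have h5' : ¬ G.Adj z x := fun h => h5 h.symm
  have h6' : ¬ G.Adj z y := fun h => h6 h.symm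
  let f : Fin 1 ⊕ Fin 3 → V := Sum.elim (fun _ => c) ![x, y, z]
  have hc : ∀ i, G.Adj c (![x, y, z] i) := by
    intro i
    fin_cases i
    exacts [hx, hy, hz]
  have ht : ∀ i j, ¬ G.Adj (![x, y, z] i) (![x, y, z] j) := by
    intro i j
    fin_cases i <;> fin_cases j
    exacts [G.loopless.irrefl _, h4, h5, h4', G.loopless.irrefl _, h6, h5', h6',
      G.loopless.irrefl _]
  have hadj : ∀ i j, G.Adj (f i) (f j) ↔ clawGraph.Adj i j := by
    rintro (i | i) (j | j)
    · exact iff_of_false (G.loopless.irrefl c) (by simp)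
    · exact iff_of_true (hc j) (by simp)
    · exact iff_of_true (hc i).symm (by simp)
    · exact iff_of_false (ht i j) (by simp)
  refine h ⟨⟨⟨f, ?_⟩, ?_⟩⟩
  · rintro (i | i) (j | j) hij
    · exact congrArg _ (Subsingleton.elim i j)
    · exact absurd hij (hc j).ne
    · exact absurd hij (hc i).ne'
    · refine congrArg _ ?_
      replace hij : ![x, y, z] i = ![x, y, z] j := hij
      fin_cases i <;> fin_cases j <;>
        first
          | rfl
          | exact absurd hij h1
          | exact absurd hij h2
          | exact absurd hij h3
          | exact absurd hij.symm h1
          | exact absurd hij.symm h2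
          | exact absurd hij.symm h3
  · exact hadj _ _

/-- Contracting the complement of an independent triple to a point turns a connected graph into a
claw, as each vertex of the triple has a neighbour outside it. -/
theorem IsClawContractibleFree.cut (h : IsClawContractibleFree G) (hG : ConnOn G Set.univ)
    (x y z : V) (ht : IndepTriple G x y z) : ¬ ConnOn G {x, y, z}ᶜ := by
  classical
  intro hc
  have nb : ∀ x y z, IndepTriple G x y z → ∃ m, m ≠ x ∧ m ≠ y ∧ m ≠ z ∧ G.Adj m x := by
    rintro x y z ⟨h1, h2, h3, h4, h5, h6⟩
    obtain ⟨x', hx', m, -, hm, hxm⟩ := hG.exists_adj (A := {x}) (Set.subset_univ _) ⟨x, rfl⟩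
      (fun h => h1 (h (Set.mem_univ y)).symm)
    rw [Set.mem_singleton_iff.mp hx'] at hxm
    refine ⟨m, hm, ?_, ?_, hxm.symm⟩ <;> rintro rfl
    · exact h4 hxm
    · exact h5 hxm
  obtain ⟨mx, x1, x2, x3, x4⟩ := nb x y z ht
  obtain ⟨my, y1, y2, y3, y4⟩ := nb y z x ht.rotate
  obtain ⟨mz, z1, z2, z3, z4⟩ := nb z x y ht.rotate.rotate
  obtain ⟨h1, h2, h3, h4, h5, h6⟩ := ht
  have h4' : ¬ G.Adj y x := fun h => h4 h.symm
  have h5' : ¬ G.Adj z x := fun h => h5 h.symm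
  have h6' : ¬ G.Adj z y := fun h => h6 h.symm
  let f : V → Fin 1 ⊕ Fin 3 := fun v =>
    if v = x then Sum.inr 0 else if v = y then Sum.inr 1 else if v = z then Sum.inr 2 else Sum.inl 0
  have fx : ∀ v, f v = Sum.inr 0 ↔ v = x := by intro v; simp only [f]; split_ifs <;> simp_all
  have fy : ∀ v, f v = Sum.inr 1 ↔ v = y := by
    intro v; simp only [f]; split_ifs <;> simp_all
  have fz : ∀ v, f v = Sum.inr 2 ↔ v = z := by
    intro v; simp only [f]; split_ifs <;> simp_all
  have fc : ∀ v, f v = Sum.inl 0 ↔ v ≠ x ∧ v ≠ y ∧ v ≠ z := by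
    intro v; simp only [f]; split_ifs <;> simp_all
  refine h ⟨f, ?_, ?_⟩
  · intro w
    rw [← connOn_iff_connected]
    rcases w with i | i <;> fin_cases i
    · convert hc using 1
      ext v
      simpa using fc v
    · convert ConnOn.singleton x using 1
      ext v
      exact fx v
    · convert ConnOn.singleton y using 1
      ext v
      exact fy v
    · convert ConnOn.singleton z using 1
      ext v
      exact fz v
  · have ex : ∃ v v', f v = Sum.inl 0 ∧ f v' = Sum.inr 0 ∧ G.Adj v v' :=
      ⟨mx, x, (fc mx).mpr ⟨x1, x2, x3⟩, (fx x).mpr rfl, x4⟩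
    have ey : ∃ v v', f v = Sum.inl 0 ∧ f v' = Sum.inr 1 ∧ G.Adj v v' :=
      ⟨my, y, (fc my).mpr ⟨y3, y1, y2⟩, (fy y).mpr rfl, y4⟩
    have ez : ∃ v v', f v = Sum.inl 0 ∧ f v' = Sum.inr 2 ∧ G.Adj v v' :=
      ⟨mz, z, (fc mz).mpr ⟨z2, z3, z1⟩, (fz z).mpr rfl, z4⟩
    have sw : ∀ w w', (∃ v v', f v = w ∧ f v' = w' ∧ G.Adj v v') →
        ∃ v v', f v = w' ∧ f v' = w ∧ G.Adj v v' :=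
      fun w w' ⟨v, v', a, b, c⟩ => ⟨v', v, b, a, c.symm⟩
    have ft : ∀ i v, f v = Sum.inr i → v = ![x, y, z] i := by
      intro i v hv
      fin_cases i
      · exact (fx v).mp hv
      · exact (fy v).mp hv
      · exact (fz v).mp hv
    have ht : ∀ i j, ¬ G.Adj (![x, y, z] i) (![x, y, z] j) := by
      intro i j
      fin_cases i <;> fin_cases j
      exacts [G.loopless.irrefl _, h4, h5, h4', G.loopless.irrefl _, h6, h5', h6',
        G.loopless.irrefl _]
    have ee : ∀ i, ∃ v v', f v = Sum.inl 0 ∧ f v' = Sum.inr i ∧ G.Adj v v' := by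
      intro i
      fin_cases i
      exacts [ex, ey, ez]
    rintro (i | i) (j | j) hij
    · exact absurd (congrArg _ (Subsingleton.elim i j)) hij
    · rw [Subsingleton.elim i 0]
      exact iff_of_true (by simp) (ee j)
    · rw [Subsingleton.elim j 0]
      exact iff_of_true (by simp) (sw _ _ (ee i))
    · refine iff_of_false (by simp) ?_
      rintro ⟨v, v', a, b, c⟩
      rw [ft i v a, ft j v' b] at c
      exact ht i j c

end Claw

/-! ### Binary digits -/

section Bits

/-- The binary digit of `m` at position `i`. -/
def bitOf (m i : ℕ) : Bool := Nat.beq (Nat.mod (Nat.shiftRight m i) 2) 1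

theorem bitOf_eq (m i : ℕ) : bitOf m i = m.testBit i := by
  have h1 : Nat.mod (Nat.shiftRight m i) 2 = m / 2 ^ i % 2 := by
    rw [← Nat.shiftRight_eq_div_pow]; rfl
  have h : bitOf m i = decide (Nat.mod (Nat.shiftRight m i) 2 = 1) := by
    unfold bitOf
    rw [Bool.eq_iff_iff]; simp
  rw [h, h1, Nat.testBit_eq_decide_div_mod_eq]

/-- The number obtained from `x` by clearing its lowest nonzero binary digit. -/
def popLow (x : ℕ) : ℕ := Nat.land x (Nat.sub x 1)

theorem popLow_spec {x : ℕ} (hx : x ≠ 0) :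
    ∃ v, x.testBit v = true ∧ ∀ i, (popLow x).testBit i = (x.testBit i && decide (i ≠ v)) := by
  induction x using Nat.strong_induction_on with
  | _ x ih =>
    have hp : popLow x = x &&& (x - 1) := rfl
    rcases Nat.even_or_odd' x with ⟨y, rfl | rfl⟩
    · obtain ⟨v, hv, h⟩ := ih y (by omega) (by omega)
      refine ⟨v + 1, by rwa [Nat.testBit_succ, Nat.mul_div_cancel_left _ two_pos], fun i => ?_⟩
      rw [hp]
      rcases i with _ | i
      · simp
      · have h2 : (2 * y - 1) / 2 = y - 1 := by omega
        have := h i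
        rw [show popLow y = y &&& (y - 1) from rfl, Nat.testBit_land] at this
        rw [Nat.testBit_land, Nat.testBit_succ, Nat.testBit_succ, h2,
          Nat.mul_div_cancel_left _ two_pos, this]
        simp
    · refine ⟨0, by simp, fun i => ?_⟩
      rw [hp]
      rcases i with _ | i
      · simp
      · have h2 : (2 * y + 1) / 2 = y := by omega
        rw [Nat.add_sub_cancel, Nat.testBit_land, Nat.testBit_succ, Nat.testBit_succ, h2,
          Nat.mul_div_cancel_left _ two_pos]
        simp

theorem testBit_xor_popLow {x v : ℕ}
    (h : ∀ i, (popLow x).testBit i = (x.testBit i && decide (i ≠ v))) (hv : x.testBit v = true) :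
    x ^^^ popLow x = 2 ^ v := by
  refine Nat.eq_of_testBit_eq fun i => ?_
  rw [Nat.testBit_xor, h, Nat.testBit_two_pow]
  by_cases hi : v = i
  · subst hi; simp [hv]
  · simp [hi, Ne.symm hi]

/-- Repeats the pattern `M` of width `s * 2 ^ i` until it has width `s * 2 ^ (i + k)`. -/
def stretch (s : ℕ) : ℕ → ℕ → ℕ → ℕ
  | _, 0, M => M
  | i, k+1, M => stretch s (Nat.succ i) k (Nat.add M (Nat.shiftLeft M (Nat.mul s (Nat.pow 2 i))))

/-- In a row of `2 ^ n` blocks of `W` digits each, all digits of the blocks whose index lacks the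
binary digit `j`. -/
def lack (W n j : ℕ) : ℕ :=
  stretch W (Nat.succ j) (Nat.sub n (Nat.succ j)) (Nat.sub (Nat.pow 2 (Nat.mul W (Nat.pow 2 j))) 1)

theorem stretch_testBit {s : ℕ} (hs : 0 < s) (k : ℕ) : ∀ {i M : ℕ}, M < 2 ^ (s * 2 ^ i) → ∀ m,
    (stretch s i k M).testBit m = (decide (m < s * 2 ^ (i + k)) && M.testBit (m % (s * 2 ^ i))) := by
  induction k with
  | zero =>
    intro i M hM m
    simp only [stretch, Nat.add_zero]
    by_cases h : m < s * 2 ^ i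
    · simp [h, Nat.mod_eq_of_lt h]
    · simp [h, Nat.testBit_lt_two_pow (hM.trans_le (Nat.pow_le_pow_right two_pos (not_lt.mp h)))]
  | succ k ih =>
    intro i M hM m
    have e : Nat.add M (Nat.shiftLeft M (Nat.mul s (Nat.pow 2 i))) = 2 ^ (s * 2 ^ i) * M + M := by
      change M + M <<< (s * 2 ^ i) = _
      rw [Nat.shiftLeft_eq]; ring
    have e2 : s * 2 ^ (i + 1) = s * 2 ^ i + s * 2 ^ i := by ring
    have hpos : 0 < s * 2 ^ i := by positivity
    have hlt : 2 ^ (s * 2 ^ i) * M + M < 2 ^ (s * 2 ^ (i + 1)) := by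
      rw [e2, pow_add]
      calc 2 ^ (s * 2 ^ i) * M + M < 2 ^ (s * 2 ^ i) * M + 2 ^ (s * 2 ^ i) := by omega
        _ = 2 ^ (s * 2 ^ i) * (M + 1) := by ring
        _ ≤ _ := Nat.mul_le_mul_left _ hM
    simp only [stretch]
    rw [Nat.succ_eq_add_one, e, ih hlt, Nat.testBit_two_pow_mul_add _ hM, e2,
      show i + 1 + k = i + (k + 1) by ring]
    congr 1
    have hm : m % (s * 2 ^ i) = m % (s * 2 ^ i + s * 2 ^ i) % (s * 2 ^ i) := by
      rw [Nat.mod_mod_of_dvd]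
      exact ⟨2, by ring⟩
    rw [hm]
    have := Nat.mod_lt m (show 0 < s * 2 ^ i + s * 2 ^ i by omega)
    generalize m % (s * 2 ^ i + s * 2 ^ i) = r at *
    split_ifs with h
    · rw [Nat.mod_eq_of_lt h]
    · rw [Nat.mod_eq_sub_mod (not_lt.mp h), Nat.mod_eq_of_lt (by omega)]

theorem lack_testBit {W n j : ℕ} (hW : 0 < W) (hj : j < n) (m : ℕ) :
    (lack W n j).testBit m = (decide (m < W * 2 ^ n) && !(m / W).testBit j) := by
  have hpos : 0 < W * 2 ^ j := by positivity
  have hlt : 2 ^ (W * 2 ^ j) - 1 < 2 ^ (W * 2 ^ (j + 1)) := by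
    have : 2 ^ (W * 2 ^ j) ≤ 2 ^ (W * 2 ^ (j + 1)) := Nat.pow_le_pow_right two_pos
      (Nat.mul_le_mul_left _ (Nat.pow_le_pow_right two_pos (Nat.le_succ _)))
    have := Nat.two_pow_pos (W * 2 ^ j)
    omega
  have h1 := stretch_testBit hW (n - (j + 1)) hlt m
  rw [show j + 1 + (n - (j + 1)) = n by omega] at h1
  refine Eq.trans h1 ?_
  congr 1
  rw [Nat.testBit_two_pow_sub_one, Nat.testBit_eq_decide_div_mod_eq, Nat.div_div_eq_div_mul]
  have e2 : W * 2 ^ (j + 1) = W * 2 ^ j * 2 := by ring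
  rw [e2, Nat.mod_mul]
  have := Nat.mod_lt m hpos
  rcases Nat.mod_two_eq_zero_or_one (m / (W * 2 ^ j)) with h | h <;> rw [h] <;> simp [this]

end Bits

/-! ### Graphs coded by numbers -/

section Codes

/-- `R` codes the graph `G` with vertices `0, …, n - 1`: the digit `32 * i + j` of `R` says whether
`i` and `j` are adjacent. -/
structure Codes (n R : ℕ) (G : SimpleGraph ℕ) : Prop where
  lt : ∀ i j, G.Adj i j → i < n
  le : n ≤ 32
  adj : ∀ i j, j < 32 → (R.testBit (32 * i + j) = true ↔ G.Adj i j)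

/-- The graph `G` restricted to the vertices `0, …, n - 1`. -/
abbrev onFin (n : ℕ) (G : SimpleGraph ℕ) : SimpleGraph (Fin n) := G.comap Fin.val

variable {n R : ℕ} {G : SimpleGraph ℕ}

/-- Reads off the adjacency of `i` and `j`. -/
def adjBit (R i j : ℕ) : Bool := bitOf R (Nat.add (Nat.mul 32 i) j)

theorem Codes.adjBit_iff (h : Codes n R G) {i j : ℕ} (hj : j < n) :
    adjBit R i j = true ↔ G.Adj i j := by
  rw [← h.adj i j (hj.trans_le h.le), adjBit, bitOf_eq]
  rfl

/-- Spreads the lowest `k` digits of `N` so that they are `32` places apart. -/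
def spread (N : ℕ) : ℕ → ℕ
  | 0 => 0
  | k+1 => bif bitOf N k then Nat.lor (Nat.pow 2 (Nat.mul 32 k)) (spread N k) else spread N k

theorem spread_testBit (N k i j : ℕ) (hj : j < 32) :
    (spread N k).testBit (32 * i + j) = (decide (j = 0) && (decide (i < k) && N.testBit i)) := by
  induction k with
  | zero => simp [spread]
  | succ k ih =>
    have e : Nat.lor (Nat.pow 2 (Nat.mul 32 k)) (spread N k) = 2 ^ (32 * k) ||| spread N k := rfl
    rw [spread, e, bitOf_eq]
    have e2 : (32 * k = 32 * i + j) ↔ (i = k ∧ j = 0) := by omega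
    by_cases hi : i = k
    · subst hi
      cases hb : N.testBit i <;> simp [ih, Nat.testBit_two_pow, hb]
    · have e3 : i < k + 1 ↔ i < k := by omega
      cases N.testBit k <;> simp [ih, e2, hi, e3]

/-- The code of the graph obtained by adding the vertex `n` with the set `N` of neighbours. -/
def addVertex (n R N : ℕ) : ℕ :=
  Nat.lor (Nat.lor R (Nat.shiftLeft N (Nat.mul 32 n))) (Nat.shiftLeft (spread N n) n)

/-- The graph `G` with the additional vertex `n`, joined to the members of `N` below `n`. -/
def extend (n N : ℕ) (G : SimpleGraph ℕ) : SimpleGraph ℕ where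
  Adj i j := G.Adj i j ∨ (i = n ∧ j < n ∧ N.testBit j = true) ∨ (j = n ∧ i < n ∧ N.testBit i = true)
  symm := ⟨fun i j h => by
    rcases h with h | h | h
    · exact Or.inl h.symm
    · exact Or.inr (Or.inr h)
    · exact Or.inr (Or.inl h)⟩
  loopless := ⟨fun i h => by
    rcases h with h | h | h
    · exact G.loopless.irrefl i h
    · omega
    · omega⟩

theorem Codes.addVertex (h : Codes n R G) (hn : n < 32) {N : ℕ} (hN : N < 2 ^ n) :
    Codes (n + 1) (addVertex n R N) (extend n N G) := by
  have hNb : ∀ j, N.testBit j = true → j < n := fun j hj => by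
    by_contra hc
    rw [Nat.testBit_lt_two_pow (hN.trans_le (Nat.pow_le_pow_right two_pos (not_lt.mp hc)))] at hj
    exact absurd hj (by simp)
  have hlt' : ∀ i j, G.Adj i j → j < n := fun i j hij => h.lt j i hij.symm
  refine ⟨?_, hn, fun i j hj => ?_⟩
  · rintro i j (hij | hij | hij)
    · exact (h.lt i j hij).trans (Nat.lt_succ_self n)
    · omega
    · omega
  · have e : _root_.addVertex n R N = R ||| N <<< (32 * n) ||| spread N n <<< n := rfl
    rw [e, Nat.testBit_lor, Nat.testBit_lor, Nat.testBit_shiftLeft, Nat.testBit_shiftLeft,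
      Bool.or_eq_true, Bool.or_eq_true, h.adj i j hj, or_assoc]
    refine or_congr Iff.rfl (or_congr ?_ ?_)
    · simp only [ge_iff_le, Bool.and_eq_true, decide_eq_true_eq]
      constructor
      · rintro ⟨h1, h2⟩
        have := hNb _ h2
        have hi : i = n := by omega
        subst hi
        rw [Nat.add_sub_cancel_left] at h2
        exact ⟨rfl, hNb _ h2, h2⟩
      · rintro ⟨rfl, h1, h2⟩
        refine ⟨by omega, ?_⟩
        rwa [Nat.add_sub_cancel_left]
    · simp only [ge_iff_le, Bool.and_eq_true, decide_eq_true_eq]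
      constructor
      · rintro ⟨h1, h2⟩
        by_cases hjn : n ≤ j
        · rw [show 32 * i + j - n = 32 * i + (j - n) by omega, spread_testBit _ _ _ _ (by omega)] at h2
          simp only [Bool.and_eq_true, decide_eq_true_eq] at h2
          exact ⟨by omega, h2.2⟩
        · rw [show 32 * i + j - n = 32 * (i - 1) + (32 + j - n) by omega,
            spread_testBit _ _ _ _ (by omega)] at h2
          simp only [Bool.and_eq_true, decide_eq_true_eq] at h2
          omega
      · rintro ⟨rfl, h1⟩
        refine ⟨by omega, ?_⟩
        rw [Nat.add_sub_cancel, show 32 * i = 32 * i + 0 from rfl, spread_testBit _ _ _ _ (by omega)]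
        simp [h1]

end Codes

/-! ### Renumbering the vertices -/

section Normal

/-- The digits `0, 32, 64, …`, `n` in number. -/
def ones : ℕ → ℕ
  | 0 => 0
  | k+1 => Nat.lor 1 (Nat.shiftLeft (ones k) 32)

theorem ones_testBit (n i j : ℕ) (hj : j < 32) :
    (ones n).testBit (32 * i + j) = (decide (i < n) && decide (j = 0)) := by
  induction n generalizing i with
  | zero => simp [ones]
  | succ n ih =>
    have e : ones (n + 1) = 2 ^ 0 ||| ones n <<< 32 := rfl
    rw [e, Nat.testBit_lor, Nat.testBit_two_pow, Nat.testBit_shiftLeft]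
    rcases i with _ | i
    · have h1 : ¬ 32 ≤ j := by omega
      have h2 : 0 = j ↔ j = 0 := eq_comm
      simp [h1, h2]
    · rw [show 32 * (i + 1) + j - 32 = 32 * i + j by omega, ih]
      have h1 : ¬ (0 = 32 * (i + 1) + j) := by omega
      have h2 : 32 * (i + 1) + j ≥ 32 := by omega
      simp [h1, h2]

/-- The rows of `R`, with `C` marking the beginning of each row, as columns. -/
def columns (R C : ℕ) : ℕ → ℕ → List ℕ
  | _, 0 => []
  | j, k+1 => Nat.land (Nat.shiftRight R j) C :: columns R C (Nat.succ j) k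

/-- The product of the matrix with the given columns and the vector whose entries are the digits of
`c` in base `2 ^ 32`; the result holds its entries in the same way. -/
def walk : List ℕ → ℕ → ℕ
  | [], _ => 0
  | q :: l, c => Nat.add (Nat.mul q (Nat.mod c 4294967296)) (walk l (Nat.div c 4294967296))

/-- Iterates the map `c ↦ (A + 3) c`, where `A` is the adjacency matrix and the entries are truncated by
`mask`. This spreads invariants of the vertices along the edges. -/
def walks (cols : List ℕ) (mask : ℕ) : ℕ → ℕ → ℕ
  | 0, c => c
  | k+1, c => walks cols mask k (Nat.land (Nat.add (walk cols c) (Nat.mul 3 c)) mask)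

/-- Inserts a number into an increasing list. -/
def insertKey (k : ℕ) : List ℕ → List ℕ
  | [] => [k]
  | x :: l => bif Nat.ble k x then k :: x :: l else x :: insertKey k l

/-- The entries of `c`, each followed by the index of its vertex as a last hexadecimal digit, in
increasing order. -/
def sortKeys : ℕ → ℕ → ℕ → List ℕ
  | _, 0, _ => []
  | i, k+1, c => insertKey (Nat.add (Nat.mul 16 (Nat.mod c 4294967296)) i)
      (sortKeys (Nat.succ i) k (Nat.div c 4294967296))

/-- The closed neighbourhood of the vertex `i`. -/
def closedRow (R i : ℕ) : ℕ := Nat.lor (Nat.mod (Nat.shiftRight R (Nat.mul 32 i)) 65536) (Nat.pow 2 i)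

/-- A vertex that the invariants do not distinguish from another one with a different closed
neighbourhood, or `99` if there is none. Twins may be exchanged, so that ties between them are harmless. -/
def tied (R : ℕ) : ℕ → List ℕ → ℕ
  | _, [] => 99
  | k, k' :: l => bif (Nat.beq (Nat.div k 16) (Nat.div k' 16)) then
       bif Nat.beq (closedRow R (Nat.mod k 16)) (closedRow R (Nat.mod k' 16)) then tied R k' l
       else Nat.mod k 16
      else tied R k' l

/-- The vertices that the keys in a list belong to. -/
def lowDigits : List ℕ → List ℕ
  | [] => []
  | k :: l => Nat.mod k 16 :: lowDigits l

/-- The vertices sorted by invariants that count weighted walks; if ties are left, one of the tied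
vertices is marked and the invariants are computed again. The order only matters
for how often isomorphic graphs are listed. -/
def vertexOrder (n R C : ℕ) : List ℕ :=
  let cols := columns R C 0 n
  let mask := Nat.mul C 16777215
  let c := walks cols mask 3 C
  let ks := sortKeys 0 n c
  let t := tied R 1000000000 ks
  lowDigits (bif Nat.beq t 99 then ks
    else sortKeys 0 n (walks cols mask 3 (Nat.add c (Nat.pow 2 (Nat.mul 32 t)))))

/-- The code `R` with its columns rearranged according to a list. -/
def permCols (R C : ℕ) : ℕ → List ℕ → ℕ
  | _, [] => 0
  | k, q :: l => Nat.lor (Nat.shiftLeft (Nat.land (Nat.shiftRight R q) C) k) (permCols R C (Nat.succ k) l)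

/-- The code `R` with its rows rearranged according to a list. -/
def permRows (R : ℕ) : List ℕ → ℕ
  | [] => 0
  | q :: l => Nat.lor (Nat.mod (Nat.shiftRight R (Nat.mul 32 q)) 4294967296)
      (Nat.shiftLeft (permRows R l) 32)

/-- The set of the members of a list, as a number with the corresponding digits. -/
def maskOf : List ℕ → ℕ
  | [] => 0
  | q :: l => Nat.lor (Nat.pow 2 q) (maskOf l)

/-- A code of a graph isomorphic to the one coded by `R`, usually the same for isomorphic graphs. -/
def normalForm (n R : ℕ) : ℕ :=
  let C := ones n
  let p := vertexOrder n R C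
  bif Nat.beq (maskOf p) (Nat.sub (Nat.pow 2 n) 1) && Nat.beq p.length n then
    permRows (permCols R C 0 p) p
  else R

variable {n R : ℕ} {G : SimpleGraph ℕ}

theorem maskOf_testBit (p : List ℕ) (i : ℕ) : (maskOf p).testBit i = true ↔ i ∈ p := by
  induction p with
  | nil => simp [maskOf]
  | cons q l ih =>
    have e : maskOf (q :: l) = 2 ^ q ||| maskOf l := rfl
    rw [e, Nat.testBit_lor, Bool.or_eq_true, ih, Nat.testBit_two_pow]
    simp [eq_comm]

theorem permCols_testBit (R : ℕ) (p : List ℕ) (k i j : ℕ) (hj : j < 32) (hk : k + p.length ≤ 32)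
    (hp : ∀ q ∈ p, q < 32) :
    (permCols R (ones n) k p).testBit (32 * i + j) = true ↔
      i < n ∧ ∃ t, ∃ h : t < p.length, j = k + t ∧ R.testBit (32 * i + p[t]) = true := by
  induction p generalizing k with
  | nil => simp [permCols]
  | cons q l ih =>
    have e : permCols R (ones n) k (q :: l)
        = ((R >>> q) &&& ones n) <<< k ||| permCols R (ones n) (k + 1) l := rfl
    rw [List.length_cons] at hk
    have hq := hp q (by simp)
    rw [e, Nat.testBit_lor, Bool.or_eq_true, ih (k + 1) (by omega) fun q' h' => hp q' (by simp [h'])]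
    have h1 : (((R >>> q) &&& ones n) <<< k).testBit (32 * i + j) = true ↔
        i < n ∧ j = k ∧ R.testBit (32 * i + q) = true := by
      rw [Nat.testBit_shiftLeft, Nat.testBit_land, Nat.testBit_shiftRight]
      simp only [ge_iff_le, Bool.and_eq_true, decide_eq_true_eq]
      by_cases hkj : k ≤ j
      · rw [show 32 * i + j - k = 32 * i + (j - k) by omega, ones_testBit _ _ _ (by omega)]
        simp only [Bool.and_eq_true, decide_eq_true_eq]
        constructor
        · rintro ⟨a, b, c, d⟩
          have hjk : j = k := by omega
          subst hjk
          rw [Nat.sub_self] at b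
          refine ⟨c, rfl, ?_⟩
          convert b using 2
          omega
        · rintro ⟨a, rfl, c⟩
          refine ⟨by omega, ?_, a, by omega⟩
          convert c using 2
          omega
      · refine iff_of_false ?_ (by omega)
        rintro ⟨a, b, c⟩
        rw [show 32 * i + j - k = 32 * (i - 1) + (32 + j - k) by omega, ones_testBit _ _ _ (by omega)] at c
        simp only [Bool.and_eq_true, decide_eq_true_eq] at c
        omega
    rw [h1]
    constructor
    · rintro (⟨a, b, c⟩ | ⟨a, t, ht, b, c⟩)
      · exact ⟨a, 0, by simp, by omega, by simpa using c⟩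
      · exact ⟨a, t + 1, by simpa using ht, by omega, by simpa using c⟩
    · rintro ⟨a, t, ht, b, c⟩
      rcases t with _ | t
      · exact Or.inl ⟨a, by omega, by simpa using c⟩
      · exact Or.inr ⟨a, t, by simpa using ht, by omega, by simpa using c⟩

theorem permRows_testBit (R : ℕ) (p : List ℕ) (i j : ℕ) (hj : j < 32) :
    (permRows R p).testBit (32 * i + j) = true ↔
      ∃ h : i < p.length, R.testBit (32 * p[i] + j) = true := by
  induction p generalizing i with
  | nil => simp [permRows]
  | cons q l ih =>
    have e : permRows R (q :: l) = (R >>> (32 * q)) % 2 ^ 32 ||| permRows R l <<< 32 := rfl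
    rw [e, Nat.testBit_lor, Bool.or_eq_true, Nat.testBit_mod_two_pow, Nat.testBit_shiftRight,
      Nat.testBit_shiftLeft]
    rcases i with _ | i
    · simp [hj]
    · rw [show 32 * (i + 1) + j - 32 = 32 * i + j by omega]
      have h1 : ¬ (32 * (i + 1) + j < 32) := by omega
      have h2 : 32 * (i + 1) + j ≥ 32 := by omega
      simp [h1, h2, ih]

theorem Codes.normalForm (h : Codes n R G) :
    ∃ G', Codes n (normalForm n R) G' ∧ Nonempty (onFin n G ≃g onFin n G') := by
  unfold _root_.normalForm
  simp only
  set p := vertexOrder n R (ones n)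
  rcases hb : (Nat.beq (maskOf p) (Nat.sub (Nat.pow 2 n) 1) && Nat.beq p.length n) with _ | _
  · exact ⟨G, h, ⟨SimpleGraph.Iso.refl⟩⟩
  · simp only [cond]
    rw [Bool.and_eq_true, Nat.beq_eq, Nat.beq_eq] at hb
    obtain ⟨hm, hl⟩ := hb
    have hm' : maskOf p = 2 ^ n - 1 := hm
    have hmem : ∀ i, i ∈ p ↔ i < n := fun i => by
      rw [← maskOf_testBit, hm', Nat.testBit_two_pow_sub_one, decide_eq_true_eq]
    have hlt : ∀ i (hi : i < p.length), p[i] < n := fun i hi => (hmem _).mp (List.getElem_mem hi)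
    let f : Fin n → Fin n := fun i => ⟨p[i.1]'(by omega), hlt _ _⟩
    have hf : Function.Bijective f := by
      rw [← Finite.surjective_iff_bijective]
      intro j
      obtain ⟨i, hi, hij⟩ := List.getElem_of_mem ((hmem j).mpr j.2)
      exact ⟨⟨i, by omega⟩, Fin.ext hij⟩
    have hbits : ∀ i j, j < 32 → ((permRows (permCols R (ones n) 0 p) p).testBit (32 * i + j) = true ↔
        ∃ (hi : i < n) (hj : j < n), G.Adj (f ⟨i, hi⟩) (f ⟨j, hj⟩)) := by
      intro i j hj
      rw [permRows_testBit _ _ _ _ hj]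
      constructor
      · rintro ⟨hi, hb⟩
        rw [permCols_testBit _ _ _ _ _ hj (by have := h.le; omega)
          fun q hq => ((hmem q).mp hq).trans_le h.le] at hb
        obtain ⟨-, t, ht, hjt, hb⟩ := hb
        obtain rfl : j = t := by omega
        exact ⟨by omega, by omega, (h.adj _ _ ((hlt _ _).trans_le h.le)).mp hb⟩
      · rintro ⟨hi, hj', ha⟩
        refine ⟨by omega, ?_⟩
        rw [permCols_testBit _ _ _ _ _ hj (by have := h.le; omega)
          fun q hq => ((hmem q).mp hq).trans_le h.le]
        exact ⟨hlt _ _, j, by omega, by omega, (h.adj _ _ ((hlt _ _).trans_le h.le)).mpr ha⟩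
    let G' : SimpleGraph ℕ :=
      { Adj := fun i j => ∃ (hi : i < n) (hj : j < n), G.Adj (f ⟨i, hi⟩) (f ⟨j, hj⟩)
        symm := ⟨fun i j ⟨hi, hj, ha⟩ => ⟨hj, hi, ha.symm⟩⟩
        loopless := ⟨fun i ⟨hi, hj, ha⟩ => G.loopless.irrefl _ ha⟩ }
    refine ⟨G', ⟨fun i j ⟨hi, _, _⟩ => hi, h.le, hbits⟩, ⟨SimpleGraph.Iso.symm
      ⟨Equiv.ofBijective f hf, ?_⟩⟩⟩
    intro i j
    exact ⟨fun ha => ⟨i.2, j.2, ha⟩, fun ⟨_, _, ha⟩ => ha⟩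

end Normal

/-! ### Adding a vertex -/

section Extension

variable {n R : ℕ} {G H : SimpleGraph ℕ}

/-- The vertices coded by the digits of `x`. -/
def digitSet (x : ℕ) : Set ℕ := {i | x.testBit i = true}

theorem ConnOn.mono_graph {V : Type*} {G H : SimpleGraph V} {S : Set V} (hGH : G ≤ H)
    (h : ConnOn G S) : ConnOn H S :=
  ⟨h.1, fun A h1 h2 h3 => h.2 A h1 h2 fun a ha b hb hab => h3 a ha b hb (hGH hab)⟩

theorem ConnOn.union_nbrs {V : Type*} {G : SimpleGraph V} {S T : Set V} {s : V} (h : ConnOn G S)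
    (hs : s ∈ S) (hT : ∀ t ∈ T, G.Adj s t) : ConnOn G (S ∪ T) := by
  refine ⟨⟨s, Or.inl hs⟩, fun A hA ⟨a, ha⟩ hcl => ?_⟩
  have h1 : S ⊆ A := by
    have h2 : (A ∩ S).Nonempty := by
      rcases hA ha with h3 | h3
      · exact ⟨a, ha, h3⟩
      · exact ⟨s, hcl a ha s (Or.inl hs) (hT a h3).symm, hs⟩
    exact (h.2 (A ∩ S) Set.inter_subset_right h2
      (fun p hp q hq hpq => ⟨hcl p hp.1 q (Or.inl hq) hpq, hq⟩)).trans Set.inter_subset_left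
  exact Set.union_subset h1 fun t ht => hcl s (h1 hs) t (Or.inr ht) (hT t ht)

/-- Searches the graph coded by `R`: `fr` holds the vertices that have been reached but not yet
processed, `al` those not yet reached. The result holds the vertices that have not been reached
after at most `k` steps. -/
def grow (R : ℕ) : ℕ → ℕ → ℕ → ℕ
  | 0, al, _ => al
  | k+1, al, fr => bif Nat.beq fr 0 then al else
      let rest := popLow fr
      let new := Nat.land (Nat.div R (Nat.pow (Nat.xor fr rest) 32)) al
      grow R k (Nat.xor al new) (Nat.lor rest new)

theorem Codes.grow (h : Codes n R G) {S : Set ℕ} (k : ℕ) : ∀ al fr, digitSet al ⊆ Set.Iio n →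
    digitSet al ⊆ S → digitSet fr ⊆ S \ digitSet al → ConnOn G (S \ digitSet al) →
    digitSet (grow R k al fr) ⊆ digitSet al ∧ ConnOn G (S \ digitSet (grow R k al fr)) := by
  induction k with
  | zero => exact fun al fr _ _ _ hc => ⟨subset_rfl, hc⟩
  | succ k ih =>
    intro al fr hn hS hfr hc
    simp only [_root_.grow]
    rcases hb : Nat.beq fr 0 with _ | _
    · simp only [cond]
      have hfr0 : fr ≠ 0 := by
        intro h0
        rw [h0] at hb
        exact absurd hb (by decide)
      obtain ⟨v, hv, hpop⟩ := popLow_spec hfr0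
      have e1 : Nat.div R (Nat.pow (Nat.xor fr (popLow fr)) 32) = R >>> (32 * v) := by
        change R / (fr ^^^ popLow fr) ^ 32 = _
        rw [testBit_xor_popLow hpop hv, ← pow_mul, Nat.shiftRight_eq_div_pow, mul_comm]
      rw [e1]
      set new := Nat.land (R >>> (32 * v)) al with hnew
      have hnew' : ∀ i, new.testBit i = true ↔ al.testBit i = true ∧ G.Adj v i := by
        intro i
        have : new = (R >>> (32 * v)) &&& al := rfl
        rw [this, Nat.testBit_land, Nat.testBit_shiftRight, Bool.and_eq_true, and_comm]
        exact and_congr_right fun hi => h.adj v i ((hn hi).trans_le h.le)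
      have hxor : ∀ i, (Nat.xor al new).testBit i = true ↔ al.testBit i = true ∧ ¬ G.Adj v i := by
        intro i
        have : Nat.xor al new = al ^^^ new := rfl
        have h2 := hnew' i
        rw [this, Nat.testBit_xor]
        cases h3 : al.testBit i <;> cases h4 : new.testBit i <;> simp_all
      have hdiff : S \ digitSet (Nat.xor al new) = S \ digitSet al ∪ digitSet new := by
        ext i
        have h2 := hnew' i
        have h3 := hxor i
        have h4 := @hS i
        simp only [digitSet, Set.mem_sdiff, Set.mem_union, Set.mem_ofPred_eq] at *
        tauto
      have hsub : digitSet (Nat.xor al new) ⊆ digitSet al := fun i hi => ((hxor i).mp hi).1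
      obtain ⟨r1, r2⟩ := ih (Nat.xor al new) (Nat.lor (popLow fr) new) (hsub.trans hn)
        (hsub.trans hS) (by
          intro i hi
          rw [hdiff]
          have : Nat.lor (popLow fr) new = popLow fr ||| new := rfl
          rw [digitSet, Set.mem_ofPred_eq, this, Nat.testBit_lor, Bool.or_eq_true] at hi
          refine hi.imp (fun hi => hfr ?_) id
          rw [hpop, Bool.and_eq_true] at hi
          exact hi.1) (by
          rw [hdiff]
          exact hc.union_nbrs (hfr hv) fun t ht => ((hnew' t).mp ht).2)
      exact ⟨r1.trans hsub, r2⟩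
    · exact ⟨subset_rfl, hc⟩

/-- The members of `al` not reached from its lowest member. -/
def growTop (R n al : ℕ) : ℕ := grow R n (popLow al) (Nat.xor al (popLow al))

theorem Codes.growTop (h : Codes n R G) {al : ℕ} (h0 : al ≠ 0) (hn : digitSet al ⊆ Set.Iio n) :
    digitSet (growTop R n al) ⊆ digitSet al ∧ ConnOn G (digitSet al \ digitSet (growTop R n al)) := by
  obtain ⟨v, hv, hpop⟩ := popLow_spec h0
  have hsub : digitSet (popLow al) ⊆ digitSet al := fun i hi => by
    rw [digitSet, Set.mem_ofPred_eq, hpop, Bool.and_eq_true] at hi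
    exact hi.1
  have hd : digitSet al \ digitSet (popLow al) = {v} := by
    ext i
    have := hpop i
    simp only [digitSet, Set.mem_sdiff, Set.mem_ofPred_eq, Set.mem_singleton_iff, this]
    by_cases hi : i = v
    · subst hi; simp [hv]
    · simp [hi]
  have e : Nat.xor al (popLow al) = 2 ^ v := testBit_xor_popLow hpop hv
  unfold _root_.growTop
  rw [e]
  obtain ⟨r1, r2⟩ := h.grow (S := digitSet al) n (popLow al) (2 ^ v) (hsub.trans hn) hsub (by
    rw [hd]
    intro i hi
    rw [digitSet, Set.mem_ofPred_eq, Nat.testBit_two_pow, decide_eq_true_eq] at hi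
    exact hi.symm) (hd ▸ ConnOn.singleton v)
  exact ⟨r1.trans hsub, r2⟩

/-- A partition of `al` into connected sets. An empty piece is added should the number `k` of steps
be too small. -/
def pieces (R n : ℕ) : ℕ → ℕ → List ℕ
  | 0, _ => [0]
  | k+1, al => bif Nat.beq al 0 then [] else
      let rest := growTop R n al
      Nat.xor al rest :: pieces R n k rest

theorem Codes.pieces (h : Codes n R G) (hGH : G ≤ H) {w : ℕ} (k : ℕ) : ∀ (al : ℕ) (S : Set ℕ),
    digitSet al ⊆ Set.Iio n → ConnOn H S → w ∈ S →
    (∀ C ∈ pieces R n k al, ∃ c, C.testBit c = true ∧ H.Adj w c) → ConnOn H (S ∪ digitSet al) := by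
  induction k with
  | zero =>
    intro al S _ _ _ hC
    obtain ⟨c, hc, _⟩ := hC 0 (by simp [_root_.pieces])
    simp at hc
  | succ k ih =>
    intro al S hn hS hw hC
    by_cases h0 : al = 0
    · subst h0
      have : digitSet 0 = ∅ := by ext; simp [digitSet]
      rwa [this, Set.union_empty]
    · have hb : Nat.beq al 0 = false := by
        rw [Bool.eq_false_iff]
        exact fun hb => h0 (Nat.eq_of_beq_eq_true hb)
      simp only [_root_.pieces, hb, cond, List.mem_cons, forall_eq_or_imp] at hC
      obtain ⟨⟨c, hc, hwc⟩, hC⟩ := hC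
      obtain ⟨r1, r2⟩ := h.growTop h0 hn
      set rest := _root_.growTop R n al
      have hx : ∀ i, (Nat.xor al rest).testBit i = true ↔ i ∈ digitSet al \ digitSet rest := by
        intro i
        have e : Nat.xor al rest = al ^^^ rest := rfl
        have h1 := @r1 i
        rw [e, Nat.testBit_xor]
        simp only [digitSet, Set.mem_ofPred_eq, Set.mem_sdiff] at *
        cases h3 : al.testBit i <;> cases h4 : rest.testBit i <;> simp_all
      have hU := hS.union (r2.mono_graph hGH) hw ((hx c).mp hc) (Or.inr hwc)
      have := ih rest _ (r1.trans hn) hU (Or.inl hw) hC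
      rwa [Set.union_assoc, Set.sdiff_union_of_subset r1] at this

/-- A vertex `ix` with the sets of those `N` that lack it and that contain it. -/
structure VertexItem where
  ix : ℕ
  no : ℕ
  yes : ℕ

/-- The items of the vertices `k - 1, …, 0`. -/
def items (n full : ℕ) : ℕ → List VertexItem
  | 0 => []
  | k+1 => let m := lack 1 n k; ⟨k, m, Nat.xor full m⟩ :: items n full k

/-- What an item of a graph on `n` vertices has to satisfy. -/
structure VertexItem.Valid (n : ℕ) (i : VertexItem) : Prop where
  lt : i.ix < n
  no_iff : ∀ N, N < 2 ^ n → (i.no.testBit N = true ↔ N.testBit i.ix = false)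
  yes_iff : ∀ N, N < 2 ^ n → (i.yes.testBit N = true ↔ N.testBit i.ix = true)

/-- The set of all sets of vertices. -/
def fullSet (n : ℕ) : ℕ := Nat.sub (Nat.pow 2 (Nat.pow 2 n)) 1

theorem testBit_fullSet (n N : ℕ) : (fullSet n).testBit N = decide (N < 2 ^ n) :=
  Nat.testBit_two_pow_sub_one _ _

theorem valid_item {k : ℕ} (hk : k < n) :
    VertexItem.Valid n ⟨k, lack 1 n k, Nat.xor (fullSet n) (lack 1 n k)⟩ := by
  have h1 : ∀ N, N < 2 ^ n → (lack 1 n k).testBit N = !N.testBit k := fun N hN => by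
    rw [lack_testBit one_pos hk, one_mul, Nat.div_one]
    simp [hN]
  refine ⟨hk, fun N hN => by simp [h1 N hN], fun N hN => ?_⟩
  have e : Nat.xor (fullSet n) (lack 1 n k) = fullSet n ^^^ lack 1 n k := rfl
  simp only
  rw [e, Nat.testBit_xor, h1 N hN, testBit_fullSet]
  simp [hN]

theorem items_valid {k : ℕ} (hk : k ≤ n) : ∀ i ∈ items n (fullSet n) k, i.Valid n ∧ i.ix < k := by
  induction k with
  | zero => simp [items]
  | succ k ih =>
    intro i hi
    simp only [items, List.mem_cons] at hi
    rcases hi with rfl | hi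
    · exact ⟨valid_item hk, Nat.lt_succ_self k⟩
    · exact ⟨(ih (by omega) i hi).1, (ih (by omega) i hi).2.trans (Nat.lt_succ_self k)⟩

/-- The sets that meet `C`. -/
def meets : List VertexItem → ℕ → ℕ
  | [], _ => 0
  | i :: l, C => bif bitOf C i.ix then Nat.lor i.yes (meets l C) else meets l C

/-- The sets that meet all members of a list. -/
def meetsAll (I : List VertexItem) (full : ℕ) : List ℕ → ℕ
  | [] => full
  | C :: l => Nat.land (meets I C) (meetsAll I full l)

theorem meets_testBit {I : List VertexItem} (hI : ∀ i ∈ I, i.Valid n) {N : ℕ} (hN : N < 2 ^ n) {C : ℕ}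
    (h : (meets I C).testBit N = true) :
    ∃ c, c < n ∧ C.testBit c = true ∧ N.testBit c = true := by
  induction I with
  | nil => simp [meets] at h
  | cons i l ih =>
    have ih' := ih fun j hj => hI j (by simp [hj])
    have hi := hI i (by simp)
    rw [meets, bitOf_eq] at h
    rcases hb : C.testBit i.ix with _ | _
    · rw [hb] at h
      exact ih' h
    · rw [hb] at h
      have e : Nat.lor i.yes (meets l C) = i.yes ||| meets l C := rfl
      simp only [cond] at h
      rw [e, Nat.testBit_lor, Bool.or_eq_true, hi.yes_iff N hN] at h
      rcases h with h | h
      · exact ⟨i.ix, hi.lt, hb, h⟩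
      · exact ih' h

theorem meetsAll_testBit {I : List VertexItem} (hI : ∀ i ∈ I, i.Valid n) {N full : ℕ} (hN : N < 2 ^ n)
    {l : List ℕ} (h : (meetsAll I full l).testBit N = true) :
    ∀ C ∈ l, ∃ c, c < n ∧ C.testBit c = true ∧ N.testBit c = true := by
  induction l with
  | nil => simp
  | cons C l ih =>
    have e : meetsAll I full (C :: l) = meets I C &&& meetsAll I full l := rfl
    rw [e, Nat.testBit_land, Bool.and_eq_true] at h
    intro D hD
    rcases List.mem_cons.mp hD with rfl | hD
    · exact meets_testBit hI hN h.1
    · exact ih h.2 D hD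

/-- The sets of neighbours of a new vertex that are excluded by the triple `k`, `j`, `i`: they cause
a claw, or the triple is independent but fails to be a cut set. Here `al` is the complement of
`{k, j}` and `a` says whether `k` and `j` are adjacent. -/
def badTriple (R n full al : ℕ) (I : List VertexItem) (k j i : VertexItem) (a : Bool) : ℕ :=
  bif a then
    bif adjBit R k.ix i.ix then
      (bif adjBit R j.ix i.ix then 0 else Nat.land k.yes (Nat.land j.no i.no))
    else bif adjBit R j.ix i.ix then Nat.land j.yes (Nat.land k.no i.no) else 0
  else
    bif adjBit R k.ix i.ix then
      bif adjBit R j.ix i.ix then Nat.land i.yes (Nat.land k.no j.no) else 0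
    else bif adjBit R j.ix i.ix then 0 else
      Nat.lor (Nat.land k.yes (Nat.land j.yes i.yes))
        (meetsAll I full (pieces R n n (Nat.xor al (Nat.pow 2 i.ix))))

/-- The sets of neighbours excluded by the triples that consist of `k`, `j` and a member of a list. -/
def badTriples (R n full al : ℕ) (I : List VertexItem) (k j : VertexItem) (a : Bool) :
    List VertexItem → ℕ
  | [] => 0
  | i :: l => Nat.lor (badTriple R n full al I k j i a) (badTriples R n full al I k j a l)

/-- The sets of neighbours excluded by the pair `k`, `j` of vertices: if these are adjacent twins, a
set that contains only `k` can be replaced by a smaller one; if they are not adjacent, together with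
the new vertex they may form an independent triple that is no cut set. -/
def badPair (R n al : ℕ) (k j : VertexItem) (a : Bool) : ℕ :=
  bif a then
    bif Nat.beq (closedRow R k.ix) (closedRow R j.ix) then Nat.land k.yes j.no else 0
  else bif Nat.beq (growTop R n al) 0 then Nat.land k.no j.no else 0

/-- The sets of neighbours excluded by `k`, a member `j` of a list, and possibly a later member. -/
def badPairs (R n full al : ℕ) (I : List VertexItem) (k : VertexItem) : List VertexItem → ℕ
  | [] => 0
  | j :: l =>
    let a := adjBit R k.ix j.ix
    let al' := Nat.xor al (Nat.pow 2 j.ix)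
    Nat.lor (Nat.lor (badPair R n al' k j a) (badTriples R n full al' I k j a l))
      (badPairs R n full al I k l)

/-- The sets of neighbours excluded by the pairs and triples of members of a list. -/
def badSets (R n full : ℕ) (I : List VertexItem) : List VertexItem → ℕ
  | [] => 0
  | k :: l => Nat.lor
      (badPairs R n full (Nat.xor (Nat.sub (Nat.pow 2 n) 1) (Nat.pow 2 k.ix)) I k l)
      (badSets R n full I l)

/-- The sets that have to be considered as the set of neighbours of a new vertex. -/
def goodSets (R n full : ℕ) (I : List VertexItem) : ℕ :=
  Nat.land full (Nat.xor full (Nat.lor 1 (badSets R n full I I)))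

/-- `N` can be the set of neighbours of the new vertex in a good graph, and is minimal. -/
structure Admissible (n : ℕ) (G : SimpleGraph ℕ) (N : ℕ) : Prop where
  lt : N < 2 ^ n
  ne : N ≠ 0
  noClaw : NoClaw (extend n N G)
  cut : ∀ x y z, x < n + 1 → y < n + 1 → z < n + 1 → IndepTriple (extend n N G) x y z →
    ¬ ConnOn (extend n N G) (Set.Iio (n + 1) \ {x, y, z})
  twin : ∀ j k, j < k → k < n → G.Adj k j → (∀ m, m ≠ j → m ≠ k → (G.Adj k m ↔ G.Adj j m)) →
    ¬ (N.testBit k = true ∧ N.testBit j = false)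

theorem extend_adj {N i j : ℕ} (hi : i < n) (hj : j < n) :
    (extend n N G).Adj i j ↔ G.Adj i j := by
  change (_ ∨ _ ∨ _) ↔ _
  constructor
  · rintro (h | h | h)
    · exact h
    · omega
    · omega
  · exact Or.inl

theorem extend_adj_new (hlt : ∀ i j, G.Adj i j → i < n) {N i : ℕ} (hi : i < n) :
    (extend n N G).Adj n i ↔ N.testBit i = true := by
  change (_ ∨ _ ∨ _) ↔ _
  constructor
  · rintro (h | h | h)
    · exact absurd (hlt _ _ h) (lt_irrefl n)
    · exact h.2.2
    · omega
  · exact fun h => Or.inr (Or.inl ⟨rfl, hi, h⟩)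

theorem Admissible.no_claw_at {N : ℕ} (hN : Admissible n G N) (h : Codes n R G) {c x y : ℕ}
    (hc : c < n) (hx : x < n) (hy : y < n) (hxy : x ≠ y) (cx : G.Adj c x) (cy : G.Adj c y)
    (nxy : ¬ G.Adj x y) (Nc : N.testBit c = true) (Nx : N.testBit x = false)
    (Ny : N.testBit y = false) : False := by
  refine hN.noClaw c n x y ((extend_adj_new h.lt hc).mpr Nc).symm ((extend_adj hc hx).mpr cx)
    ((extend_adj hc hy).mpr cy) ⟨hx.ne', hy.ne', hxy, ?_, ?_, ?_⟩
  · rw [extend_adj_new h.lt hx, Nx]; simp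
  · rw [extend_adj_new h.lt hy, Ny]; simp
  · rwa [extend_adj hx hy]

theorem le_extend (n N : ℕ) (G : SimpleGraph ℕ) : G ≤ extend n N G := fun _ _ h => Or.inl h

/-- The vertex `n` is joined to all pieces of the complement of an independent triple only if this
is no cut set. -/
theorem Admissible.not_meetsAll {N : ℕ} (hN : Admissible n G N) (h : Codes n R G) {al k j i : ℕ}
    {I : List VertexItem} (hI : ∀ i ∈ I, i.Valid n) (hk : k < n) (hkj : j < k) (hji : i < j)
    (hal : ∀ m, al.testBit m = true ↔ m < n ∧ m ≠ k ∧ m ≠ j)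
    (h1 : ¬ G.Adj k j) (h2 : ¬ G.Adj k i) (h3 : ¬ G.Adj j i)
    (hb : (meetsAll I (fullSet n) (pieces R n n (Nat.xor al (Nat.pow 2 i)))).testBit N = true) :
    False := by
  have hall := meetsAll_testBit hI hN.lt hb
  have hd : ∀ m, (Nat.xor al (Nat.pow 2 i)).testBit m = true ↔ m < n ∧ m ≠ k ∧ m ≠ j ∧ m ≠ i := by
    intro m
    have e : Nat.xor al (Nat.pow 2 i) = al ^^^ 2 ^ i := rfl
    rw [e, Nat.testBit_xor, Nat.testBit_two_pow]
    by_cases hm : i = m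
    · subst hm
      simp [(hal i).mpr ⟨by omega, by omega, by omega⟩]
    · rw [decide_eq_false hm, Bool.xor_false, hal m]
      omega
  generalize Nat.xor al (Nat.pow 2 i) = al' at *
  have hc := h.pieces (le_extend n N G) (w := n) n al' {n} (fun m hm => ((hd m).mp hm).1)
    (ConnOn.singleton n) rfl fun C hC => by
      obtain ⟨c, h1, h2, h3⟩ := hall C hC
      exact ⟨c, h2, (extend_adj_new h.lt h1).mpr h3⟩
  refine hN.cut k j i (by omega) (by omega) (by omega) ⟨by omega, by omega, by omega, ?_, ?_, ?_⟩ ?_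
  · rwa [extend_adj hk (by omega)]
  · rwa [extend_adj hk (by omega)]
  · rwa [extend_adj (by omega) (by omega)]
  · convert hc using 1
    ext m
    simp only [Set.mem_sdiff, Set.mem_Iio, Set.mem_insert_iff, Set.mem_singleton_iff,
      Set.mem_union, digitSet, Set.mem_ofPred_eq, hd m]
    omega

theorem Admissible.badTriple {N : ℕ} (hN : Admissible n G N) (h : Codes n R G) {al : ℕ}
    {I : List VertexItem} (hI : ∀ i ∈ I, i.Valid n) {k j i : VertexItem} (hk : k.Valid n)
    (hj : j.Valid n) (hi : i.Valid n) (hkj : j.ix < k.ix) (hji : i.ix < j.ix)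
    (hal : ∀ m, al.testBit m = true ↔ m < n ∧ m ≠ k.ix ∧ m ≠ j.ix) {a : Bool}
    (ha : a = true ↔ G.Adj k.ix j.ix) :
    (badTriple R n (fullSet n) al I k j i a).testBit N = false := by
  have kN := hk.no_iff N hN.lt
  have kY := hk.yes_iff N hN.lt
  have jN := hj.no_iff N hN.lt
  have jY := hj.yes_iff N hN.lt
  have iN := hi.no_iff N hN.lt
  have iY := hi.yes_iff N hN.lt
  have hki := h.adjBit_iff (i := k.ix) hi.lt
  have hji' := h.adjBit_iff (i := j.ix) hi.lt
  rw [Bool.eq_false_iff]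
  intro hb
  unfold _root_.badTriple at hb
  have land : ∀ x y : ℕ, Nat.land x y = x &&& y := fun _ _ => rfl
  rcases a with _ | _ <;> rcases hb1 : adjBit R k.ix i.ix with _ | _ <;>
    rcases hb2 : adjBit R j.ix i.ix with _ | _ <;>
    simp only [hb1, hb2, cond, Nat.zero_testBit, Bool.false_eq_true, false_iff, true_iff] at hb ha hki hji'
  · have lor : ∀ x y : ℕ, Nat.lor x y = x ||| y := fun _ _ => rfl
    rw [lor, Nat.testBit_lor, Bool.or_eq_true] at hb
    rcases hb with hb | hb
    · rw [land, land, Nat.testBit_land, Nat.testBit_land, Bool.and_eq_true, Bool.and_eq_true, kY, jY,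
        iY] at hb
      refine hN.noClaw n k.ix j.ix i.ix ((extend_adj_new h.lt hk.lt).mpr hb.1)
        ((extend_adj_new h.lt hj.lt).mpr hb.2.1) ((extend_adj_new h.lt hi.lt).mpr hb.2.2)
        ⟨hkj.ne', (hji.trans hkj).ne', hji.ne', ?_, ?_, ?_⟩
      · rwa [extend_adj hk.lt hj.lt]
      · rwa [extend_adj hk.lt hi.lt]
      · rwa [extend_adj hj.lt hi.lt]
    · exact hN.not_meetsAll h hI hk.lt hkj hji hal ha hki hji' hb
  · rw [land, land, Nat.testBit_land, Nat.testBit_land, Bool.and_eq_true, Bool.and_eq_true, iY, kN,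
      jN] at hb
    exact hN.no_claw_at h hi.lt hk.lt hj.lt hkj.ne' hki.symm hji'.symm ha hb.1 hb.2.1 hb.2.2
  · rw [land, land, Nat.testBit_land, Nat.testBit_land, Bool.and_eq_true, Bool.and_eq_true, jY, kN,
      iN] at hb
    exact hN.no_claw_at h hj.lt hk.lt hi.lt (hji.trans hkj).ne' ha.symm hji' hki hb.1 hb.2.1 hb.2.2
  · rw [land, land, Nat.testBit_land, Nat.testBit_land, Bool.and_eq_true, Bool.and_eq_true, kY, jN,
      iN] at hb
    exact hN.no_claw_at h hk.lt hj.lt hi.lt hji.ne' ha hki hji' hb.1 hb.2.1 hb.2.2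

theorem Admissible.badTriples {N : ℕ} (hN : Admissible n G N) (h : Codes n R G) {al : ℕ}
    {I : List VertexItem} (hI : ∀ i ∈ I, i.Valid n) {k j : VertexItem} (hk : k.Valid n)
    (hj : j.Valid n) (hkj : j.ix < k.ix)
    (hal : ∀ m, al.testBit m = true ↔ m < n ∧ m ≠ k.ix ∧ m ≠ j.ix) {a : Bool}
    (ha : a = true ↔ G.Adj k.ix j.ix) {l : List VertexItem} (hl : ∀ i ∈ l, i.Valid n ∧ i.ix < j.ix) :
    (badTriples R n (fullSet n) al I k j a l).testBit N = false := by
  induction l with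
  | nil => simp [_root_.badTriples]
  | cons i l ih =>
    have e : _root_.badTriples R n (fullSet n) al I k j a (i :: l)
        = _root_.badTriple R n (fullSet n) al I k j i a |||
          _root_.badTriples R n (fullSet n) al I k j a l := rfl
    obtain ⟨hi, hji⟩ := hl i (by simp)
    rw [e, Nat.testBit_lor, ih fun i' hi' => hl i' (by simp [hi']),
      hN.badTriple h hI hk hj hi hkj hji hal ha]
    rfl

theorem closedRow_testBit (h : Codes n R G) (hn : n ≤ 16) {i m : ℕ} (hm : m < n) :
    (closedRow R i).testBit m = true ↔ G.Adj i m ∨ m = i := by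
  have e : closedRow R i = (R >>> (32 * i)) % 2 ^ 16 ||| 2 ^ i := rfl
  rw [e, Nat.testBit_lor, Bool.or_eq_true, Nat.testBit_mod_two_pow, Nat.testBit_shiftRight,
    Nat.testBit_two_pow, Bool.and_eq_true, decide_eq_true_eq, decide_eq_true_eq,
    h.adj i m (hm.trans_le h.le), eq_comm]
  exact or_congr (and_iff_right (hm.trans_le hn)) Iff.rfl

theorem Admissible.badPair {N : ℕ} (hN : Admissible n G N) (h : Codes n R G) (hn : n ≤ 16)
    (hn3 : 3 ≤ n) {al : ℕ} {k j : VertexItem} (hk : k.Valid n)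
    (hj : j.Valid n) (hkj : j.ix < k.ix)
    (hal : ∀ m, al.testBit m = true ↔ m < n ∧ m ≠ k.ix ∧ m ≠ j.ix) {a : Bool}
    (ha : a = true ↔ G.Adj k.ix j.ix) :
    (badPair R n al k j a).testBit N = false := by
  have kN := hk.no_iff N hN.lt
  have kY := hk.yes_iff N hN.lt
  have jN := hj.no_iff N hN.lt
  rw [Bool.eq_false_iff]
  intro hb
  unfold _root_.badPair at hb
  have land : ∀ x y : ℕ, Nat.land x y = x &&& y := fun _ _ => rfl
  rcases a with _ | _ <;> simp only [cond] at hb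
  · rcases hz : Nat.beq (_root_.growTop R n al) 0 with _ | _ <;> rw [hz] at hb <;>
      simp only [Nat.zero_testBit, Bool.false_eq_true] at hb
    have hz := Nat.eq_of_beq_eq_true hz
    rw [land, Nat.testBit_land, Bool.and_eq_true, kN, jN] at hb
    obtain ⟨m, hm1, hm2, hm3⟩ : ∃ m, m < n ∧ m ≠ k.ix ∧ m ≠ j.ix := by
      by_cases h0 : k.ix ≠ 0 ∧ j.ix ≠ 0
      · exact ⟨0, by omega, h0.1.symm, h0.2.symm⟩
      · by_cases h1 : k.ix ≠ 1 ∧ j.ix ≠ 1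
        · exact ⟨1, by omega, h1.1.symm, h1.2.symm⟩
        · exact ⟨2, by omega, by omega, by omega⟩
    have hal0 : al ≠ 0 := by
      rintro rfl
      have := (hal m).mpr ⟨hm1, hm2, hm3⟩
      simp at this
    obtain ⟨-, r⟩ := h.growTop hal0 fun m hm => ((hal m).mp hm).1
    have h0 : digitSet 0 = ∅ := by ext; simp [digitSet]
    rw [hz, h0, Set.sdiff_empty] at r
    refine hN.cut n k.ix j.ix (Nat.lt_succ_self n) (hk.lt.trans (Nat.lt_succ_self n))
      (hj.lt.trans (Nat.lt_succ_self n)) ⟨hk.lt.ne', hj.lt.ne', hkj.ne', ?_, ?_, ?_⟩ ?_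
    · rw [extend_adj_new h.lt hk.lt, hb.1]; simp
    · rw [extend_adj_new h.lt hj.lt, hb.2]; simp
    · rw [extend_adj hk.lt hj.lt, ← ha]; simp
    · convert r.mono_graph (le_extend n N G) using 1
      ext m
      simp only [Set.mem_sdiff, Set.mem_Iio, Set.mem_insert_iff, Set.mem_singleton_iff,
        digitSet, Set.mem_ofPred_eq, hal m]
      omega
  · rcases hz : Nat.beq (closedRow R k.ix) (closedRow R j.ix) with _ | _ <;> rw [hz] at hb <;>
      simp only [Nat.zero_testBit, Bool.false_eq_true] at hb
    have hz := Nat.eq_of_beq_eq_true hz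
    rw [land, Nat.testBit_land, Bool.and_eq_true, kY, jN] at hb
    refine hN.twin j.ix k.ix hkj hk.lt (ha.mp rfl) (fun m hmj hmk => ?_) hb
    by_cases hm : m < n
    · have h1 := closedRow_testBit h hn (i := k.ix) hm
      have h2 := closedRow_testBit h hn (i := j.ix) hm
      rw [hz] at h1
      simpa [hmj, hmk] using h1.symm.trans h2
    · exact iff_of_false (fun h' => hm (h.lt _ _ h'.symm)) fun h' => hm (h.lt _ _ h'.symm)

theorem Admissible.badPairs {N : ℕ} (hN : Admissible n G N) (h : Codes n R G) (hn : n ≤ 16)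
    (hn3 : 3 ≤ n) {al : ℕ} {I : List VertexItem} (hI : ∀ i ∈ I, i.Valid n) {k : VertexItem}
    (hk : k.Valid n) (hal : ∀ m, al.testBit m = true ↔ m < n ∧ m ≠ k.ix) {t : ℕ} (ht : t ≤ k.ix) :
    (badPairs R n (fullSet n) al I k (items n (fullSet n) t)).testBit N = false := by
  induction t with
  | zero => simp [_root_.badPairs, items]
  | succ t ih =>
    have htn : t < n := (Nat.lt_of_succ_le ht).trans hk.lt
    set j : VertexItem := ⟨t, lack 1 n t, Nat.xor (fullSet n) (lack 1 n t)⟩ with hj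
    have hjv : j.Valid n := valid_item htn
    have e : _root_.badPairs R n (fullSet n) al I k (items n (fullSet n) (t + 1))
        = (_root_.badPair R n (al ^^^ 2 ^ t) k j (adjBit R k.ix t) |||
            _root_.badTriples R n (fullSet n) (al ^^^ 2 ^ t) I k j (adjBit R k.ix t)
              (items n (fullSet n) t)) |||
          _root_.badPairs R n (fullSet n) al I k (items n (fullSet n) t) := rfl
    have hal' : ∀ m, (al ^^^ 2 ^ t).testBit m = true ↔ m < n ∧ m ≠ k.ix ∧ m ≠ j.ix := by
      intro m
      rw [Nat.testBit_xor, Nat.testBit_two_pow]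
      by_cases hm : t = m
      · subst hm
        simp [(hal t).mpr ⟨htn, by omega⟩, hj]
      · rw [decide_eq_false hm, Bool.xor_false, hal m]
        have : m ≠ j.ix := fun h => hm h.symm
        tauto
    have ha : adjBit R k.ix t = true ↔ G.Adj k.ix j.ix := h.adjBit_iff htn
    rw [e, Nat.testBit_lor, Nat.testBit_lor, ih (by omega),
      hN.badPair h hn hn3 hk hjv (Nat.lt_of_succ_le ht) hal' ha,
      hN.badTriples h hI hk hjv (Nat.lt_of_succ_le ht) hal' ha (items_valid htn.le)]
    rfl

theorem Admissible.badSets {N : ℕ} (hN : Admissible n G N) (h : Codes n R G) (hn : n ≤ 16)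
    (hn3 : 3 ≤ n) {I : List VertexItem} (hI : ∀ i ∈ I, i.Valid n) {t : ℕ} (ht : t ≤ n) :
    (badSets R n (fullSet n) I (items n (fullSet n) t)).testBit N = false := by
  induction t with
  | zero => simp [_root_.badSets, items]
  | succ t ih =>
    set k : VertexItem := ⟨t, lack 1 n t, Nat.xor (fullSet n) (lack 1 n t)⟩ with hk
    have hkv : k.Valid n := valid_item ht
    have e : _root_.badSets R n (fullSet n) I (items n (fullSet n) (t + 1))
        = _root_.badPairs R n (fullSet n) ((2 ^ n - 1) ^^^ 2 ^ t) I k (items n (fullSet n) t) |||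
          _root_.badSets R n (fullSet n) I (items n (fullSet n) t) := rfl
    rw [e, Nat.testBit_lor, ih (by omega), hN.badPairs h hn hn3 hI hkv ?_ le_rfl]
    · rfl
    · intro m
      rw [Nat.testBit_xor, Nat.testBit_two_pow, Nat.testBit_two_pow_sub_one]
      by_cases hm : t = m
      · subst hm
        simp [Nat.lt_of_succ_le ht, hk]
      · have : m ≠ k.ix := fun h => hm h.symm
        simp [hm, this]

theorem Admissible.goodSets {N : ℕ} (hN : Admissible n G N) (h : Codes n R G) (hn : n ≤ 16)
    (hn3 : 3 ≤ n) :
    (goodSets R n (fullSet n) (items n (fullSet n) n)).testBit N = true := by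
  have e : _root_.goodSets R n (fullSet n) (items n (fullSet n) n)
      = fullSet n &&& (fullSet n ^^^ (2 ^ 0 ||| _root_.badSets R n (fullSet n) (items n (fullSet n) n)
        (items n (fullSet n) n))) := rfl
  rw [e, Nat.testBit_land, Nat.testBit_xor, Nat.testBit_lor, Nat.testBit_two_pow, testBit_fullSet,
    hN.badSets h hn hn3 (fun i hi => (items_valid le_rfl i hi).1) le_rfl]
  simp [hN.lt, hN.ne.symm]

theorem lt_of_goodSets {N : ℕ} {I : List VertexItem}
    (h : (goodSets R n (fullSet n) I).testBit N = true) : N < 2 ^ n := by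
  have e : _root_.goodSets R n (fullSet n) I
      = fullSet n &&& (Nat.xor (fullSet n) (Nat.lor 1 (badSets R n (fullSet n) I I))) := rfl
  rw [e, Nat.testBit_land, testBit_fullSet, Bool.and_eq_true, decide_eq_true_eq] at h
  exact h.1

end Extension

/-! ### Enumeration up to isomorphism -/

section Enumeration

variable {n R : ℕ} {G H : SimpleGraph ℕ}

/-- The number `N` for `x = 2 ^ N`. -/
def indexOf (x : ℕ) : List VertexItem → ℕ
  | [] => 0
  | i :: l => bif Nat.beq (Nat.land x i.yes) 0 then indexOf x l
      else Nat.add (Nat.pow 2 i.ix) (indexOf x l)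

/-- The positions of the nonzero digits of `S`, of which there are at most `k`. -/
def positions (I : List VertexItem) : ℕ → ℕ → List ℕ
  | 0, _ => []
  | k+1, S => bif Nat.beq S 0 then [] else
      indexOf (Nat.xor S (popLow S)) I :: positions I k (popLow S)

theorem indexOf_two_pow {N : ℕ} (hN : N < 2 ^ n) {k : ℕ} (hk : k ≤ n) :
    indexOf (2 ^ N) (items n (fullSet n) k) = N % 2 ^ k := by
  induction k with
  | zero => simp [items, indexOf, Nat.mod_one]
  | succ k ih =>
    have hv := (valid_item (n := n) (k := k) hk).yes_iff N hN
    have e : indexOf (2 ^ N) (items n (fullSet n) (k + 1))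
        = bif Nat.beq (2 ^ N &&& Nat.xor (fullSet n) (lack 1 n k)) 0 then
            indexOf (2 ^ N) (items n (fullSet n) k)
          else 2 ^ k + indexOf (2 ^ N) (items n (fullSet n) k) := rfl
    have hb : Nat.beq (2 ^ N &&& Nat.xor (fullSet n) (lack 1 n k)) 0 = !N.testBit k := by
      rw [Bool.eq_iff_iff, Nat.beq_eq, Bool.not_eq_true']
      simp only at hv
      rw [Nat.two_pow_and, ← Bool.not_eq_true, ← hv]
      cases (Nat.xor (fullSet n) (lack 1 n k)).testBit N <;> simp
    rw [e, hb, ih (by omega), Nat.mod_pow_succ]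
    have h2 := Nat.testBit_eq_decide_div_mod_eq (x := N) (i := k)
    rcases Nat.mod_two_eq_zero_or_one (N / 2 ^ k) with h3 | h3 <;> rw [h3] at h2 ⊢ <;> rw [h2] <;>
      simp [add_comm]

theorem mem_positions {N : ℕ} (hN : N < 2 ^ n) (k : ℕ) : ∀ S : ℕ, S.testBit N = true →
    (∀ i, S.testBit i = true → i < 2 ^ n) →
    ((Finset.range (2 ^ n)).filter fun i => S.testBit i = true).card ≤ k →
    N ∈ positions (items n (fullSet n) n) k S := by
  induction k with
  | zero =>
    intro S hS hlt hk
    have : N ∈ (Finset.range (2 ^ n)).filter fun i => S.testBit i = true := by simp [hS, hN]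
    rw [Nat.le_zero, Finset.card_eq_zero] at hk
    simp [hk] at this
  | succ k ih =>
    intro S hS hlt hk
    have hS0 : S ≠ 0 := by rintro rfl; simp at hS
    have hb : Nat.beq S 0 = false := by
      rw [Bool.eq_false_iff]
      exact fun hb => hS0 (Nat.eq_of_beq_eq_true hb)
    obtain ⟨v, hv, hpop⟩ := popLow_spec hS0
    simp only [positions, hb, cond, List.mem_cons]
    have e : Nat.xor S (popLow S) = 2 ^ v := testBit_xor_popLow hpop hv
    by_cases hNv : N = v
    · left
      subst hNv
      rw [e, indexOf_two_pow hN le_rfl, Nat.mod_eq_of_lt hN]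
    · right
      refine ih _ (by rw [hpop, hS]; simp [hNv])
        (fun i hi => hlt i (by rw [hpop, Bool.and_eq_true] at hi; exact hi.1)) ?_
      refine Nat.le_of_lt_succ (lt_of_lt_of_le (Finset.card_lt_card ?_) hk)
      rw [Finset.ssubset_iff_of_subset]
      · exact ⟨v, by simp [hv, hlt v hv], by simp [hpop]⟩
      · intro i
        simp only [Finset.mem_filter, hpop, Bool.and_eq_true]
        exact fun hi => ⟨hi.1, hi.2.1⟩

def memCode (g : ℕ) : List ℕ → Bool
  | [] => false
  | h :: l => bif Nat.beq g h then true else memCode g l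

def insertCode (g : ℕ) (l : List ℕ) : List ℕ := bif memCode g l then l else g :: l

/-- Adds to `acc` the extensions of the graph coded by `R` with the given sets of neighbours. -/
def children (n R : ℕ) : List ℕ → List ℕ → List ℕ
  | [], acc => acc
  | N :: l, acc => children n R l (insertCode (normalForm (Nat.succ n) (addVertex n R N)) acc)

/-- Adds to `acc` the extensions of the graphs with codes in a list by all sets of neighbours that
have to be considered. -/
def stepAux (n full : ℕ) (I : List VertexItem) : List ℕ → List ℕ → List ℕ
  | [], acc => acc
  | R :: l, acc => stepAux n full I l
     (children n R (positions I (Nat.pow 2 n) (goodSets R n full I)) acc)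

/-- Passes from the good graphs on `n` vertices to those on `n + 1` vertices. -/
def step (n : ℕ) (L : List ℕ) : List ℕ :=
  stepAux n (fullSet n) (items n (fullSet n) n) L []

theorem mem_of_memCode {g : ℕ} {l : List ℕ} (h : memCode g l = true) : g ∈ l := by
  induction l with
  | nil => simp [memCode] at h
  | cons a l ih =>
    rw [memCode] at h
    rcases hb : Nat.beq g a with _ | _ <;> rw [hb] at h
    · exact List.mem_cons_of_mem _ (ih h)
    · rw [Nat.eq_of_beq_eq_true hb]
      exact List.mem_cons_self

theorem mem_insertCode (g : ℕ) (l : List ℕ) : g ∈ insertCode g l := by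
  unfold insertCode
  rcases h : memCode g l with _ | _
  · exact List.mem_cons_self
  · exact mem_of_memCode h

theorem subset_insertCode (g : ℕ) (l : List ℕ) : l ⊆ insertCode g l := by
  unfold insertCode
  rcases h : memCode g l with _ | _
  · exact List.subset_cons_self _ _
  · exact List.Subset.refl _

theorem subset_children (n R : ℕ) (l : List ℕ) : ∀ acc, acc ⊆ children n R l acc := by
  induction l with
  | nil => exact fun acc => List.Subset.refl _
  | cons N l ih => exact fun acc => List.Subset.trans (subset_insertCode _ _) (ih _)

theorem mem_children {N : ℕ} {l : List ℕ} (h : N ∈ l) : ∀ acc,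
    normalForm (n + 1) (addVertex n R N) ∈ children n R l acc := by
  induction l with
  | nil => simp at h
  | cons a l ih =>
    intro acc
    rcases List.mem_cons.mp h with rfl | h
    · exact subset_children _ _ l _ (mem_insertCode _ _)
    · exact ih h _

theorem subset_stepAux (n full : ℕ) (I : List VertexItem) (l : List ℕ) :
    ∀ acc, acc ⊆ stepAux n full I l acc := by
  induction l with
  | nil => exact fun acc => List.Subset.refl _
  | cons N l ih => exact fun acc => List.Subset.trans (subset_children _ _ _ _) (ih _)

theorem mem_stepAux {full N : ℕ} {I : List VertexItem} {l : List ℕ} (h : R ∈ l)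
    (hN : N ∈ positions I (2 ^ n) (goodSets R n full I)) : ∀ acc,
    normalForm (n + 1) (addVertex n R N) ∈ stepAux n full I l acc := by
  induction l with
  | nil => simp at h
  | cons a l ih =>
    intro acc
    rcases List.mem_cons.mp h with rfl | h
    · exact subset_stepAux _ _ _ l _ (mem_children hN _)
    · exact ih h _

theorem mem_step {L : List ℕ} (hR : R ∈ L) (h : Codes n R G) (hn : n ≤ 16) (hn3 : 3 ≤ n) {N : ℕ}
    (hN : Admissible n G N) : normalForm (n + 1) (addVertex n R N) ∈ step n L := by
  refine mem_stepAux hR ?_ _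
  refine mem_positions hN.lt _ _ (hN.goodSets h hn hn3) (fun i hi => lt_of_goodSets hi) ?_
  exact (Finset.card_filter_le _ _).trans (Finset.card_range _).le

/-- A permutation of the natural numbers that preserves `m` restricts to an isomorphism. -/
def onFinIso {m : ℕ} {H H' : SimpleGraph ℕ} (σ : Equiv.Perm ℕ) (hσ : ∀ i, σ i < m ↔ i < m)
    (h : ∀ a b, H'.Adj (σ a) (σ b) ↔ H.Adj a b) : onFin m H ≃g onFin m H' where
  toFun i := ⟨σ i, (hσ i).mpr i.2⟩
  invFun i := ⟨σ.symm i, (hσ _).mp (by simp)⟩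
  left_inv i := by simp
  right_inv i := by simp
  map_rel_iff' := h _ _

/-- Exchanging adjacent twins `j < k` in the neighbourhood of the new vertex makes `N` smaller. -/
theorem exists_smaller {N j k : ℕ} (hN : N < 2 ^ n) (hjk : j < k)
    (hk : k < n) (tw : ∀ m, m ≠ j → m ≠ k → (G.Adj k m ↔ G.Adj j m)) (Nk : N.testBit k = true)
    (Nj : N.testBit j = false) : ∃ N' < N, N' < 2 ^ n ∧
      Nonempty (onFin (n + 1) (extend n N G) ≃g onFin (n + 1) (extend n N' G)) := by
  set N' := N ^^^ 2 ^ k ^^^ 2 ^ j with hN'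
  have hb : ∀ i, N'.testBit i = (N.testBit i ^^ decide (k = i) ^^ decide (j = i)) := fun i => by
    rw [hN', Nat.testBit_xor, Nat.testBit_xor, Nat.testBit_two_pow, Nat.testBit_two_pow]
  have hlt' : N' < N := by
    refine Nat.lt_of_testBit k ?_ Nk fun i hi => ?_
    · rw [hb, Nk]
      simp [hjk.ne]
    · rw [hb]
      simp [hi.ne, (hjk.trans hi).ne]
  refine ⟨N', hlt', hlt'.trans hN, ⟨onFinIso (Equiv.swap j k) ?_ ?_⟩⟩
  · intro i
    rw [Equiv.swap_apply_def]
    split_ifs <;> omega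
  · have hG : ∀ a b, G.Adj (Equiv.swap j k a) (Equiv.swap j k b) ↔ G.Adj a b := by
      have tw' : ∀ m, m ≠ j → m ≠ k → (G.Adj m k ↔ G.Adj m j) := fun m h1 h2 => by
        rw [G.adj_comm m k, G.adj_comm m j, tw m h1 h2]
      intro a b
      rw [Equiv.swap_apply_def, Equiv.swap_apply_def]
      split_ifs with h1 h2 h3 h4 h5 h6 h7 h8
      · subst h1 h2; simp
      · subst h1 h3; exact G.adj_comm _ _
      · subst h1; exact tw b h2 h3
      · subst h4 h5; exact G.adj_comm _ _
      · subst h4 h6; simp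
      · subst h4; exact (tw b h5 h6).symm
      · subst h7; exact tw' a h1 h4
      · subst h8; exact (tw' a h1 h4).symm
      · rfl
    have hn : ∀ a, Equiv.swap j k a = n ↔ a = n := by
      intro a
      rw [Equiv.swap_apply_def]
      split_ifs <;> omega
    have hl : ∀ a, Equiv.swap j k a < n ↔ a < n := by
      intro a
      rw [Equiv.swap_apply_def]
      split_ifs <;> omega
    have hb' : ∀ a, N'.testBit (Equiv.swap j k a) = N.testBit a := by
      intro a
      rw [hb, Equiv.swap_apply_def]
      split_ifs with h1 h2
      · subst h1; simp [Nk, Nj, hjk.ne]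
      · subst h2; simp [Nk, Nj, hjk.ne']
      · simp [Ne.symm h1, Ne.symm h2]
    intro a b
    simp only [extend, hG, hn, hl, hb']

/-- Every good graph on `n` vertices is isomorphic to one coded in `L`. -/
def Complete (n : ℕ) (L : List ℕ) : Prop :=
  ∀ H : SimpleGraph (Fin n), IsGood H → ∃ R ∈ L, ∃ G, Codes n R G ∧ Nonempty (onFin n G ≃g H)

theorem noClaw_of_onFin {m : ℕ} {H : SimpleGraph ℕ} (hlt : ∀ i j, H.Adj i j → i < m)
    (h : NoClaw (onFin m H)) : NoClaw H := by
  intro c x y z hx hy hz ht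
  exact h ⟨c, hlt _ _ hx⟩ ⟨x, hlt _ _ hx.symm⟩ ⟨y, hlt _ _ hy.symm⟩ ⟨z, hlt _ _ hz.symm⟩ hx hy hz
    ((IndepTriple.map (SimpleGraph.Embedding.comap ⟨Fin.val, Fin.val_injective⟩ H)).mp ht)

theorem admissible_of_isGood (hlt : ∀ i j, G.Adj i j → i < n) (hn : 0 < n) {N : ℕ} (hN : N < 2 ^ n)
    (hG : IsGood (onFin (n + 1) (extend n N G)))
    (hmin : ∀ N' < N, N' < 2 ^ n →
      IsEmpty (onFin (n + 1) (extend n N G) ≃g onFin (n + 1) (extend n N' G))) :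
    Admissible n G N := by
  have hlt' : ∀ i j, (extend n N G).Adj i j → i < n + 1 := by
    rintro i j (h | h | h)
    · exact (hlt i j h).trans (Nat.lt_succ_self n)
    · omega
    · omega
  let e : onFin (n + 1) (extend n N G) ↪g extend n N G :=
    SimpleGraph.Embedding.comap ⟨Fin.val, Fin.val_injective⟩ _
  have he : ∀ i, e i = i.1 := fun _ => rfl
  refine ⟨hN, ?_, noClaw_of_onFin hlt' hG.noClaw, ?_, ?_⟩
  · rintro rfl
    obtain ⟨a, ha, b, -, hb, hab⟩ := hG.conn.exists_adj (A := {Fin.last n}) (Set.subset_univ _)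
      ⟨_, rfl⟩ fun h => by
        have := h (Set.mem_univ (0 : Fin (n + 1)))
        rw [Set.mem_singleton_iff, Fin.ext_iff] at this
        exact hn.ne this
    rw [Set.mem_singleton_iff.mp ha] at hab
    have hbn : b.1 < n := by
      have h1 : b.1 ≠ n := fun h => hb (Fin.ext h)
      omega
    have := (extend_adj_new hlt hbn).mp hab
    simp at this
  · intro x y z hx hy hz ht hc
    refine hG.cut ⟨x, hx⟩ ⟨y, hy⟩ ⟨z, hz⟩ ((IndepTriple.map e).mp ht) ?_
    rw [← connOn_image e]
    convert hc using 1
    ext i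
    simp only [Set.mem_image, Set.mem_compl_iff, Set.mem_insert_iff, Set.mem_singleton_iff, he,
      Set.mem_sdiff, Set.mem_Iio]
    constructor
    · rintro ⟨a, ha, rfl⟩
      refine ⟨a.2, ?_⟩
      simpa [Fin.ext_iff] using ha
    · rintro ⟨h1, h2⟩
      refine ⟨⟨i, h1⟩, ?_, rfl⟩
      simpa [Fin.ext_iff] using h2
  · rintro j k hjk hk - tw ⟨Nk, Nj⟩
    obtain ⟨N', h1, h2, ⟨f⟩⟩ := exists_smaller hN hjk hk tw Nk Nj
    exact (hmin N' h1 h2).false f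

theorem exists_extend {H : SimpleGraph (Fin (n + 1))} {v : Fin (n + 1)}
    (hlt : ∀ i j, G.Adj i j → i < n) (f : onFin n G ≃g H.induce {v}ᶜ) :
    ∃ N < 2 ^ n, Nonempty (onFin (n + 1) (extend n N G) ≃g H) := by
  classical
  let p : Fin n → Bool := fun i => decide (H.Adj v (f i))
  let g : Fin (n + 1) → Fin (n + 1) := fun i => if h : i.1 < n then (f ⟨i, h⟩).1 else v
  have g1 : ∀ (i : Fin (n + 1)) (h : i.1 < n), g i = (f ⟨i, h⟩).1 := fun i h => by simp [g, h]
  have g2 : ∀ i : Fin (n + 1), ¬ i.1 < n → g i = v := fun i h => by simp [g, h]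
  have hfv : ∀ i, (f i).1 ≠ v := fun i => (f i).2
  have hg : Function.Injective g := by
    intro a b hab
    by_cases ha : a.1 < n <;> by_cases hb : b.1 < n
    · rw [g1 a ha, g1 b hb] at hab
      have := f.injective (Subtype.ext hab)
      exact Fin.ext (congrArg (fun i : Fin n => i.1) this)
    · rw [g1 a ha, g2 b hb] at hab
      exact absurd hab (hfv _)
    · rw [g2 a ha, g1 b hb] at hab
      exact absurd hab.symm (hfv _)
    · exact Fin.ext (by omega)
  refine ⟨Nat.ofBits p, Nat.ofBits_lt_two_pow p, ⟨⟨Equiv.ofBijective g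
    (Finite.injective_iff_bijective.mp hg), ?_⟩⟩⟩
  intro a b
  have hbit : ∀ i (h : i < n), (Nat.ofBits p).testBit i = true ↔ H.Adj v (f ⟨i, h⟩) := fun i h => by
    rw [Nat.testBit_ofBits_lt p i h]
    exact decide_eq_true_iff
  change H.Adj (g a) (g b) ↔ (extend n (Nat.ofBits p) G).Adj a b
  by_cases ha : a.1 < n <;> by_cases hb : b.1 < n
  · rw [g1 a ha, g1 b hb, extend_adj ha hb]
    exact f.map_rel_iff (a := ⟨a, ha⟩) (b := ⟨b, hb⟩)
  · have hbn : b.1 = n := by omega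
    rw [g1 a ha, g2 b hb, hbn, SimpleGraph.adj_comm, SimpleGraph.adj_comm _ _ n,
      extend_adj_new hlt ha, hbit a ha]
  · have han : a.1 = n := by omega
    rw [g2 a ha, g1 b hb, han, extend_adj_new hlt hb, hbit b hb]
  · have han : a.1 = n := by omega
    have hbn : b.1 = n := by omega
    rw [g2 a ha, g2 b hb, han, hbn]
    simp

/-- If `L` is complete, then so is every list that holds the codes obtained from those in `L`; the
codes in `L` may be treated in several portions. -/
theorem Complete.step {L L' : List ℕ} (hL : Complete n L) (hn : n ≤ 16) (hn5 : 5 ≤ n)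
    (h : ∀ R ∈ L, ∃ C, R ∈ C ∧ step n C ⊆ L') : Complete (n + 1) L' := by
  intro H hH
  obtain ⟨v, hv⟩ := hH.exists_delete (by simpa using hn5)
  have hcard : Fintype.card ({v}ᶜ : Set (Fin (n + 1))) = Fintype.card (Fin n) := by
    rw [Fintype.card_compl_set]; simp
  let e : ({v}ᶜ : Set (Fin (n + 1))) ≃ Fin n := Fintype.equivOfCardEq hcard
  let e' := SimpleGraph.Iso.map e (H.induce {v}ᶜ)
  obtain ⟨R, hR, G, hRG, ⟨f⟩⟩ := hL _ (hv.of_iso e')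
  have hex : ∃ N, N < 2 ^ n ∧ Nonempty (onFin (n + 1) (extend n N G) ≃g H) :=
    exists_extend hRG.lt (f.trans e'.symm)
  classical
  obtain ⟨hN, ⟨φ⟩⟩ := Nat.find_spec hex
  have hadm : Admissible n G (Nat.find hex) := by
    refine admissible_of_isGood hRG.lt (by omega) hN (hH.of_iso φ.symm) fun N' h1 h2 => ⟨fun ψ => ?_⟩
    exact Nat.find_min hex h1 ⟨h2, ⟨ψ.symm.trans φ⟩⟩
  obtain ⟨G', hG', ⟨χ⟩⟩ := (hRG.addVertex (by omega) hN).normalForm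
  obtain ⟨C, hC, hCL⟩ := h R hR
  exact ⟨_, hCL (mem_step hC hRG hn (by omega) hadm), G', hG', ⟨χ.symm.trans φ⟩⟩

end Enumeration

/-! ### The graphs on five vertices, and the enumeration up to nine vertices -/

section Base

/-- The path with five vertices. -/
def pathCode : ℕ := addVertex 4 (addVertex 3 (addVertex 2 (addVertex 1 0 1) 2) 4) 8

/-- The path with five vertices, as obtained by adding vertices one by one. -/
def path5 : SimpleGraph ℕ := extend 4 8 (extend 3 4 (extend 2 2 (extend 1 1 ⊥)))

theorem codes_path5 : Codes 5 pathCode path5 :=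
  (((Codes.addVertex (n := 1) (R := 0) (G := ⊥) ⟨by simp, by norm_num, by simp⟩ (by norm_num)
    (by norm_num)).addVertex (by norm_num) (by norm_num)).addVertex (by norm_num)
    (by norm_num)).addVertex (by norm_num) (by norm_num)

theorem path5_adj : ∀ a b : Fin 5, (onFin 5 path5).Adj a b ↔ a.1 + 1 = b.1 ∨ b.1 + 1 = a.1 := by
  simp only [SimpleGraph.comap_adj, path5, extend, SimpleGraph.bot_adj]
  decide

variable {H : SimpleGraph (Fin 5)}

theorem iso_path5 {x d y e z : Fin 5} (ht : IndepTriple H x y z) (hxe : x ≠ e) (hzd : z ≠ d)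
    (hde : d ≠ e) (xd : H.Adj x d) (yd : H.Adj y d) (ye : H.Adj y e) (ze : H.Adj z e)
    (nxe : ¬ H.Adj x e) (nzd : ¬ H.Adj z d) (nde : ¬ H.Adj d e) :
    Nonempty (onFin 5 path5 ≃g H) := by
  obtain ⟨h1, h2, h3, h4, h5, h6⟩ := ht
  let g : Fin 5 → Fin 5 := ![x, d, y, e, z]
  have hadj : ∀ a b : Fin 5, a < b → (H.Adj (g a) (g b) ↔ a.1 + 1 = b.1) := by
    intro a b hab
    have h6' : ¬ H.Adj z y := fun h => h6 h.symm
    fin_cases a <;> fin_cases b <;> first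
      | exact absurd hab (by decide)
      | exact iff_of_true (by assumption) (by decide)
      | exact iff_of_true (SimpleGraph.Adj.symm (by assumption)) (by decide)
      | exact iff_of_false (by assumption) (by decide)
      | exact iff_of_false (fun h => absurd h.symm (by assumption)) (by decide)
  have hne : ∀ a b : Fin 5, a < b → g a ≠ g b := by
    intro a b hab
    fin_cases a <;> fin_cases b <;> first
      | exact absurd hab (by decide)
      | assumption
      | exact SimpleGraph.Adj.ne (by assumption)
      | exact SimpleGraph.Adj.ne' (by assumption)
      | exact Ne.symm (by assumption)
  have hg : Function.Injective g := by
    intro a b hab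
    rcases lt_trichotomy a b with h | h | h
    · exact absurd hab (hne a b h)
    · exact h
    · exact absurd hab.symm (hne b a h)
  refine ⟨⟨Equiv.ofBijective g (Finite.injective_iff_bijective.mp hg), ?_⟩⟩
  intro a b
  change H.Adj (g a) (g b) ↔ _
  rw [path5_adj]
  rcases lt_trichotomy a b with h | rfl | h
  · rw [hadj a b h]
    have : a.1 < b.1 := h
    omega
  · simp
  · rw [SimpleGraph.adj_comm, hadj b a h]
    have : b.1 < a.1 := h
    omega

theorem complete_base : Complete 5 [pathCode] := by
  intro H hH
  refine ⟨pathCode, by simp, path5, codes_path5, ?_⟩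
  obtain ⟨a, b, c, ht⟩ := hH.triple
  have hcard : (Finset.univ \ {a, b, c} : Finset (Fin 5)).card = 2 := by
    rw [Finset.card_sdiff_of_subset (Finset.subset_univ _), Finset.card_eq_three.mpr
      ⟨a, b, c, ht.1, ht.2.1, ht.2.2.1, rfl⟩]
    rfl
  obtain ⟨d, e, hde, hU⟩ := Finset.card_eq_two.mp hcard
  have hmem : ∀ i, (i ≠ a ∧ i ≠ b ∧ i ≠ c) ↔ (i = d ∨ i = e) := fun i => by
    have := Finset.ext_iff.mp hU i
    simpa [not_or] using this
  have hd := (hmem d).mpr (Or.inl rfl)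
  have he := (hmem e).mpr (Or.inr rfl)
  have nde : ¬ H.Adj d e := fun h => hH.cut a b c ht (by
    convert (ConnOn.singleton (G := H) d).insert rfl h using 1
    ext i
    have := hmem i
    simp only [Set.mem_compl_iff, Set.mem_insert_iff, Set.mem_singleton_iff, not_or, this]
    tauto)
  -- Each member of the triple is joined to `d` or `e`.
  have nb : ∀ a b c, IndepTriple H a b c → (∀ i, (i ≠ a ∧ i ≠ b ∧ i ≠ c) ↔ (i = d ∨ i = e)) →
      H.Adj a d ∨ H.Adj a e := by
    intro a b c ht hmem
    obtain ⟨a', ha', m, -, hm, ham⟩ := hH.conn.exists_adj (A := {a}) (Set.subset_univ _) ⟨a, rfl⟩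
      (fun h => ht.1 (h (Set.mem_univ b)).symm)
    rw [Set.mem_singleton_iff.mp ha'] at ham
    have : m = d ∨ m = e := (hmem m).mp ⟨hm, fun h => ht.2.2.2.1 (h ▸ ham),
      fun h => ht.2.2.2.2.1 (h ▸ ham)⟩
    rcases this with rfl | rfl
    · exact Or.inl ham
    · exact Or.inr ham
  have main : ∀ x y z, IndepTriple H x y z → (∀ i, (i ≠ x ∧ i ≠ y ∧ i ≠ z) ↔ (i = d ∨ i = e)) →
      H.Adj y d → H.Adj y e → Nonempty (onFin 5 path5 ≃g H) := by
    intro x y z ht hm yd ye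
    have hd := (hm d).mpr (Or.inl rfl)
    have he := (hm e).mpr (Or.inr rfl)
    have c1 : ¬ (H.Adj x d ∧ H.Adj z d) := fun h =>
      hH.noClaw d x y z h.1.symm yd.symm h.2.symm ht
    have c2 : ¬ (H.Adj x e ∧ H.Adj z e) := fun h =>
      hH.noClaw e x y z h.1.symm ye.symm h.2.symm ht
    have n1 := nb x y z ht hm
    have n2 := nb z x y ht.rotate.rotate fun i => by rw [← hm i]; tauto
    by_cases xd : H.Adj x d
    · have zd : ¬ H.Adj z d := fun h => c1 ⟨xd, h⟩
      have ze := n2.resolve_left zd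
      exact iso_path5 ht he.1.symm hd.2.2.symm hde xd yd ye ze (fun h => c2 ⟨h, ze⟩) zd nde
    · have xe := n1.resolve_left xd
      have ze : ¬ H.Adj z e := fun h => c2 ⟨xe, h⟩
      have zd := n2.resolve_right ze
      exact iso_path5 ht hd.1.symm he.2.2.symm hde.symm xe ye yd zd xd ze fun h => nde h.symm
  have hcommon : (H.Adj a d ∧ H.Adj a e) ∨ (H.Adj b d ∧ H.Adj b e) ∨ (H.Adj c d ∧ H.Adj c e) := by
    by_contra! hno
    -- Otherwise `d` and its neighbours are not joined to the other vertices.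
    have := hH.conn.2 {i | i = d ∨ H.Adj d i} (Set.subset_univ _) ⟨d, Or.inl rfl⟩ (by
      rintro p (rfl | hp) q - hpq
      · exact Or.inr hpq
      · by_cases hpabc : p ≠ a ∧ p ≠ b ∧ p ≠ c
        · rcases (hmem p).mp hpabc with rfl | rfl
          · exact Or.inr hpq
          · exact absurd hp nde
        · have hq : q ≠ a ∧ q ≠ b ∧ q ≠ c := by
            obtain ⟨h1, h2, h3, h4, h5, h6⟩ := ht
            refine ⟨?_, ?_, ?_⟩ <;> rintro rfl <;> apply hpabc <;> refine ⟨?_, ?_, ?_⟩ <;>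
              rintro rfl <;> first
                | exact hpq.ne rfl
                | exact absurd hpq (by assumption)
                | exact absurd hpq.symm (by assumption)
          rcases (hmem q).mp hq with rfl | rfl
          · exact Or.inl rfl
          · exfalso
            apply hpabc
            refine ⟨?_, ?_, ?_⟩ <;> rintro rfl
            · exact hno.1 hp.symm hpq
            · exact hno.2.1 hp.symm hpq
            · exact hno.2.2 hp.symm hpq)
    rcases this (Set.mem_univ e) with h | h
    · exact hde h.symm
    · exact nde h
  rcases hcommon with h | h | h
  · exact main c a b ht.rotate.rotate (fun i => by rw [← hmem i]; tauto) h.1 h.2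
  · exact main a b c ht hmem h.1 h.2
  · exact main b c a ht.rotate (fun i => by rw [← hmem i]; tauto) h.1 h.2

theorem Complete.step_self {n : ℕ} {L : List ℕ} (hL : Complete n L) (hn : n ≤ 16) (hn5 : 5 ≤ n) :
    Complete (n + 1) (_root_.step n L) :=
  hL.step hn hn5 fun _ hR => ⟨L, hR, List.Subset.refl _⟩

/-- Codes of the good graphs on nine vertices. -/
def codes9 : List ℕ := step 8 (step 7 (step 6 (step 5 [pathCode])))

theorem complete9 : Complete 9 codes9 :=
  (((complete_base.step_self (by norm_num) (by norm_num)).step_self (by norm_num)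
    (by norm_num)).step_self (by norm_num) (by norm_num)).step_self (by norm_num) (by norm_num)

end Base

/-! ### The polynomial of stable partitions -/

section BlockPolynomial

open MvPolynomial

/-- No two members of `A` are adjacent. -/
def IsStable (G : SimpleGraph ℕ) (A : Finset ℕ) : Prop := ∀ a ∈ A, ∀ b ∈ A, ¬ G.Adj a b

theorem IsStable.mono {G : SimpleGraph ℕ} {A B : Finset ℕ} (h : IsStable G B) (hAB : A ⊆ B) :
    IsStable G A := fun a ha b hb => h a (hAB ha) b (hAB hb)

open Classical in
/-- The stable subsets of `S`. -/
noncomputable def stableSubsets (G : SimpleGraph ℕ) (S : Finset ℕ) : Finset (Finset ℕ) :=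
  S.powerset.filter (IsStable G)

theorem mem_stableSubsets {G : SimpleGraph ℕ} {S A : Finset ℕ} :
    A ∈ stableSubsets G S ↔ A ⊆ S ∧ IsStable G A := by
  simp [stableSubsets]

open Classical in
/-- The sets `A` of vertices of `S` below `k` such that `A` together with `k` is stable. -/
noncomputable def blocksBelow (G : SimpleGraph ℕ) (k : ℕ) (S : Finset ℕ) : Finset (Finset ℕ) :=
  (S ∩ Finset.range k).powerset.filter fun A => IsStable G (insert k A)

theorem mem_blocksBelow {G : SimpleGraph ℕ} {k : ℕ} {S A : Finset ℕ} :
    A ∈ blocksBelow G k S ↔ A ⊆ S ∩ Finset.range k ∧ IsStable G (insert k A) := by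
  simp only [blocksBelow, Finset.mem_filter, Finset.mem_powerset]

/-- The sum of `∏ X_{|B|}` over all partitions of `S ∩ {0, …, k - 1}` into nonempty stable blocks
`B`. The recursion chooses the block that contains the largest vertex. -/
noncomputable def blockPoly (G : SimpleGraph ℕ) : ℕ → Finset ℕ → MvPolynomial ℕ ℕ
  | 0, _ => 1
  | k+1, S => if k ∈ S then ∑ A ∈ blocksBelow G k S, X (A.card + 1) * blockPoly G k (S \ A)
      else blockPoly G k S

theorem blockPoly_congr (G : SimpleGraph ℕ) (k : ℕ) : ∀ S S' : Finset ℕ,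
    S ∩ Finset.range k = S' ∩ Finset.range k → blockPoly G k S = blockPoly G k S' := by
  induction k with
  | zero => exact fun _ _ _ => rfl
  | succ k ih =>
    intro S S' h
    have hm : ∀ i, i < k + 1 → (i ∈ S ↔ i ∈ S') := fun i hi => by
      have := Finset.ext_iff.mp h i
      simpa [hi] using this
    have h' : S ∩ Finset.range k = S' ∩ Finset.range k := by
      ext i
      simp only [Finset.mem_inter, Finset.mem_range]
      constructor
      · exact fun ⟨a, b⟩ => ⟨(hm i (by omega)).mp a, b⟩
      · exact fun ⟨a, b⟩ => ⟨(hm i (by omega)).mpr a, b⟩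
    have hb : blocksBelow G k S = blocksBelow G k S' := by
      ext A
      rw [mem_blocksBelow, mem_blocksBelow, h']
    simp only [blockPoly, hm k (Nat.lt_succ_self k), hb, ih S S' h']
    congr 1
    refine Finset.sum_congr rfl fun A _ => ?_
    rw [ih (S \ A) (S' \ A)]
    rw [Finset.sdiff_inter_right_comm, Finset.sdiff_inter_right_comm, h']

theorem constantCoeff_blockPoly (G : SimpleGraph ℕ) (k : ℕ) : ∀ S : Finset ℕ, S ⊆ Finset.range k →
    constantCoeff (blockPoly G k S) = if S = ∅ then 1 else 0 := by
  induction k with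
  | zero =>
    intro S hS
    have : S = ∅ := by simpa using hS
    simp [blockPoly, this]
  | succ k ih =>
    intro S hS
    rw [blockPoly]
    split_ifs with h h' h'
    · simp [h'] at h
    · simp
    · subst h'
      simpa using ih ∅ (by simp)
    · rw [ih S, if_neg h']
      intro i hi
      have h1 := Finset.mem_range.mp (hS hi)
      have : i ≠ k := fun h2 => h (h2 ▸ hi)
      exact Finset.mem_range.mpr (by omega)

open Classical in
/-- The stable subsets of `S` of size `a`. -/
noncomputable def stableOfSize (G : SimpleGraph ℕ) (S : Finset ℕ) (a : ℕ) : Finset (Finset ℕ) :=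
  (stableSubsets G S).filter fun B => B.card = a

theorem mem_stableOfSize {G : SimpleGraph ℕ} {S B : Finset ℕ} {a : ℕ} :
    B ∈ stableOfSize G S a ↔ (B ⊆ S ∧ IsStable G B) ∧ B.card = a := by
  simp [stableOfSize, mem_stableSubsets]

/-- Differentiating with respect to the variable of the blocks of size `a` removes one block of this
size. -/
theorem pderiv_blockPoly (G : SimpleGraph ℕ) {a : ℕ} (ha : a ≠ 0) (k : ℕ) : ∀ S : Finset ℕ,
    S ⊆ Finset.range k →
    pderiv a (blockPoly G k S) = ∑ B ∈ stableOfSize G S a, blockPoly G k (S \ B) := by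
  classical
  induction k with
  | zero =>
    intro S hS
    have hS : S = ∅ := by simpa using hS
    rw [blockPoly, pderiv_one, Finset.sum_eq_zero]
    intro B hB
    rw [mem_stableOfSize, hS, Finset.subset_empty] at hB
    exact absurd (by rw [← hB.2, hB.1.1]; rfl) ha
  | succ k ih =>
    intro S hS
    by_cases hk : k ∈ S
    · set S' := S ∩ Finset.range k with hS'
      have hkS' : k ∉ S' := by simp [hS']
      have hSi : ∀ i, i ∈ S ↔ i = k ∨ i ∈ S' := by
        intro i
        rw [hS', Finset.mem_inter, Finset.mem_range]
        constructor
        · intro hi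
          have := Finset.mem_range.mp (hS hi)
          by_cases h : i = k
          · exact Or.inl h
          · exact Or.inr ⟨hi, by omega⟩
        · rintro (rfl | h)
          · exact hk
          · exact h.1
      have hS'r : S' ⊆ Finset.range k := Finset.inter_subset_right
      have hP : ∀ A, blockPoly G k (S \ A) = blockPoly G k (S' \ A) := fun A => by
        refine blockPoly_congr G k _ _ ?_
        rw [Finset.sdiff_inter_right_comm, Finset.sdiff_inter_right_comm, hS',
          Finset.inter_assoc, Finset.inter_self]
      have hL : pderiv a (blockPoly G (k + 1) S) =
          ∑ A ∈ blocksBelow G k S, (if A.card + 1 = a then blockPoly G k (S' \ A) else 0) +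
          ∑ A ∈ blocksBelow G k S, ∑ B ∈ stableOfSize G (S' \ A) a,
            X (A.card + 1) * blockPoly G k ((S' \ A) \ B) := by
        rw [blockPoly, if_pos hk, map_sum, ← Finset.sum_add_distrib]
        refine Finset.sum_congr rfl fun A hA => ?_
        rw [Derivation.leibniz, hP, ih (S' \ A) (Finset.sdiff_subset.trans hS'r), pderiv_X,
          smul_eq_mul, smul_eq_mul, Finset.mul_sum, add_comm]
        congr 1
        by_cases h : A.card + 1 = a
        · subst h; simp
        · simp [h]
      have hR : ∑ B ∈ stableOfSize G S a, blockPoly G (k + 1) (S \ B) =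
          ∑ B ∈ (stableOfSize G S a).filter (fun B => k ∈ B), blockPoly G (k + 1) (S \ B) +
          ∑ B ∈ (stableOfSize G S a).filter (fun B => ¬ k ∈ B), blockPoly G (k + 1) (S \ B) :=
        (Finset.sum_filter_add_sum_filter_not _ _ _).symm
      rw [hL, hR]
      congr 1
      · rw [← Finset.sum_filter]
        refine Finset.sum_nbij' (fun A => insert k A) (fun B => B.erase k) ?_ ?_ ?_ ?_ ?_
        · intro A hA
          rw [Finset.mem_filter, mem_blocksBelow] at hA
          obtain ⟨⟨h1, h2⟩, h3⟩ := hA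
          have hkA : k ∉ A := fun h => hkS' (h1 h)
          rw [Finset.mem_filter, mem_stableOfSize]
          refine ⟨⟨⟨?_, h2⟩, ?_⟩, Finset.mem_insert_self _ _⟩
          · exact Finset.insert_subset hk (h1.trans Finset.inter_subset_left)
          · rw [Finset.card_insert_of_notMem hkA, h3]
        · intro B hB
          rw [Finset.mem_filter, mem_stableOfSize] at hB
          obtain ⟨⟨⟨h1, h2⟩, h3⟩, h4⟩ := hB
          rw [Finset.mem_filter, mem_blocksBelow, Finset.insert_erase h4]
          refine ⟨⟨fun i hi => ?_, h2⟩, ?_⟩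
          · rw [Finset.mem_erase] at hi
            exact ((hSi i).mp (h1 hi.2)).resolve_left hi.1
          · rw [Finset.card_erase_of_mem h4]
            have := Finset.card_pos.mpr ⟨k, h4⟩
            omega
        · intro A hA
          rw [Finset.mem_filter, mem_blocksBelow] at hA
          exact Finset.erase_insert fun h => hkS' (hA.1.1 h)
        · intro B hB
          rw [Finset.mem_filter] at hB
          exact Finset.insert_erase hB.2
        · intro A hA
          rw [blockPoly, if_neg (by simp)]
          refine blockPoly_congr G k _ _ ?_
          ext i
          simp only [Finset.mem_inter, Finset.mem_sdiff, Finset.mem_insert, hSi i, Finset.mem_range]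
          constructor
          · exact fun ⟨⟨h1, h2⟩, h3⟩ => ⟨⟨Or.inr h1, fun h => h.elim (fun h => hkS' (h ▸ h1)) h2⟩, h3⟩
          · exact fun ⟨⟨h1, h2⟩, h3⟩ => ⟨⟨h1.resolve_left (by omega), fun h => h2 (Or.inr h)⟩, h3⟩
      · have : ∀ B ∈ (stableOfSize G S a).filter (fun B => ¬ k ∈ B), blockPoly G (k + 1) (S \ B) =
            ∑ A ∈ blocksBelow G k (S \ B), X (A.card + 1) * blockPoly G k ((S' \ A) \ B) := by
          intro B hB
          rw [Finset.mem_filter] at hB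
          rw [blockPoly, if_pos (by simp [hk, hB.2])]
          refine Finset.sum_congr rfl fun A hA => ?_
          rw [sdiff_right_comm S' A B, sdiff_sdiff, sdiff_sdiff, hP, sup_comm]
        rw [Finset.sum_congr rfl this]
        refine Finset.sum_comm' fun A B => ?_
        rw [mem_blocksBelow, mem_stableOfSize, Finset.mem_filter, mem_blocksBelow, mem_stableOfSize,
          ← hS', Finset.sdiff_inter_right_comm, ← hS']
        constructor
        · rintro ⟨⟨h1, h2⟩, ⟨h3, h4⟩, h5⟩
          have hB : B ⊆ S' := h3.trans Finset.sdiff_subset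
          refine ⟨⟨Finset.subset_sdiff.mpr ⟨h1, ?_⟩, h2⟩, ⟨⟨hB.trans Finset.inter_subset_left, h4⟩, h5⟩,
            fun h => hkS' (hB h)⟩
          exact (Finset.subset_sdiff.mp h3).2.symm
        · rintro ⟨⟨h1, h2⟩, ⟨⟨h3, h4⟩, h5⟩, h6⟩
          refine ⟨⟨h1.trans Finset.sdiff_subset, h2⟩, ⟨Finset.subset_sdiff.mpr ⟨fun i hi => ?_,
            (Finset.subset_sdiff.mp h1).2.symm⟩, h4⟩, h5⟩
          exact ((hSi i).mp (h3 hi)).resolve_left fun h => h6 (h ▸ hi)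
    · have hSr : S ⊆ Finset.range k := fun i hi => by
        have h1 := Finset.mem_range.mp (hS hi)
        have : i ≠ k := fun h2 => hk (h2 ▸ hi)
        exact Finset.mem_range.mpr (by omega)
      rw [blockPoly, if_neg hk, ih S hSr]
      refine Finset.sum_congr rfl fun B _ => ?_
      rw [blockPoly, if_neg (fun h => hk (Finset.sdiff_subset h))]

end BlockPolynomial

/-! ### Colourings and derivatives -/

section Colourings

/-- The proper colourings of `G` on `S` with content `d`, extended by zero. -/
def colourings (G : SimpleGraph ℕ) (S : Finset ℕ) (d : ℕ →₀ ℕ) : Set (ℕ → ℕ) :=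
  {κ | (∀ v, v ∉ S → κ v = 0) ∧ (∀ u ∈ S, ∀ v ∈ S, G.Adj u v → κ u ≠ κ v) ∧
    ∑ v ∈ S, Finsupp.single (κ v) 1 = d}

instance (G : SimpleGraph ℕ) (S : Finset ℕ) (d : ℕ →₀ ℕ) : Finite (colourings G S d) := by
  classical
  refine Finite.of_injective (β := S → d.support) (fun κ v => ⟨κ.1 v, ?_⟩) ?_
  · have h := κ.2.2.2
    rw [Finsupp.mem_support_iff]
    intro h0
    replace h := DFunLike.congr_fun h (κ.1 v)
    rw [h0, Finsupp.finsetSum_apply] at h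
    have := Finset.sum_eq_zero_iff.mp h v v.2
    simp at this
  · intro κ κ' h
    apply Subtype.ext
    funext v
    by_cases hv : v ∈ S
    · exact congrArg Subtype.val (congrFun h ⟨v, hv⟩)
    · rw [κ.2.1 v hv, κ'.2.1 v hv]

theorem ne_of_content {S : Finset ℕ} {κ : ℕ → ℕ} {f : ℕ →₀ ℕ}
    (h : ∑ v ∈ S, Finsupp.single (κ v) 1 = f) {i : ℕ} (hi : f i = 0) {v : ℕ} (hv : v ∈ S) :
    κ v ≠ i := by
  rintro rfl
  rw [← h, Finsupp.finsetSum_apply] at hi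
  have := Finset.sum_eq_zero_iff.mp hi v hv
  simp at this

/-- Colourings are counted by choosing the set of vertices of colour `i`. -/
theorem card_colourings (G : SimpleGraph ℕ) (S : Finset ℕ) {i b : ℕ} {f : ℕ →₀ ℕ} (hi : f i = 0) :
    Nat.card (colourings G S (Finsupp.single i b + f)) =
      ∑ B ∈ stableOfSize G S b, Nat.card (colourings G (S \ B) f) := by
  classical
  rw [← Finset.sum_coe_sort, ← Nat.card_sigma]
  symm
  let ψ : (Σ B : stableOfSize G S b, colourings G (S \ B.1) f) → ℕ → ℕ :=
    fun p v => if v ∈ p.1.1 then i else p.2.1 v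
  have hB : ∀ p : (Σ B : stableOfSize G S b, colourings G (S \ B.1) f), ∀ v,
      v ∈ p.1.1 ↔ v ∈ S ∧ ψ p v = i := by
    rintro ⟨⟨B, hB⟩, ⟨κ, hκ⟩⟩ v
    obtain ⟨⟨h1, -⟩, -⟩ := mem_stableOfSize.mp hB
    simp only [ψ]
    constructor
    · exact fun h => ⟨h1 h, if_pos h⟩
    · rintro ⟨hv, h⟩
      by_contra hvB
      rw [if_neg hvB] at h
      exact ne_of_content hκ.2.2 hi (Finset.mem_sdiff.mpr ⟨hv, hvB⟩) h
  have hψ : ∀ p, ψ p ∈ colourings G S (Finsupp.single i b + f) := by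
    rintro ⟨⟨B, hB⟩, ⟨κ, h1, h2, h3⟩⟩
    obtain ⟨⟨k1, k2⟩, k3⟩ := mem_stableOfSize.mp hB
    refine ⟨fun v hv => ?_, fun u hu v hv huv => ?_, ?_⟩
    · simp only [ψ]
      rw [if_neg fun h => hv (k1 h)]
      exact h1 v fun h => hv (Finset.sdiff_subset h)
    · simp only [ψ]
      have := fun {v} (hv : v ∈ S \ B) => ne_of_content h3 hi hv
      split_ifs with a b b
      · exact absurd huv (k2 u a v b)
      · exact (this (Finset.mem_sdiff.mpr ⟨hv, b⟩)).symm
      · exact this (Finset.mem_sdiff.mpr ⟨hu, a⟩)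
      · exact h2 u (Finset.mem_sdiff.mpr ⟨hu, a⟩) v (Finset.mem_sdiff.mpr ⟨hv, b⟩) huv
    · rw [← Finset.sum_sdiff k1, add_comm]
      refine congrArg₂ _ ?_ (Eq.trans ?_ h3)
      · rw [Finset.sum_congr rfl (g := fun _ => Finsupp.single i 1)
          (fun v hv => by simp only [ψ, if_pos hv]), Finset.sum_const, k3, Finsupp.smul_single]
        simp
      · refine Finset.sum_congr rfl fun v hv => ?_
        simp only [ψ]
        rw [if_neg (Finset.mem_sdiff.mp hv).2]
  refine Nat.card_congr (Equiv.ofBijective (fun p => ⟨ψ p, hψ p⟩) ⟨?_, ?_⟩)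
  · intro p q hpq
    have hpq : ψ p = ψ q := congrArg Subtype.val hpq
    have h1 : p.1 = q.1 := by
      apply Subtype.ext
      ext v
      rw [hB p v, hB q v, hpq]
    obtain ⟨B, κ⟩ := p
    obtain ⟨B', κ'⟩ := q
    simp only at h1
    subst h1
    congr 1
    apply Subtype.ext
    funext v
    by_cases hv : v ∈ B.1
    · rw [κ.2.1 v (by simp [hv]), κ'.2.1 v (by simp [hv])]
    · have := congrFun hpq v
      simpa only [ψ, if_neg hv] using this
  · rintro ⟨κ, h1, h2, h3⟩
    have hcard : (S.filter fun v => κ v = i).card = b := by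
      have := congrArg (fun g : ℕ →₀ ℕ => g i) h3
      simp only [Finsupp.finsetSum_apply, Finsupp.single_apply, Finsupp.add_apply, hi, if_true] at this
      rw [Finset.card_filter, this, add_zero]
    have hmem : (S.filter fun v => κ v = i) ∈ stableOfSize G S b := by
      refine mem_stableOfSize.mpr ⟨⟨Finset.filter_subset _ _, ?_⟩, hcard⟩
      intro u hu v hv huv
      rw [Finset.mem_filter] at hu hv
      exact h2 u hu.1 v hv.1 huv (hu.2.trans hv.2.symm)
    refine ⟨⟨⟨_, hmem⟩, ⟨fun v => if v ∈ S.filter (fun v => κ v = i) then 0 else κ v, ?_, ?_, ?_⟩⟩, ?_⟩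
    · intro v hv
      beta_reduce
      split_ifs with h
      · rfl
      · exact h1 v fun h' => hv (Finset.mem_sdiff.mpr ⟨h', h⟩)
    · intro u hu v hv huv
      rw [Finset.mem_sdiff] at hu hv
      beta_reduce
      rw [if_neg hu.2, if_neg hv.2]
      exact h2 u hu.1 v hv.1 huv
    · have h4 := h3
      rw [← Finset.sum_sdiff (Finset.filter_subset (fun v => κ v = i) S), add_comm,
        Finset.sum_congr (g := fun _ => Finsupp.single i 1) rfl
          (fun v hv => by rw [(Finset.mem_filter.mp hv).2]), Finset.sum_const, hcard,
        Finsupp.smul_single, smul_eq_mul, mul_one] at h4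
      rw [← add_left_cancel h4]
      refine Finset.sum_congr rfl fun v hv => ?_
      beta_reduce
      rw [if_neg (Finset.mem_sdiff.mp hv).2]
    · apply Subtype.ext
      funext v
      simp only [ψ]
      split_ifs with h
      · exact (Finset.mem_filter.mp h).2.symm
      · rfl

theorem card_colourings_zero (G : SimpleGraph ℕ) (S : Finset ℕ) :
    Nat.card (colourings G S 0) = if S = ∅ then 1 else 0 := by
  split_ifs with h
  · subst h
    rw [Nat.card_eq_one_iff_unique]
    refine ⟨⟨fun a b => Subtype.ext (funext fun v => ?_)⟩, ⟨⟨fun _ => 0, by simp [colourings]⟩⟩⟩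
    rw [a.2.1 v (by simp), b.2.1 v (by simp)]
  · have : IsEmpty (colourings G S 0) := by
      refine ⟨fun κ => ?_⟩
      obtain ⟨v, hv⟩ := Finset.nonempty_iff_ne_empty.mpr h
      exact ne_of_content κ.2.2.2 (i := κ.1 v) rfl hv rfl
    exact Nat.card_of_isEmpty

/-- The number of proper colourings with a given content depends linearly on the block polynomial. -/
theorem exists_functional (d : ℕ →₀ ℕ) : ∃ Φ : MvPolynomial ℕ ℕ →+ ℕ, ∀ (G : SimpleGraph ℕ) (k : ℕ)
    (S : Finset ℕ), S ⊆ Finset.range k → Φ (blockPoly G k S) = Nat.card (colourings G S d) := by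
  induction d using Finsupp.induction with
  | zero =>
    refine ⟨(MvPolynomial.constantCoeff : MvPolynomial ℕ ℕ →+* ℕ), fun G k S hS => ?_⟩
    rw [card_colourings_zero]
    exact constantCoeff_blockPoly G k S hS
  | single_add i b f hi hb ih =>
    obtain ⟨Φ, h⟩ := ih
    refine ⟨Φ.comp (MvPolynomial.pderiv b).toLinearMap.toAddMonoidHom, fun G k S hS => ?_⟩
    rw [card_colourings G S (Finsupp.notMem_support_iff.mp hi)]
    change Φ (MvPolynomial.pderiv b (blockPoly G k S)) = _
    rw [pderiv_blockPoly G hb k S hS, map_sum]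
    exact Finset.sum_congr rfl fun B _ => h G k _ (Finset.sdiff_subset.trans hS)

theorem chromaticSymmetricFunction_onFin (n : ℕ) (G : SimpleGraph ℕ) (d : ℕ →₀ ℕ) :
    chromaticSymmetricFunction (onFin n G) d = Nat.card (colourings G (Finset.range n) d) := by
  rw [chromaticSymmetricFunction]
  congr 1
  have hsum : ∀ κ : ℕ → ℕ, ∑ v ∈ Finset.range n, Finsupp.single (κ v) 1
      = ∑ v : Fin n, (Finsupp.single (κ v) 1 : ℕ →₀ ℕ) := fun κ =>
    Finset.sum_range fun v => Finsupp.single (κ v) 1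
  symm
  refine Nat.card_congr (Equiv.ofBijective
    (fun κ => ⟨⟨fun v => κ.1 v, fun {u v} huv => κ.2.2.1 u (by simp) v (by simp) huv⟩, ?_⟩) ⟨?_, ?_⟩)
  · exact (hsum κ.1).symm.trans κ.2.2.2
  · intro κ κ' h
    apply Subtype.ext
    funext v
    by_cases hv : v < n
    · have := congrArg Subtype.val h
      exact DFunLike.congr_fun this ⟨v, hv⟩
    · rw [κ.2.1 v (by simpa using hv), κ'.2.1 v (by simpa using hv)]
  · rintro ⟨κ, hκ⟩
    refine ⟨⟨fun v => if h : v < n then κ ⟨v, h⟩ else 0, fun v hv => ?_, ?_, ?_⟩, ?_⟩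
    · rw [Finset.mem_range] at hv
      simp [hv]
    · intro u hu v hv huv
      rw [Finset.mem_range] at hu hv
      simp only [hu, hv, dif_pos]
      exact κ.valid huv
    · rw [hsum, ← hκ]
      simp [colorContent]
    · apply Subtype.ext
      apply RelHom.ext
      intro v
      exact dif_pos v.2

end Colourings

/-! ### Chromatic symmetric functions of disjoint unions -/

section Products

variable {V W : Type*} [Fintype V] [Fintype W]

theorem chromaticSymmetricFunction_congr {G : SimpleGraph V} {H : SimpleGraph W} (e : G ≃g H) :
    chromaticSymmetricFunction G = chromaticSymmetricFunction H := by
  funext d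
  rw [chromaticSymmetricFunction, chromaticSymmetricFunction]
  congr 1
  have hc : ∀ κ : H.Coloring ℕ, colorContent (κ.comp e.toHom) = colorContent κ := fun κ =>
    Equiv.sum_comp e.toEquiv fun w => Finsupp.single (κ w) 1
  symm
  refine Nat.card_congr ⟨fun κ => ⟨κ.1.comp e.toHom, (hc κ.1).trans κ.2⟩,
    fun κ => ⟨κ.1.comp e.symm.toHom, ?_⟩, fun κ => ?_, fun κ => ?_⟩
  · refine (hc _).symm.trans (Eq.trans (congrArg colorContent ?_) κ.2)
    funext v
    simp
  · apply Subtype.ext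
    apply RelHom.ext
    intro v
    simp
  · apply Subtype.ext
    apply RelHom.ext
    intro v
    simp

theorem colorContent_sum (κ : V ⊕ W → ℕ) :
    colorContent κ = colorContent (fun v => κ (Sum.inl v)) + colorContent fun w => κ (Sum.inr w) :=
  Fintype.sum_sum_type _

/-- The chromatic symmetric function of a disjoint union is the product. -/
theorem chromaticSymmetricFunction_sum (G : SimpleGraph V) (H : SimpleGraph W) :
    chromaticSymmetricFunction (G ⊕g H) =
      chromaticSymmetricFunction G * chromaticSymmetricFunction H := by
  classical
  ext d
  rw [MvPowerSeries.coeff_mul]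
  change (Nat.card _ : ℚ) = ∑ p ∈ Finset.HasAntidiagonal.antidiagonal d, (Nat.card _ : ℚ) * (Nat.card _ : ℚ)
  have hfin : ∀ {U : Type _} [Fintype U] (K : SimpleGraph U) (d : ℕ →₀ ℕ),
    Finite {κ : K.Coloring ℕ // colorContent κ = d} := fun K d => finite_coloring_of_content K d
  have := hfin G
  have := finite_coloring_of_content H
  have key : Nat.card {κ : (G ⊕g H).Coloring ℕ // colorContent κ = d} =
      Nat.card (Σ p : Finset.HasAntidiagonal.antidiagonal d, {κ : G.Coloring ℕ // colorContent κ = p.1.1} ×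
        {κ : H.Coloring ℕ // colorContent κ = p.1.2}) := by
    symm
    refine Nat.card_congr (Equiv.ofBijective (fun q => ⟨⟨Sum.elim q.2.1.1 q.2.2.1, ?_⟩, ?_⟩) ⟨?_, ?_⟩)
    · rintro (a | a) (b | b) hab
      · exact q.2.1.1.valid hab
      · exact absurd hab (by simp)
      · exact absurd hab (by simp)
      · exact q.2.2.1.valid hab
    · refine (colorContent_sum _).trans ?_
      exact (congrArg₂ _ q.2.1.2 q.2.2.2).trans (Finset.HasAntidiagonal.mem_antidiagonal.mp q.1.2)
    · rintro ⟨⟨⟨p1, p2⟩, hp⟩, ⟨κ, hκ⟩, ⟨κ', hκ'⟩⟩ ⟨⟨⟨r1, r2⟩, hr⟩, ⟨χ, hχ⟩, ⟨χ', hχ'⟩⟩ h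
      have h1 := congrArg Subtype.val h
      have e1 : κ = χ := RelHom.ext fun v => DFunLike.congr_fun h1 (Sum.inl v)
      have e2 : κ' = χ' := RelHom.ext fun v => DFunLike.congr_fun h1 (Sum.inr v)
      subst e1 e2
      simp only at hκ hκ' hχ hχ'
      subst hκ hκ'
      subst hχ hχ'
      rfl
    · rintro ⟨κ, hκ⟩
      have hs := colorContent_sum κ
      rw [hκ] at hs
      refine ⟨⟨⟨(_, _), Finset.HasAntidiagonal.mem_antidiagonal.mpr hs.symm⟩,
        ⟨⟨fun v => κ (Sum.inl v), fun hab => κ.valid (by simpa using hab)⟩, rfl⟩,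
        ⟨⟨fun v => κ (Sum.inr v), fun hab => κ.valid (by simpa using hab)⟩, rfl⟩⟩, ?_⟩
      apply Subtype.ext
      apply RelHom.ext
      rintro (v | v) <;> rfl
  rw [key, Nat.card_sigma]
  push_cast
  rw [← Finset.sum_coe_sort (Finset.HasAntidiagonal.antidiagonal d)]
  refine Finset.sum_congr rfl fun p _ => ?_
  rw [Nat.card_prod, Nat.cast_mul]

end Products

/-! ### Disjoint unions of complete graphs -/

section Cliques

theorem mem_stableOfSize_top {S B : Finset ℕ} {b : ℕ} (hb : b ≠ 0) :
    B ∈ stableOfSize ⊤ S b ↔ b = 1 ∧ ∃ v ∈ S, B = {v} := by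
  rw [mem_stableOfSize]
  constructor
  · rintro ⟨⟨h1, h2⟩, h3⟩
    obtain ⟨v, hv⟩ := Finset.card_pos.mp (by omega : 0 < B.card)
    have hB : B = {v} := by
      ext u
      rw [Finset.mem_singleton]
      constructor
      · intro hu
        by_contra huv
        exact h2 u hu v hv huv
      · rintro rfl; exact hv
    subst hB
    exact ⟨h3.symm.trans (Finset.card_singleton v), v, h1 hv, rfl⟩
  · rintro ⟨rfl, v, hv, rfl⟩
    refine ⟨⟨by simpa using hv, ?_⟩, Finset.card_singleton v⟩
    intro a ha b hb hab
    rw [Finset.mem_singleton] at ha hb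
    exact hab.ne (ha.trans hb.symm)

open Classical in
theorem card_colourings_top (d : ℕ →₀ ℕ) : ∀ S : Finset ℕ, Nat.card (colourings ⊤ S d) =
    if (∀ i, d i ≤ 1) ∧ d.degree = S.card then S.card.factorial else 0 := by
  induction d using Finsupp.induction with
  | zero =>
    intro S
    rw [card_colourings_zero]
    by_cases hS : S = ∅
    · simp [hS]
    · rw [if_neg hS, if_neg]
      rintro ⟨-, h⟩
      rw [map_zero] at h
      exact hS (Finset.card_eq_zero.mp h.symm)
  | single_add i b f hi hb ih =>
    intro S
    have hfi := Finsupp.notMem_support_iff.mp hi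
    rw [card_colourings ⊤ S hfi]
    have hdeg : (Finsupp.single i b + f).degree = b + f.degree := by
      rw [map_add, Finsupp.degree_single]
    by_cases hb1 : b = 1
    · subst hb1
      have hst : stableOfSize ⊤ S 1 = S.image fun v => {v} := by
        ext B
        rw [mem_stableOfSize_top one_ne_zero, Finset.mem_image]
        simp [eq_comm]
      have hle : (∀ j, (Finsupp.single i 1 + f : ℕ →₀ ℕ) j ≤ 1) ↔ ∀ j, f j ≤ 1 := by
        refine forall_congr' fun j => ?_
        rw [Finsupp.add_apply, Finsupp.single_apply]
        split_ifs with h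
        · subst h; simp [hfi]
        · simp
      rw [hst, Finset.sum_image fun a _ b _ h => Finset.singleton_injective h, hdeg, hle]
      have : ∀ v ∈ S, Nat.card (colourings ⊤ (S \ {v}) f) =
          if (∀ j, f j ≤ 1) ∧ 1 + f.degree = S.card then (S.card - 1).factorial else 0 := by
        intro v hv
        have hpos := Finset.card_pos.mpr ⟨v, hv⟩
        rw [ih, Finset.card_sdiff_of_subset (by simpa using hv), Finset.card_singleton]
        have : f.degree = S.card - 1 ↔ 1 + f.degree = S.card := by omega
        simp only [this]
      rw [Finset.sum_congr rfl this, Finset.sum_const, smul_eq_mul]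
      split_ifs with h
      · rw [Nat.mul_factorial_pred (by omega)]
      · rw [mul_zero]
    · rw [Finset.sum_eq_zero, if_neg]
      · rintro ⟨h, -⟩
        have := h i
        rw [Finsupp.add_apply, Finsupp.single_eq_same, hfi] at this
        omega
      · intro B hB
        exact absurd ((mem_stableOfSize_top hb).mp hB).1 hb1

theorem chromaticSymmetricFunction_top (a : ℕ) :
    chromaticSymmetricFunction (onFin a ⊤) = (a.factorial : ℚ) • elementarySymm a := by
  classical
  ext d
  change chromaticSymmetricFunction (onFin a ⊤) d = (a.factorial : ℚ) * elementarySymm a d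
  rw [chromaticSymmetricFunction_onFin, card_colourings_top, Finset.card_range, elementarySymm]
  split_ifs <;> simp

/-- The disjoint union of complete graphs of the given sizes. -/
def cliqueUnion : List ℕ → SimpleGraph ℕ
  | [] => ⊥
  | a :: l =>
    { Adj := fun i j => (cliqueUnion l).Adj i j ∨
        (i ≠ j ∧ (l.sum ≤ i ∧ i < l.sum + a) ∧ l.sum ≤ j ∧ j < l.sum + a)
      symm := ⟨fun _ _ h => h.imp (fun h => h.symm) fun h => ⟨h.1.symm, h.2.2, h.2.1⟩⟩
      loopless := ⟨fun _ h => h.elim (fun h => (cliqueUnion l).loopless.irrefl _ h) fun h => h.1 rfl⟩ }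

theorem cliqueUnion_lt (l : List ℕ) : ∀ i j, (cliqueUnion l).Adj i j → i < l.sum := by
  induction l with
  | nil => exact fun i j h => h.elim
  | cons a l ih =>
    rintro i j (h | h)
    · have := ih i j h
      rw [List.sum_cons]
      omega
    · rw [List.sum_cons]
      omega

/-- The product of the elementary symmetric functions of the given degrees. -/
noncomputable def elementaryProd (l : List ℕ) : MvPowerSeries ℕ ℚ := (l.map elementarySymm).prod

/-- The product of the factorials of the members of a list. -/
def factorialProd (l : List ℕ) : ℕ := (l.map Nat.factorial).prod

theorem chromaticSymmetricFunction_cliqueUnion (l : List ℕ) : ∀ n, l.sum = n →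
    chromaticSymmetricFunction (onFin n (cliqueUnion l)) = (factorialProd l : ℚ) • elementaryProd l := by
  induction l with
  | nil =>
    rintro n rfl
    have : cliqueUnion [] = ⊥ := rfl
    have h0 : onFin 0 ⊥ = onFin 0 ⊤ := by ext i; exact i.elim0
    rw [List.sum_nil, this, h0, chromaticSymmetricFunction_top]
    have h1 : elementarySymm 0 = 1 := by
      classical
      ext d
      rw [MvPowerSeries.coeff_one]
      change elementarySymm 0 d = _
      rw [elementarySymm]
      congr 1
      rw [Finsupp.degree_eq_zero_iff]
      exact propext ⟨fun h => h.2, fun h => ⟨by simp [h], h⟩⟩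
    simp [factorialProd, elementaryProd, h1]
  | cons a l ih =>
    intro n hn
    obtain rfl : n = l.sum + a := by rw [← hn, List.sum_cons, add_comm]
    have e : onFin l.sum (cliqueUnion l) ⊕g onFin a ⊤ ≃g onFin (l.sum + a) (cliqueUnion (a :: l)) := by
      refine ⟨finSumFinEquiv, ?_⟩
      have hlt := cliqueUnion_lt l
      have hlt' : ∀ i j, (cliqueUnion l).Adj i j → j < l.sum := fun i j h => hlt j i h.symm
      rintro (i | i) (j | j)
      · change ((cliqueUnion l).Adj i j ∨ _) ↔ (cliqueUnion l).Adj i j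
        refine or_iff_left fun h => ?_
        have := i.2
        have h2 : l.sum ≤ i.1 := h.2.1.1
        omega
      · refine iff_of_false ?_ (by simp)
        rintro (h | h)
        · have h2 := hlt' _ _ h
          simp at h2
        · have h2 := h.2.1.1
          simp at h2
          omega
      · refine iff_of_false ?_ (by simp)
        rintro (h | h)
        · have h2 := hlt _ _ h
          simp at h2
        · have h2 := h.2.2.1
          simp at h2
          omega
      · change ((cliqueUnion l).Adj (l.sum + i) (l.sum + j) ∨
          (l.sum + i.1 ≠ l.sum + j.1 ∧ (l.sum ≤ l.sum + i.1 ∧ l.sum + i.1 < l.sum + a) ∧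
            l.sum ≤ l.sum + j.1 ∧ l.sum + j.1 < l.sum + a)) ↔ i.1 ≠ j.1
        have := i.2
        have := j.2
        constructor
        · rintro (h | h)
          · have := hlt _ _ h
            omega
          · omega
        · intro h
          right
          omega
    rw [← chromaticSymmetricFunction_congr e, chromaticSymmetricFunction_sum, ih _ rfl,
      chromaticSymmetricFunction_top, factorialProd, factorialProd, elementaryProd, elementaryProd,
      List.map_cons, List.map_cons, List.prod_cons, List.prod_cons, smul_mul_smul_comm, mul_comm]
    push_cast
    rw [mul_comm (elementarySymm a)]

end Cliques

/-! ### Positivity in terms of the polynomials of stable partitions -/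

section EPositive

/-- `F` is a nonnegative linear combination of the `e_λ` for the partitions `λ` of `n`. -/
def IsEPositiveSeries (n : ℕ) (F : MvPowerSeries ℕ ℚ) : Prop :=
  ∃ c : n.Partition → ℚ, (∀ p, 0 ≤ c p) ∧ F = ∑ p, c p • elementarySymmPart p

theorem isEPositiveSeries_zero (n : ℕ) : IsEPositiveSeries n 0 :=
  ⟨0, fun _ => le_rfl, by simp⟩

theorem IsEPositiveSeries.add {n : ℕ} {F F' : MvPowerSeries ℕ ℚ} (h : IsEPositiveSeries n F)
    (h' : IsEPositiveSeries n F') : IsEPositiveSeries n (F + F') := by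
  obtain ⟨c, hc, rfl⟩ := h
  obtain ⟨c', hc', rfl⟩ := h'
  refine ⟨c + c', fun p => add_nonneg (hc p) (hc' p), ?_⟩
  simp [add_smul, Finset.sum_add_distrib]

theorem elementaryProd_filter (l : List ℕ) :
    (((l : Multiset ℕ).filter (· ≠ 0)).map elementarySymm).prod = elementaryProd l := by
  induction l with
  | nil => simp [elementaryProd]
  | cons a l ih =>
    have h1 : elementarySymm 0 = 1 := by
      classical
      ext d
      rw [MvPowerSeries.coeff_one]
      change elementarySymm 0 d = _
      rw [elementarySymm]
      congr 1
      rw [Finsupp.degree_eq_zero_iff]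
      exact propext ⟨fun h => h.2, fun h => ⟨by simp [h], h⟩⟩
    have h2 : elementaryProd (a :: l) = elementarySymm a * elementaryProd l := by
      simp [elementaryProd]
    rw [h2, ← ih, ← Multiset.cons_coe]
    by_cases ha : a = 0
    · subst ha
      rw [Multiset.filter_cons_of_neg (p := fun x => x ≠ 0) _ (by simp), h1, one_mul]
    · rw [Multiset.filter_cons_of_pos (p := fun x => x ≠ 0) _ ha, Multiset.map_cons, Multiset.prod_cons]

theorem isEPositiveSeries_elementaryProd {l : List ℕ} {q : ℚ} (hq : 0 ≤ q) :
    IsEPositiveSeries l.sum (q • elementaryProd l) := by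
  classical
  refine ⟨Pi.single (Nat.Partition.ofSums l.sum (l : Multiset ℕ) (Multiset.sum_coe l)) q,
    fun p => ?_, ?_⟩
  · rw [Pi.single_apply]
    split_ifs
    · exact hq
    · exact le_rfl
  · rw [Finset.sum_eq_single (Nat.Partition.ofSums l.sum (l : Multiset ℕ) (Multiset.sum_coe l))]
    · rw [Pi.single_eq_same, elementarySymmPart]
      congr 1
      exact (elementaryProd_filter l).symm
    · intro p _ hp
      rw [Pi.single_eq_of_ne hp, zero_smul]
    · simp

theorem isEPositive_iff {V : Type*} [Fintype V] {G : SimpleGraph V} {n : ℕ} (hn : Fintype.card V = n) :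
    IsEPositive G ↔ IsEPositiveSeries n (chromaticSymmetricFunction G) := by
  subst hn
  rfl

theorem IsEPositive.of_iso {V W : Type*} [Fintype V] [Fintype W] {G : SimpleGraph V}
    {H : SimpleGraph W} (e : G ≃g H) (h : IsEPositive G) : IsEPositive H := by
  rw [isEPositive_iff (Fintype.card_congr e.toEquiv).symm, ← chromaticSymmetricFunction_congr e]
  exact h

/-- If a multiple of the block polynomial of `G` is a nonnegative combination of block polynomials of
disjoint unions of complete graphs, then `G` is `e`-positive. -/
theorem isEPositive_of_blockPoly {n D : ℕ} {G : SimpleGraph ℕ} (hD : D ≠ 0) (L : List (ℕ × List ℕ))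
    (hL : ∀ p ∈ L, p.2.sum = n)
    (h : D • blockPoly G n (Finset.range n) =
      (L.map fun p => p.1 • blockPoly (cliqueUnion p.2) n (Finset.range n)).sum) :
    IsEPositive (onFin n G) := by
  rw [isEPositive_iff (Fintype.card_fin n)]
  have key : chromaticSymmetricFunction (onFin n G) =
      (L.map fun p => ((p.1 * factorialProd p.2 : ℕ) / D : ℚ) • elementaryProd p.2).sum := by
    have h1 : (D : ℚ) • chromaticSymmetricFunction (onFin n G) =
        (L.map fun p => (p.1 : ℚ) • chromaticSymmetricFunction (onFin n (cliqueUnion p.2))).sum := by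
      ext d
      obtain ⟨Φ, hΦ⟩ := exists_functional d
      have h2 := congrArg Φ h
      rw [map_nsmul, hΦ _ _ _ subset_rfl, map_list_sum, List.map_map] at h2
      have h3 : (D : ℚ) * chromaticSymmetricFunction (onFin n G) d = (L.map fun p =>
          (p.1 : ℚ) * chromaticSymmetricFunction (onFin n (cliqueUnion p.2)) d).sum := by
        rw [chromaticSymmetricFunction_onFin, ← Nat.cast_mul, ← smul_eq_mul, h2, Nat.cast_list_sum,
          List.map_map]
        congr 1
        refine List.map_congr_left fun p _ => ?_
        rw [chromaticSymmetricFunction_onFin, ← Nat.cast_mul, ← smul_eq_mul]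
        simp only [Function.comp_apply]
        rw [map_nsmul, hΦ _ _ _ subset_rfl]
      refine Eq.trans h3 ?_
      rw [map_list_sum, List.map_map]
      rfl
    have hD' : (D : ℚ) ≠ 0 := Nat.cast_ne_zero.mpr hD
    rw [← inv_smul_smul₀ hD' (chromaticSymmetricFunction (onFin n G)), h1, List.smul_sum,
      List.map_map]
    congr 1
    refine List.map_congr_left fun p hp => ?_
    simp only [Function.comp_apply]
    rw [chromaticSymmetricFunction_cliqueUnion _ _ (hL p hp), smul_smul, smul_smul]
    congr 1
    push_cast
    field_simp
  rw [key]
  clear key h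
  induction L with
  | nil => exact isEPositiveSeries_zero n
  | cons p L ih =>
    rw [List.map_cons, List.sum_cons]
    refine IsEPositiveSeries.add ?_ (ih fun q hq => hL q (by simp [hq]))
    have := isEPositiveSeries_elementaryProd (l := p.2)
      (q := ((p.1 * factorialProd p.2 : ℕ) / D : ℚ)) (by positivity)
    rwa [hL p (by simp)] at this

end EPositive

/-! ### Recovering a polynomial from one of its values -/

section Evaluation

open MvPolynomial

theorem bell_succ_range (u : ℕ) :
    Nat.bell (u + 1) = ∑ j ∈ Finset.range (u + 1), u.choose j * Nat.bell (u - j) := by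
  rw [Nat.bell_succ, Nat.range_succ_eq_Iic]

theorem bell_lt : ∀ u ≤ 11, Nat.bell u < 2 ^ 20 := by
  decide +kernel

theorem eval_blockPoly_le (G : SimpleGraph ℕ) {z : ℕ → ℕ} {Z : ℕ} (hz : ∀ j, z j ≤ Z ^ j) (k : ℕ) :
    ∀ S : Finset ℕ, S ⊆ Finset.range k → eval z (blockPoly G k S) ≤ Nat.bell S.card * Z ^ S.card := by
  induction k with
  | zero =>
    intro S hS
    have : S = ∅ := by simpa using hS
    simp [blockPoly, this]
  | succ k ih =>
    intro S hS
    by_cases hk : k ∈ S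
    · set S' := S ∩ Finset.range k with hS'
      have hkS' : k ∉ S' := by simp [hS']
      have hSi : S = insert k S' := by
        ext i
        rw [hS', Finset.mem_insert, Finset.mem_inter, Finset.mem_range]
        constructor
        · intro hi
          have := Finset.mem_range.mp (hS hi)
          by_cases h : i = k
          · exact Or.inl h
          · exact Or.inr ⟨hi, by omega⟩
        · rintro (rfl | h)
          · exact hk
          · exact h.1
      have hcard : S.card = S'.card + 1 := by
        conv_lhs => rw [hSi]
        exact Finset.card_insert_of_notMem hkS'
      rw [blockPoly, if_pos hk, map_sum, hcard, bell_succ_range, Finset.sum_mul]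
      calc ∑ A ∈ blocksBelow G k S, eval z (X (A.card + 1) * blockPoly G k (S \ A))
          ≤ ∑ A ∈ S'.powerset, Nat.bell (S'.card - A.card) * Z ^ (S'.card + 1) := by
            refine (Finset.sum_le_sum fun A hA => ?_).trans (Finset.sum_le_sum_of_subset fun A hA =>
              Finset.mem_powerset.mpr (mem_blocksBelow.mp hA).1)
            have hAS := (mem_blocksBelow.mp hA).1
            have e : blockPoly G k (S \ A) = blockPoly G k (S' \ A) := by
              refine blockPoly_congr G k _ _ ?_
              rw [Finset.sdiff_inter_right_comm, Finset.sdiff_inter_right_comm, hS',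
                Finset.inter_assoc, Finset.inter_self]
            rw [map_mul, eval_X, e]
            have h1 := ih (S' \ A) (Finset.sdiff_subset.trans Finset.inter_subset_right)
            rw [Finset.card_sdiff_of_subset hAS] at h1
            have h2 := Finset.card_le_card hAS
            calc z (A.card + 1) * eval z (blockPoly G k (S' \ A))
                ≤ Z ^ (A.card + 1) * (Nat.bell (S'.card - A.card) * Z ^ (S'.card - A.card)) :=
                  Nat.mul_le_mul (hz _) h1
              _ = Nat.bell (S'.card - A.card) * (Z ^ (A.card + 1) * Z ^ (S'.card - A.card)) := by ring
              _ = _ := by rw [← pow_add, show A.card + 1 + (S'.card - A.card) = S'.card + 1 by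
                            have : A.card ≤ S'.card := h2
                            omega]
        _ = _ := by
            rw [Finset.sum_powerset_apply_card fun j => Nat.bell (S'.card - j) * Z ^ (S'.card + 1)]
            refine Finset.sum_congr rfl fun j _ => ?_
            rw [smul_eq_mul, mul_assoc]
    · rw [blockPoly, if_neg hk]
      refine ih S fun i hi => ?_
      have h1 := Finset.mem_range.mp (hS hi)
      have : i ≠ k := fun h2 => hk (h2 ▸ hi)
      exact Finset.mem_range.mpr (by omega)

theorem coeff_blockPoly_le (G : SimpleGraph ℕ) (k : ℕ) (S : Finset ℕ) (hS : S ⊆ Finset.range k)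
    (d : ℕ →₀ ℕ) : coeff d (blockPoly G k S) ≤ Nat.bell S.card := by
  have h := eval_blockPoly_le G (z := fun _ => 1) (Z := 1) (fun j => by simp) k S hS
  rw [one_pow, mul_one, eval_eq] at h
  by_cases hd : d ∈ (blockPoly G k S).support
  · refine le_trans ?_ h
    have := Finset.single_le_sum (f := fun d => coeff d (blockPoly G k S) *
      ∏ i ∈ d.support, (1 : ℕ) ^ d i) (fun _ _ => Nat.zero_le _) hd
    simpa using this
  · rw [notMem_support_iff.mp hd]
    exact Nat.zero_le _

/-- The monomials of the block polynomial have weight `|S|`, and their variables belong to the sizes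
of stable sets. -/
theorem blockPoly_support (G : SimpleGraph ℕ) {a : ℕ} (k : ℕ)
    (ha : ∀ A ⊆ Finset.range k, IsStable G A → A.card ≤ a) : ∀ S : Finset ℕ, S ⊆ Finset.range k →
    (blockPoly G k S).IsWeightedHomogeneous (fun i : ℕ => i) S.card ∧
      blockPoly G k S ∈ supported ℕ (Set.Icc 1 a) := by
  induction k with
  | zero =>
    intro S hS
    have : S = ∅ := by simpa using hS
    subst this
    exact ⟨isWeightedHomogeneous_one ℕ _, one_mem _⟩
  | succ k ih =>
    have ih := ih fun A hA => ha A (hA.trans (Finset.range_mono (Nat.le_succ k)))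
    intro S hS
    by_cases hk : k ∈ S
    · have hkS : ∀ A ∈ blocksBelow G k S, insert k A ⊆ S ∧ k ∉ A := fun A hA => by
        have h1 := (mem_blocksBelow.mp hA).1
        exact ⟨Finset.insert_subset hk (h1.trans Finset.inter_subset_left),
          fun h => by simpa using Finset.mem_range.mp (Finset.mem_inter.mp (h1 h)).2⟩
      have e : ∀ A ∈ blocksBelow G k S, blockPoly G k (S \ A) = blockPoly G k (S \ insert k A) := by
        intro A _
        refine blockPoly_congr G k _ _ ?_
        ext i
        simp only [Finset.mem_inter, Finset.mem_sdiff, Finset.mem_insert, Finset.mem_range]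
        constructor
        · exact fun ⟨⟨h1, h2⟩, h3⟩ => ⟨⟨h1, fun h => h.elim (by omega) h2⟩, h3⟩
        · exact fun ⟨⟨h1, h2⟩, h3⟩ => ⟨⟨h1, fun h => h2 (Or.inr h)⟩, h3⟩
      have hsub : ∀ A, S \ insert k A ⊆ Finset.range k := fun A i hi => by
        rw [Finset.mem_sdiff, Finset.mem_insert, not_or] at hi
        have := Finset.mem_range.mp (hS hi.1)
        exact Finset.mem_range.mpr (by have := hi.2.1; omega)
      rw [blockPoly, if_pos hk]
      constructor
      · refine IsWeightedHomogeneous.sum _ _ _ fun A hA => ?_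
        obtain ⟨h1, h2⟩ := hkS A hA
        have h3 := (isWeightedHomogeneous_X ℕ (fun i : ℕ => i) (A.card + 1)).mul
          (ih (S \ insert k A) (hsub A)).1
        rw [e A hA]
        convert h3 using 1
        have h4 := Finset.card_le_card h1
        rw [Finset.card_sdiff_of_subset h1, Finset.card_insert_of_notMem h2]
        rw [Finset.card_insert_of_notMem h2] at h4
        omega
      · refine sum_mem fun A hA => mul_mem ?_ ?_
        · obtain ⟨h1, h2⟩ := hkS A hA
          refine Algebra.subset_adjoin ⟨A.card + 1, ⟨by omega, ?_⟩, rfl⟩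
          rw [← Finset.card_insert_of_notMem h2]
          exact ha _ (h1.trans hS) (mem_blocksBelow.mp hA).2
        · rw [e A hA]
          exact (ih _ (hsub A)).2
    · rw [blockPoly, if_neg hk]
      refine ih S fun i hi => ?_
      have h1 := Finset.mem_range.mp (hS hi)
      have : i ≠ k := fun h2 => hk (h2 ▸ hi)
      exact Finset.mem_range.mpr (by omega)

/-- Digits in base `B` are unique. -/
theorem digits_unique {B : ℕ} (N : ℕ) : ∀ f g : ℕ → ℕ, (∀ w, f w < B) → (∀ w, g w < B) →
    ∑ w ∈ Finset.range N, f w * B ^ w = ∑ w ∈ Finset.range N, g w * B ^ w → ∀ w < N, f w = g w := by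
  induction N with
  | zero => intro f g _ _ _ w hw; omega
  | succ N ih =>
    intro f g hf hg h w hw
    have e : ∀ f : ℕ → ℕ, ∑ w ∈ Finset.range (N + 1), f w * B ^ w
        = B * (∑ w ∈ Finset.range N, f (w + 1) * B ^ w) + f 0 := fun f => by
      rw [Finset.sum_range_succ', Finset.mul_sum, pow_zero, mul_one]
      congr 1
      exact Finset.sum_congr rfl fun w _ => by ring
    rw [e, e] at h
    have h0 : f 0 = g 0 := by
      have := congrArg (· % B) h
      simpa [Nat.mod_eq_of_lt (hf 0), Nat.mod_eq_of_lt (hg 0)] using this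
    have hB : 0 < B := (Nat.zero_le _).trans_lt (hf 0)
    have h1 : ∑ w ∈ Finset.range N, f (w + 1) * B ^ w = ∑ w ∈ Finset.range N, g (w + 1) * B ^ w := by
      rw [h0] at h
      exact Nat.eq_of_mul_eq_mul_left hB (Nat.add_right_cancel h)
    rcases w with _ | w
    · exact h0
    · exact ih (fun w => f (w + 1)) (fun w => g (w + 1)) (fun w => hf _) (fun w => hg _) h1 w (by omega)

theorem coeff_unique {ι : Type*} {B : ℕ} (s : Finset ι) (wt : ι → ℕ) (hwt : Set.InjOn wt s)
    {f g : ι → ℕ} (hf : ∀ d ∈ s, f d < B) (hg : ∀ d ∈ s, g d < B)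
    (h : ∑ d ∈ s, f d * B ^ wt d = ∑ d ∈ s, g d * B ^ wt d) : ∀ d ∈ s, f d = g d := by
  classical
  intro d hd
  have hB : 0 < B := (Nat.zero_le _).trans_lt (hf d hd)
  set N := s.sup wt + 1
  have hN : ∀ e ∈ s, wt e < N := fun e he => Nat.lt_succ_of_le (Finset.le_sup he)
  have e : ∀ f : ι → ℕ, ∑ d ∈ s, f d * B ^ wt d =
      ∑ w ∈ Finset.range N, (∑ d ∈ s.filter fun d => wt d = w, f d) * B ^ w := fun f => by
    rw [← Finset.sum_fiberwise_of_maps_to (t := Finset.range N) (g := wt)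
      fun e he => Finset.mem_range.mpr (hN e he)]
    refine Finset.sum_congr rfl fun w _ => ?_
    rw [Finset.sum_mul]
    exact Finset.sum_congr rfl fun d hd => by rw [(Finset.mem_filter.mp hd).2]
  have hsing : ∀ d ∈ s, (s.filter fun d' => wt d' = wt d) = {d} := fun d hd => by
    ext d'
    rw [Finset.mem_filter, Finset.mem_singleton]
    exact ⟨fun h => hwt h.1 hd h.2, fun h => by rw [h]; exact ⟨hd, rfl⟩⟩
  have hlt : ∀ f : ι → ℕ, (∀ d ∈ s, f d < B) → ∀ w, ∑ d ∈ s.filter (fun d => wt d = w), f d < B := by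
    intro f hf w
    by_cases hw : ∃ d ∈ s, wt d = w
    · obtain ⟨d, hd, rfl⟩ := hw
      rw [hsing d hd, Finset.sum_singleton]
      exact hf d hd
    · rw [Finset.sum_eq_zero]
      · exact hB
      · intro d hd
        rw [Finset.mem_filter] at hd
        exact absurd ⟨d, hd.1, hd.2⟩ hw
  rw [e f, e g] at h
  have := digits_unique N _ _ (hlt f hf) (hlt g hg) h (wt d) (hN d hd)
  simpa [hsing d hd] using this

/-- The types `[d a, …, d 1]` of the partitions of `m` into parts of size at most `a`, where `d i` is the
number of parts of size `i`. -/
def partTypes : ℕ → ℕ → List (List ℕ)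
  | 0, m => bif Nat.beq m 0 then [[]] else []
  | a+1, m => (List.range (m / (a + 1) + 1)).flatMap fun c =>
      (partTypes a (m - c * (a + 1))).map fun l => c :: l

/-- The weight of a type, where parts of size `i + 1` count with the weight `ws[i]`. -/
def typeWeight (ws : List ℕ) : List ℕ → ℕ
  | [] => 0
  | c :: l => ws.getD l.length 0 * c + typeWeight ws l

/-- The list `[d a, …, d 1]`. -/
def typeList (d : ℕ → ℕ) : ℕ → List ℕ
  | 0 => []
  | a+1 => d (a + 1) :: typeList d a

theorem length_typeList (d : ℕ → ℕ) (a : ℕ) : (typeList d a).length = a := by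
  induction a with
  | zero => rfl
  | succ a ih => rw [typeList, List.length_cons, ih]

theorem typeWeight_typeList (ws : List ℕ) (d : ℕ → ℕ) (a : ℕ) :
    typeWeight ws (typeList d a) = ∑ i ∈ Finset.Icc 1 a, ws.getD (i - 1) 0 * d i := by
  induction a with
  | zero => simp [typeList, typeWeight]
  | succ a ih =>
    rw [typeList, typeWeight, ih, length_typeList, Finset.sum_Icc_succ_top (by omega), add_comm,
      Nat.add_sub_cancel]

theorem typeList_mem (d : ℕ → ℕ) (a : ℕ) : ∀ m, ∑ i ∈ Finset.Icc 1 a, d i * i = m →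
    typeList d a ∈ partTypes a m := by
  induction a with
  | zero => simp +contextual [typeList, partTypes]
  | succ a ih =>
    intro m hm
    rw [Finset.sum_Icc_succ_top (by omega)] at hm
    rw [typeList, partTypes, List.mem_flatMap]
    refine ⟨d (a + 1), ?_, List.mem_map.mpr ⟨_, ih _ (by omega), rfl⟩⟩
    rw [List.mem_range, Nat.lt_succ_iff, Nat.le_div_iff_mul_le (by omega)]
    omega

theorem typeList_inj {d e : ℕ → ℕ} {a : ℕ} (h : typeList d a = typeList e a) :
    ∀ i, 1 ≤ i → i ≤ a → d i = e i := by
  induction a with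
  | zero => intro i h1 h2; omega
  | succ a ih =>
    rw [typeList, typeList, List.cons.injEq] at h
    intro i h1 h2
    rcases Nat.eq_or_lt_of_le h2 with rfl | h3
    · exact h.1
    · exact ih h.2 i h1 (by omega)

/-- A weighted homogeneous polynomial with small coefficients is determined by its value at powers of
`2 ^ 48`, if the exponents of these powers tell the types of partitions apart. -/
theorem eq_of_eval_eq {n a : ℕ} {ws : List ℕ} (hws : ((partTypes a n).map (typeWeight ws)).Nodup)
    {z : ℕ → ℕ} (hz : ∀ i, 1 ≤ i → i ≤ a → z i = (2 ^ 48) ^ ws.getD (i - 1) 0) {P Q : MvPolynomial ℕ ℕ}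
    (hP : P.IsWeightedHomogeneous (fun i : ℕ => i) n) (hP' : P ∈ supported ℕ (Set.Icc 1 a))
    (hP'' : ∀ d, coeff d P < 2 ^ 48)
    (hQ : Q.IsWeightedHomogeneous (fun i : ℕ => i) n) (hQ' : Q ∈ supported ℕ (Set.Icc 1 a))
    (hQ'' : ∀ d, coeff d Q < 2 ^ 48) (h : eval z P = eval z Q) : P = Q := by
  classical
  let wt : (ℕ →₀ ℕ) → ℕ := fun d => typeWeight ws (typeList d a)
  have key : ∀ P : MvPolynomial ℕ ℕ, P.IsWeightedHomogeneous (fun i : ℕ => i) n →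
      P ∈ supported ℕ (Set.Icc 1 a) → ∀ d ∈ P.support, d.support ⊆ Finset.Icc 1 a ∧
        typeList d a ∈ partTypes a n ∧ ∏ i ∈ d.support, z i ^ d i = (2 ^ 48) ^ wt d := by
    intro P hP hP' d hd
    have h1 : d.support ⊆ Finset.Icc 1 a := by
      intro i hi
      have : i ∈ P.vars := mem_vars_iff_mem_support i |>.mpr ⟨d, hd, hi⟩
      have := mem_supported.mp hP' this
      simpa using this
    refine ⟨h1, typeList_mem _ _ _ ?_, ?_⟩
    · have h3 := hP (mem_support_iff.mp hd)
      rw [Finsupp.weight_apply, Finsupp.sum_of_support_subset _ h1 _ (by simp)] at h3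
      simpa using h3
    · have h3 : ∀ i ∈ d.support, z i ^ d i = (2 ^ 48) ^ (ws.getD (i - 1) 0 * d i) := fun i hi => by
        have := Finset.mem_Icc.mp (h1 hi)
        rw [hz i this.1 this.2, pow_mul]
      rw [Finset.prod_congr rfl h3, Finset.prod_pow_eq_pow_sum]
      congr 1
      rw [Finset.sum_subset (f := fun i => ws.getD (i - 1) 0 * d i) h1 fun i _ hi => by
        rw [Finsupp.notMem_support_iff.mp hi, mul_zero]]
      exact (typeWeight_typeList ws d a).symm
  have hev : ∀ P : MvPolynomial ℕ ℕ, P.IsWeightedHomogeneous (fun i : ℕ => i) n →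
      P ∈ supported ℕ (Set.Icc 1 a) → ∀ s : Finset (ℕ →₀ ℕ), P.support ⊆ s →
      eval z P = ∑ d ∈ s, coeff d P * (2 ^ 48) ^ wt d := by
    intro P hP hP' s hs
    rw [eval_eq, ← Finset.sum_subset hs fun d _ hd => by rw [notMem_support_iff.mp hd, zero_mul]]
    exact Finset.sum_congr rfl fun d hd => by rw [(key P hP hP' d hd).2.2]
  have hinj : Set.InjOn wt (P.support ∪ Q.support : Finset (ℕ →₀ ℕ)) := by
    intro d hd e he hde
    have hk : ∀ d ∈ (P.support ∪ Q.support : Finset (ℕ →₀ ℕ)), d.support ⊆ Finset.Icc 1 a ∧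
        typeList d a ∈ partTypes a n := by
      intro d hd
      rcases Finset.mem_union.mp hd with hd | hd
      · exact ⟨(key P hP hP' d hd).1, (key P hP hP' d hd).2.1⟩
      · exact ⟨(key Q hQ hQ' d hd).1, (key Q hQ hQ' d hd).2.1⟩
    obtain ⟨h1, h2⟩ := hk d hd
    obtain ⟨h3, h4⟩ := hk e he
    have h5 := typeList_inj (List.inj_on_of_nodup_map hws h2 h4 hde)
    ext i
    by_cases hi : i ∈ Finset.Icc 1 a
    · rw [Finset.mem_Icc] at hi
      exact h5 i hi.1 hi.2
    · rw [Finsupp.notMem_support_iff.mp fun h => hi (h1 h),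
        Finsupp.notMem_support_iff.mp fun h => hi (h3 h)]
  have := coeff_unique (P.support ∪ Q.support) wt hinj (f := fun d => coeff d P)
    (g := fun d => coeff d Q) (fun d _ => hP'' d) (fun d _ => hQ'' d)
    (by rw [← hev P hP hP' _ Finset.subset_union_left, ← hev Q hQ hQ' _ Finset.subset_union_right, h])
  ext d
  by_cases hd : d ∈ P.support ∪ Q.support
  · exact this d hd
  · rw [Finset.mem_union, not_or] at hd
    rw [notMem_support_iff.mp hd.1, notMem_support_iff.mp hd.2]

end Evaluation

/-! ### Tables of values, stored in one number -/

section Tables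

/-- The positions below `N` of the nonzero digits of `m`. -/
def digitFinset (N m : ℕ) : Finset ℕ := (Finset.range N).filter fun i => m.testBit i = true

theorem mem_digitFinset {N m i : ℕ} : i ∈ digitFinset N m ↔ i < N ∧ m.testBit i = true := by
  simp [digitFinset]

/-- A function on the subsets of `{0, …, N - 1}`, written as a number with blocks of `W` digits. -/
def encode (W N : ℕ) (t : Finset ℕ → ℕ) : ℕ :=
  ∑ m ∈ Finset.range (2 ^ N), t (digitFinset N m) * 2 ^ (W * m)

variable {W N : ℕ} {t t' : Finset ℕ → ℕ}

theorem encode_congr (h : ∀ U ⊆ Finset.range N, t U = t' U) : encode W N t = encode W N t' := by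
  refine Finset.sum_congr rfl fun m _ => ?_
  rw [h (digitFinset N m) (Finset.filter_subset _ _)]

theorem encode_add (t t' : Finset ℕ → ℕ) :
    encode W N t + encode W N t' = encode W N fun U => t U + t' U := by
  rw [encode, encode, ← Finset.sum_add_distrib]
  exact Finset.sum_congr rfl fun m _ => by ring

theorem encode_mul_two_pow (t : Finset ℕ → ℕ) (z : ℕ) :
    encode W N t <<< z = encode W N fun U => 2 ^ z * t U := by
  rw [Nat.shiftLeft_eq, encode, encode, Finset.sum_mul]
  exact Finset.sum_congr rfl fun m _ => by ring

theorem sum_blocks_lt {f : ℕ → ℕ} (hf : ∀ m, f m < 2 ^ W) (M : ℕ) :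
    ∑ m ∈ Finset.range M, f m * 2 ^ (W * m) < 2 ^ (W * M) := by
  induction M with
  | zero => simp
  | succ M ih =>
    rw [Finset.sum_range_succ, Nat.mul_succ, pow_add]
    have h1 := Nat.mul_le_mul_right (2 ^ (W * M)) (Nat.succ_le_of_lt (hf M))
    rw [Nat.succ_mul, mul_comm (2 ^ W)] at h1
    omega

theorem sum_blocks_testBit {f : ℕ → ℕ} (hW : 0 < W) (hf : ∀ m, f m < 2 ^ W) (M p : ℕ) :
    (∑ m ∈ Finset.range M, f m * 2 ^ (W * m)).testBit p =
      (decide (p / W < M) && (f (p / W)).testBit (p % W)) := by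
  induction M with
  | zero => simp
  | succ M ih =>
    rw [Finset.sum_range_succ, add_comm, mul_comm (f M),
      Nat.testBit_two_pow_mul_add _ (sum_blocks_lt hf M), ih]
    have hp := Nat.div_add_mod p W
    have hr := Nat.mod_lt p hW
    by_cases h : p < W * M
    · rw [if_pos h]
      have h1 : p / W < M := Nat.div_lt_of_lt_mul h
      simp [h1, h1.trans (Nat.lt_succ_self M)]
    · rw [if_neg h]
      have h2 : M ≤ p / W := (Nat.le_div_iff_mul_le hW).mpr (by rw [mul_comm]; omega)
      by_cases h3 : p / W = M
      · have : p - W * M = p % W := by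
          rw [← h3]; omega
        rw [this, h3]
        simp
      · have h4 : ¬ p / W < M + 1 := by omega
        have h5 : M + 1 ≤ p / W := by omega
        have h6 : W ≤ p - W * M := by
          have := Nat.mul_le_mul_left W h5
          rw [Nat.mul_add, mul_one] at this
          omega
        rw [Nat.testBit_lt_two_pow ((hf M).trans_le (Nat.pow_le_pow_right two_pos h6))]
        simp [h4]

theorem encode_land_lack (hW : 0 < W) (ht : ∀ U, t U < 2 ^ W) {i : ℕ} (hi : i < N) :
    encode W N t &&& lack W N i = encode W N fun U => if i ∈ U then 0 else t U := by
  refine Nat.eq_of_testBit_eq fun p => ?_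
  rw [Nat.testBit_land, lack_testBit hW hi, encode, encode, sum_blocks_testBit hW (fun m => ht _),
    sum_blocks_testBit hW]
  · have h1 : p < W * 2 ^ N ↔ p / W < 2 ^ N := by rw [Nat.div_lt_iff_lt_mul hW, mul_comm]
    simp only [mem_digitFinset, decide_eq_decide.mpr h1]
    cases hb : (p / W).testBit i <;> (simp [hi]; try tauto)
  · intro m
    split_ifs
    · positivity
    · exact ht _

theorem digitFinset_xor {m i : ℕ} (hm : m.testBit i = true) :
    digitFinset N (m ^^^ 2 ^ i) = (digitFinset N m).erase i := by
  ext j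
  rw [Finset.mem_erase, mem_digitFinset, mem_digitFinset, Nat.testBit_xor, Nat.testBit_two_pow]
  by_cases h : i = j
  · subst h; simp [hm]
  · simp [h, Ne.symm h]

theorem xor_two_pow_add {m i : ℕ} (hm : m.testBit i = false) : m ^^^ 2 ^ i = m + 2 ^ i := by
  have h : m % 2 ^ (i + 1) = m % 2 ^ i := by
    rw [Nat.mod_pow_succ]
    have h2 := Nat.testBit_eq_decide_div_mod_eq (x := m) (i := i)
    rw [hm] at h2
    have h3 : m / 2 ^ i % 2 ≠ 1 := by simpa using h2.symm
    have h4 : m / 2 ^ i % 2 = 0 := by omega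
    rw [h4, mul_zero, add_zero]
  have h1 := Nat.div_add_mod m (2 ^ (i + 1))
  set q := m / 2 ^ (i + 1)
  set r := m % 2 ^ (i + 1)
  have hr : r < 2 ^ i := by rw [h]; exact Nat.mod_lt _ (by positivity)
  refine Nat.eq_of_testBit_eq fun j => ?_
  have e : m + 2 ^ i = 2 ^ (i + 1) * q + (2 ^ i * 1 + r) := by omega
  have hr2 : 2 ^ i * 1 + r < 2 ^ (i + 1) := by rw [pow_succ]; omega
  rw [Nat.testBit_xor, e, Nat.testBit_two_pow_mul_add _ hr2, Nat.testBit_two_pow_mul_add _ hr, ← h1,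
    Nat.testBit_two_pow_mul_add _ (hr.trans (by rw [pow_succ]; omega)), Nat.testBit_two_pow]
  by_cases hij : i = j
  · subst hij
    simp [Nat.testBit_lt_two_pow hr]
  · by_cases hj : j < i + 1
    · have : j < i := by omega
      simp [hj, this, hij]
    · simp [hj, hij]

theorem encode_shift {i : ℕ} (hi : i < N) :
    (encode W N fun U => if i ∈ U then 0 else t U) <<< (W * 2 ^ i) =
      encode W N fun U => if i ∈ U then t (U.erase i) else 0 := by
  rw [Nat.shiftLeft_eq, encode, encode, Finset.sum_mul]
  have h1 : ∀ m, (i ∈ digitFinset N m) ↔ m.testBit i = true := fun m => by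
    rw [mem_digitFinset]
    exact and_iff_right hi
  have hl : ∀ m ∈ Finset.range (2 ^ N), (if i ∈ digitFinset N m then 0 else t (digitFinset N m)) *
      2 ^ (W * m) * 2 ^ (W * 2 ^ i) ≠ 0 → m.testBit i = false := by
    intro m _ h
    by_contra hm
    rw [if_pos (by rw [h1]; simpa using hm)] at h
    simp at h
  have hr : ∀ m ∈ Finset.range (2 ^ N), (if i ∈ digitFinset N m then
      t ((digitFinset N m).erase i) else 0) * 2 ^ (W * m) ≠ 0 → m.testBit i = true := by
    intro m _ h
    by_contra hm
    rw [if_neg (by rwa [h1])] at h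
    simp at h
  refine (Finset.sum_filter_of_ne hl).symm.trans (Eq.trans ?_ (Finset.sum_filter_of_ne hr))
  · have hlt : ∀ m < 2 ^ N, m ^^^ 2 ^ i < 2 ^ N := fun m hm =>
      Nat.xor_lt_two_pow hm (Nat.pow_lt_pow_right (by norm_num) hi)
    have hinv : ∀ m : ℕ, (m ^^^ 2 ^ i) ^^^ 2 ^ i = m := fun m => by
      rw [Nat.xor_assoc, Nat.xor_self, Nat.xor_zero]
    have hbit : ∀ m : ℕ, (m ^^^ 2 ^ i).testBit i = !m.testBit i := fun m => by
      rw [Nat.testBit_xor, Nat.testBit_two_pow_self, Bool.xor_true]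
    refine Finset.sum_nbij' (fun m => m ^^^ 2 ^ i) (fun m => m ^^^ 2 ^ i) ?_ ?_ ?_ ?_ ?_
    · intro m hm
      rw [Finset.mem_filter, Finset.mem_range] at hm ⊢
      exact ⟨hlt m hm.1, by rw [hbit, hm.2]; rfl⟩
    · intro m hm
      rw [Finset.mem_filter, Finset.mem_range] at hm ⊢
      exact ⟨hlt m hm.1, by rw [hbit, hm.2]; rfl⟩
    · exact fun m _ => hinv m
    · exact fun m _ => hinv m
    · intro m hm
      rw [Finset.mem_filter, Finset.mem_range] at hm
      have hb : (m ^^^ 2 ^ i).testBit i = true := by rw [hbit, hm.2]; rfl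
      have h2 : ¬ i ∈ digitFinset N m := by rw [h1, hm.2]; simp
      have h3 := digitFinset_xor (N := N) hb
      rw [hinv] at h3
      rw [if_neg h2, if_pos ((h1 _).mpr hb), ← h3, xor_two_pow_add hm.2, mul_add, pow_add, mul_assoc]

/-- A vertex, with the mask of the blocks whose index lacks it, and the width of the shift of the
blocks by which it is added to the index. -/
structure TableVertex where
  ix : ℕ
  mask : ℕ
  shift : ℕ

/-- The vertices `k - 1, …, 0`, for tables of `2 ^ n` blocks of width `W`. -/
def tableVertices (W n : ℕ) : ℕ → List TableVertex
  | 0 => []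
  | k+1 => ⟨k, lack W n k, Nat.mul W (Nat.pow 2 k)⟩ :: tableVertices W n k

/-- A vertex together with the set of the smaller vertices it is not adjacent to. -/
structure TableItem where
  vertex : TableVertex
  cand : ℕ

/-- Combines vertices with their sets of candidates. -/
def tableItems : List TableVertex → List ℕ → List TableItem
  | v :: vs, c :: cs => ⟨v, c⟩ :: tableItems vs cs
  | _, _ => []

/-- From the table `T` of `t`, the table of the function that sends `U` to the sum of
`2 ^ zs[|A|] * t (U \\ A)` over the stable sets `A ⊆ U` of candidates. -/
def blockSum : List TableItem → List ℕ → ℕ → ℕ → ℕ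
  | _, [], _, _ => 0
  | [], z :: _, T, _ => Nat.shiftLeft T z
  | i :: l, z :: zs, T, cand =>
    bif Nat.beq cand 0 then Nat.shiftLeft T z else
    bif bitOf cand i.vertex.ix then
      Nat.add (blockSum l (z :: zs) T (Nat.xor cand (Nat.pow 2 i.vertex.ix)))
        (blockSum l zs (Nat.shiftLeft (Nat.land T i.vertex.mask) i.vertex.shift)
          (Nat.land cand i.cand))
    else blockSum l (z :: zs) T cand

/-- The list `cs` holds, for the vertices `k - 1, …, 0`, the sets of the smaller vertices they are not
adjacent to. -/
def Candidates (G : SimpleGraph ℕ) : ℕ → List ℕ → Prop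
  | 0, [] => True
  | k+1, c :: cs => (∀ i, c.testBit i = true ↔ i < k ∧ ¬ G.Adj k i) ∧ Candidates G k cs
  | _, _ => False

/-- The value of the variable for sets of `j` elements, with the logarithms given in a list. -/
def listPower (zs : List ℕ) (j : ℕ) : ℕ := if h : j < zs.length then 2 ^ zs[j] else 0

theorem stableSubsets_empty {G : SimpleGraph ℕ} :
    stableSubsets G ∅ = {∅} := by
  ext A
  rw [mem_stableSubsets, Finset.mem_singleton, Finset.subset_empty]
  exact ⟨fun h => h.1, fun h => ⟨h, by simp [h, IsStable]⟩⟩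

theorem sum_stableSubsets_insert {G : SimpleGraph ℕ} {S S' : Finset ℕ} {i : ℕ} (hi : i ∉ S)
    (hS' : ∀ j, j ∈ S' ↔ j ∈ S ∧ ¬ G.Adj i j) (f : Finset ℕ → ℕ) :
    ∑ A ∈ stableSubsets G (insert i S), f A =
      ∑ A ∈ stableSubsets G S, f A + ∑ A ∈ stableSubsets G S', f (insert i A) := by
  classical
  rw [← Finset.sum_filter_add_sum_filter_not (stableSubsets G (insert i S)) fun A => i ∉ A]
  congr 1
  · refine Finset.sum_congr ?_ fun _ _ => rfl
    ext A
    rw [Finset.mem_filter, mem_stableSubsets, mem_stableSubsets]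
    constructor
    · exact fun ⟨⟨h1, h2⟩, h3⟩ => ⟨(Finset.subset_insert_iff_of_notMem h3).mp h1, h2⟩
    · exact fun ⟨h1, h2⟩ => ⟨⟨h1.trans (Finset.subset_insert _ _), h2⟩, fun h => hi (h1 h)⟩
  · refine Finset.sum_nbij' (fun A => A.erase i) (fun A => insert i A) ?_ ?_ ?_ ?_ ?_
    · intro A hA
      rw [Finset.mem_filter, mem_stableSubsets, not_not] at hA
      obtain ⟨⟨h1, h2⟩, h3⟩ := hA
      rw [mem_stableSubsets]
      refine ⟨fun j hj => ?_, h2.mono (Finset.erase_subset _ _)⟩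
      rw [Finset.mem_erase] at hj
      exact (hS' j).mpr ⟨(Finset.mem_insert.mp (h1 hj.2)).resolve_left hj.1, h2 i h3 j hj.2⟩
    · intro A hA
      rw [mem_stableSubsets] at hA
      obtain ⟨h1, h2⟩ := hA
      rw [Finset.mem_filter, mem_stableSubsets, not_not]
      refine ⟨⟨Finset.insert_subset_insert _ fun j hj => ((hS' j).mp (h1 hj)).1, ?_⟩,
        Finset.mem_insert_self _ _⟩
      intro a ha b hb hab
      rcases Finset.mem_insert.mp ha with ea | ha <;> rcases Finset.mem_insert.mp hb with eb | hb
      · exact hab.ne (ea.trans eb.symm)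
      · exact ((hS' b).mp (h1 hb)).2 (ea ▸ hab)
      · exact ((hS' a).mp (h1 ha)).2 (eb ▸ hab.symm)
      · exact h2 a ha b hb hab
    · intro A hA
      rw [Finset.mem_filter, not_not] at hA
      exact Finset.insert_erase hA.2
    · intro A hA
      rw [mem_stableSubsets] at hA
      exact Finset.erase_insert fun h => hi ((hS' i).mp (hA.1 h)).1
    · intro A hA
      rw [Finset.mem_filter, not_not] at hA
      rw [Finset.insert_erase hA.2]

theorem encode_blockSum {G : SimpleGraph ℕ} (hW : 0 < W) (k : ℕ) (hk : k ≤ N) : ∀ (cs zs : List ℕ)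
    (t : Finset ℕ → ℕ) (cand : ℕ), Candidates G k cs → (∀ U, t U < 2 ^ W) →
    (∀ i, cand.testBit i = true → i < k) →
    blockSum (tableItems (tableVertices W N k) cs) zs (encode W N t) cand =
      encode W N fun U => ∑ A ∈ stableSubsets G (digitFinset N cand),
        if A ⊆ U then listPower zs A.card * t (U \ A) else 0 := by
  -- without candidates, only the empty set contributes
  have base : ∀ (z : ℕ) (zs : List ℕ) (t : Finset ℕ → ℕ), encode W N t <<< z =
      encode W N fun U => ∑ A ∈ stableSubsets G (digitFinset N 0),
        if A ⊆ U then listPower (z :: zs) A.card * t (U \ A) else 0 := by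
    intro z zs t
    have h0 : digitFinset N 0 = ∅ := by simp [digitFinset]
    rw [encode_mul_two_pow, h0, stableSubsets_empty]
    refine encode_congr fun U _ => ?_
    simp [listPower]
  have hnil : ∀ (t : Finset ℕ → ℕ) (cand : ℕ), 0 = encode W N fun U =>
      ∑ A ∈ stableSubsets G (digitFinset N cand),
        if A ⊆ U then listPower [] A.card * t (U \ A) else 0 := by
    intro t cand
    symm
    rw [encode, Finset.sum_eq_zero]
    intro m _
    rw [Finset.sum_eq_zero, zero_mul]
    intro A _
    simp [listPower]
  induction k with
  | zero =>
    intro cs zs t cand _ ht hc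
    have hc0 : cand = 0 := Nat.eq_of_testBit_eq fun i => by
      rw [Nat.zero_testBit, Bool.eq_false_iff]
      exact fun h => absurd (hc i h) (by omega)
    subst hc0
    rcases zs with _ | ⟨z, zs⟩
    · simpa [tableVertices, tableItems, blockSum] using hnil t 0
    · simpa [tableVertices, tableItems, blockSum] using base z zs t
  | succ k ih =>
    intro cs zs t cand hcs ht hc
    rcases cs with _ | ⟨c, cs⟩
    · exact hcs.elim
    obtain ⟨hcb, hcs⟩ := hcs
    have ih := fun zs t cand => ih (by omega) cs zs t cand hcs
    rcases zs with _ | ⟨z, zs⟩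
    · simpa [tableVertices, tableItems, blockSum] using hnil t cand
    have e : blockSum (tableItems (tableVertices W N (k + 1)) (c :: cs)) (z :: zs) (encode W N t) cand =
        bif Nat.beq cand 0 then encode W N t <<< z else
        bif bitOf cand k then
          blockSum (tableItems (tableVertices W N k) cs) (z :: zs) (encode W N t) (cand ^^^ 2 ^ k) +
          blockSum (tableItems (tableVertices W N k) cs) zs
            ((encode W N t &&& lack W N k) <<< (W * 2 ^ k)) (cand &&& c)
        else blockSum (tableItems (tableVertices W N k) cs) (z :: zs) (encode W N t) cand := rfl
    rw [e]
    rcases hb : Nat.beq cand 0 with _ | _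
    · rw [cond_false, bitOf_eq]
      rcases hck : cand.testBit k with _ | _
      · rw [cond_false, ih (z :: zs) t cand ht]
        intro i hi
        have h1 := hc i hi
        have : i ≠ k := by rintro rfl; rw [hi] at hck; exact absurd hck (by simp)
        omega
      · have hx : ∀ i, (cand ^^^ 2 ^ k).testBit i = (cand.testBit i && decide (i ≠ k)) := fun i => by
          rw [Nat.testBit_xor, Nat.testBit_two_pow]
          by_cases h : k = i
          · subst h; simp [hck]
          · simp [h, Ne.symm h]
        have ht' : ∀ U : Finset ℕ, (if k ∈ U then t (U.erase k) else 0) < 2 ^ W := fun U => by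
          split_ifs
          · exact ht _
          · positivity
        rw [cond_true, encode_land_lack hW ht hk, encode_shift hk, ih (z :: zs) t _ ht, ih zs _ _ ht',
          encode_add]
        · refine encode_congr fun U _ => ?_
          have hins : digitFinset N cand = insert k (digitFinset N (cand ^^^ 2 ^ k)) := by
            ext j
            rw [Finset.mem_insert, mem_digitFinset, mem_digitFinset, hx]
            by_cases h : j = k
            · subst h; simp [hck]; omega
            · simp [h]
          have hnk : k ∉ digitFinset N (cand ^^^ 2 ^ k) := by
            rw [mem_digitFinset, hx]; simp
          rw [hins, sum_stableSubsets_insert hnk (S' := digitFinset N (cand &&& c))]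
          · congr 1
            refine Finset.sum_congr rfl fun A hA => ?_
            have hkA : k ∉ A := fun h => by
              have := (mem_digitFinset.mp ((mem_stableSubsets.mp hA).1 h)).2
              rw [Nat.testBit_land, Bool.and_eq_true, hcb] at this
              omega
            rw [Finset.card_insert_of_notMem hkA]
            have hl : listPower (z :: zs) (A.card + 1) = listPower zs A.card := by
              simp [listPower]
            rw [hl]
            by_cases hA : A ⊆ U
            · by_cases hkU : k ∈ U
              · rw [if_pos hA, if_pos (Finset.insert_subset hkU hA),
                  if_pos (Finset.mem_sdiff.mpr ⟨hkU, hkA⟩)]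
                congr 2
                ext j
                simp only [Finset.mem_erase, Finset.mem_sdiff, Finset.mem_insert]
                tauto
              · rw [if_pos hA, if_neg (fun h => hkU (Finset.mem_sdiff.mp h).1),
                  if_neg fun h => hkU (h (Finset.mem_insert_self _ _)), mul_zero]
            · rw [if_neg hA, if_neg fun h => hA ((Finset.subset_insert _ _).trans h)]
          · intro j
            rw [mem_digitFinset, mem_digitFinset, hx, Nat.testBit_land, Bool.and_eq_true,
              Bool.and_eq_true, hcb, decide_eq_true_eq]
            constructor
            · exact fun ⟨h1, h2, h3, h4⟩ => ⟨⟨h1, h2, by omega⟩, h4⟩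
            · exact fun ⟨⟨h1, h2, h3⟩, h4⟩ => ⟨h1, h2, by have := hc j h2; omega, h4⟩
        · intro i hi
          rw [Nat.testBit_land, Bool.and_eq_true, hcb] at hi
          exact hi.2.1
        · intro i hi
          rw [hx, Bool.and_eq_true, decide_eq_true_eq] at hi
          have := hc i hi.1
          omega
    · have hc0 := Nat.eq_of_beq_eq_true hb
      subst hc0
      exact base z zs t

end Tables

/-! ### Evaluating the polynomial of stable partitions -/

section Evaluate

open MvPolynomial

/-- The table of the values of the block polynomials of the subsets of the vertices in `vs`. -/
def table (zs : List ℕ) : List TableVertex → List ℕ → ℕ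
  | v :: vs, c :: cs =>
    let T := table zs vs cs
    Nat.add T (Nat.shiftLeft (blockSum (tableItems vs cs) zs T c) v.shift)
  | _, _ => 1

/-- From the table `T` of a function `t`, the sum of `2 ^ zs[|A|] * t Aᶜ` over the stable sets `A` of
candidates. The table is halved at every vertex, since only one of the halves matters. -/
def topSum : List TableItem → List ℕ → ℕ → ℕ → ℕ
  | _, [], _, _ => 0
  | [], z :: _, T, _ => Nat.shiftLeft T z
  | i :: l, z :: zs, T, cand =>
    let T' := Nat.shiftRight T i.vertex.shift
    bif bitOf cand i.vertex.ix then
      Nat.add (topSum l (z :: zs) T' (Nat.xor cand (Nat.pow 2 i.vertex.ix)))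
        (topSum l zs (Nat.land T (Nat.sub (Nat.pow 2 i.vertex.shift) 1)) (Nat.land cand i.cand))
    else topSum l (z :: zs) T' cand

/-- The value of the block polynomial of all vertices, where `vs` are the vertices other than the
largest one. -/
def topValue (zs : List ℕ) (vs : List TableVertex) : List ℕ → ℕ
  | c :: cs => topSum (tableItems vs cs) zs (table zs vs cs) c
  | _ => 1

variable {W N : ℕ} {G : SimpleGraph ℕ} {zs : List ℕ}

/-- The values of the variables of the block polynomials, with the logarithms given in a list. -/
def sizeValue (zs : List ℕ) (j : ℕ) : ℕ := listPower zs (j - 1)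

open Classical in
/-- The value of the block polynomial of a set of vertices below `k`, and `0` for other sets. -/
noncomputable def blockValue (zs : List ℕ) (G : SimpleGraph ℕ) (k : ℕ) (U : Finset ℕ) : ℕ :=
  if U ⊆ Finset.range k then eval (sizeValue zs) (blockPoly G k U) else 0

theorem sum_blockValue {k c : ℕ} (hk : k ≤ N) (hc : ∀ i, c.testBit i = true ↔ i < k ∧ ¬ G.Adj k i)
    (U : Finset ℕ) :
    (∑ A ∈ stableSubsets G (digitFinset N c),
      if A ⊆ U then listPower zs A.card * blockValue zs G k (U \ A) else 0) =
    if U ⊆ Finset.range k then blockValue zs G (k + 1) (insert k U) else 0 := by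
  classical
  have hA : ∀ A ∈ stableSubsets G (digitFinset N c), A ⊆ Finset.range k := fun A hA i hi =>
    Finset.mem_range.mpr ((hc i).mp (mem_digitFinset.mp ((mem_stableSubsets.mp hA).1 hi)).2).1
  split_ifs with hU
  · have hkU : k ∉ U := fun h => by simpa using hU h
    have hr : insert k U ⊆ Finset.range (k + 1) := Finset.insert_subset (by simp)
      (hU.trans (Finset.range_mono (Nat.le_succ k)))
    have hblocks : blocksBelow G k (insert k U) =
        (stableSubsets G (digitFinset N c)).filter fun A => A ⊆ U := by
      ext A
      rw [mem_blocksBelow, Finset.mem_filter, mem_stableSubsets]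
      constructor
      · rintro ⟨h1, h2⟩
        have h3 : A ⊆ U := fun i hi => by
          have := Finset.mem_inter.mp (h1 hi)
          rw [Finset.mem_insert, Finset.mem_range] at this
          exact this.1.resolve_left (by omega)
        refine ⟨⟨fun i hi => ?_, h2.mono (Finset.subset_insert _ _)⟩, h3⟩
        have h4 := Finset.mem_range.mp (hU (h3 hi))
        rw [mem_digitFinset, hc]
        exact ⟨by omega, h4, h2 k (Finset.mem_insert_self _ _) i (Finset.mem_insert_of_mem hi)⟩
      · rintro ⟨⟨h1, h2⟩, h3⟩
        refine ⟨fun i hi => Finset.mem_inter.mpr ⟨Finset.mem_insert_of_mem (h3 hi), hU (h3 hi)⟩, ?_⟩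
        have h4 : ∀ i ∈ A, ¬ G.Adj k i := fun i hi => ((hc i).mp (mem_digitFinset.mp (h1 hi)).2).2
        intro a ha b hb hab
        rcases Finset.mem_insert.mp ha with ea | ha <;> rcases Finset.mem_insert.mp hb with eb | hb
        · exact hab.ne (ea.trans eb.symm)
        · exact h4 b hb (ea ▸ hab)
        · exact h4 a ha (eb ▸ hab.symm)
        · exact h2 a ha b hb hab
    rw [blockValue, if_pos hr, blockPoly, if_pos (Finset.mem_insert_self _ _), map_sum, hblocks,
      Finset.sum_filter]
    refine Finset.sum_congr rfl fun A _ => ?_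
    split_ifs with h
    · rw [map_mul, eval_X, sizeValue, Nat.add_sub_cancel, blockValue,
        if_pos (Finset.sdiff_subset.trans hU)]
      congr 2
      refine blockPoly_congr G k _ _ ?_
      ext i
      simp only [Finset.mem_inter, Finset.mem_sdiff, Finset.mem_insert, Finset.mem_range]
      constructor
      · exact fun ⟨⟨h1, h2⟩, h3⟩ => ⟨⟨Or.inr h1, h2⟩, h3⟩
      · exact fun ⟨⟨h1, h2⟩, h3⟩ => ⟨⟨h1.resolve_left (by omega), h2⟩, h3⟩
    · rfl
  · refine Finset.sum_eq_zero fun A hA' => ?_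
    split_ifs
    · rw [blockValue, if_neg, mul_zero]
      intro h
      refine hU fun i hi => ?_
      by_cases hiA : i ∈ A
      · exact hA A hA' hiA
      · exact h (Finset.mem_sdiff.mpr ⟨hi, hiA⟩)
    · rfl

theorem blockValue_lt {κ : ℕ} (hz : ∀ j, sizeValue zs j ≤ (2 ^ κ) ^ j) {k : ℕ} (hk : k ≤ 11)
    (hW : W = 20 + k * κ) (U : Finset ℕ) : blockValue zs G k U < 2 ^ W := by
  rw [blockValue]
  split_ifs with hU
  · have h1 : U.card ≤ k := by simpa using Finset.card_le_card hU
    have h2 := bell_lt U.card (by omega)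
    calc _ ≤ Nat.bell U.card * (2 ^ κ) ^ U.card := eval_blockPoly_le G hz k U hU
      _ < 2 ^ 20 * (2 ^ κ) ^ U.card := Nat.mul_lt_mul_of_pos_right h2 (by positivity)
      _ ≤ 2 ^ 20 * (2 ^ κ) ^ k := Nat.mul_le_mul_left _ (Nat.pow_le_pow_right (by positivity) h1)
      _ = 2 ^ W := by rw [hW, ← pow_mul, pow_add, mul_comm k]
  · positivity

theorem digitFinset_eq_empty {m : ℕ} (hm : m < 2 ^ N) : digitFinset N m = ∅ ↔ m = 0 := by
  constructor
  · intro h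
    refine Nat.eq_of_testBit_eq fun i => ?_
    rw [Nat.zero_testBit, Bool.eq_false_iff]
    intro hi
    have h1 : i < N := by
      by_contra hN
      rw [Nat.testBit_lt_two_pow (hm.trans_le (Nat.pow_le_pow_right two_pos (not_lt.mp hN)))] at hi
      exact absurd hi (by simp)
    have : i ∈ digitFinset N m := mem_digitFinset.mpr ⟨h1, hi⟩
    rw [h] at this
    simp at this
  · rintro rfl
    simp [digitFinset]

theorem table_eq (hW : 0 < W) : ∀ (k : ℕ) (cs : List ℕ), k ≤ N → Candidates G k cs →
    (∀ j ≤ N, ∀ U, blockValue zs G j U < 2 ^ W) →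
    table zs (tableVertices W N k) cs = encode W N (blockValue zs G k) := by
  intro k
  induction k with
  | zero =>
    intro cs _ _ _
    have h1 : table zs (tableVertices W N 0) cs = 1 := by cases cs <;> rfl
    rw [h1, encode, Finset.sum_eq_single_of_mem 0 (Finset.mem_range.mpr (by positivity))]
    · simp [blockValue, digitFinset, blockPoly]
    · intro m hm h0
      rw [blockValue, if_neg, zero_mul]
      rw [Finset.range_zero, Finset.subset_empty, digitFinset_eq_empty (Finset.mem_range.mp hm)]
      exact h0
  | succ k ih =>
    intro cs hk hcs hb
    rcases cs with _ | ⟨c, cs⟩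
    · exact hcs.elim
    obtain ⟨hc, hcs⟩ := hcs
    have e : table zs (tableVertices W N (k + 1)) (c :: cs) = table zs (tableVertices W N k) cs +
        blockSum (tableItems (tableVertices W N k) cs) zs (table zs (tableVertices W N k) cs) c
          <<< (W * 2 ^ k) := rfl
    rw [e, ih cs (by omega) hcs hb, encode_blockSum hW k (by omega) cs zs _ c hcs (hb k (by omega))
      fun i hi => ((hc i).mp hi).1]
    simp_rw [sum_blockValue (zs := zs) (show k ≤ N by omega) hc]
    have e2 : (encode W N fun U => if U ⊆ Finset.range k then blockValue zs G (k + 1) (insert k U)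
        else 0) = encode W N fun U => if k ∈ U then 0 else
          if U ⊆ Finset.range k then blockValue zs G (k + 1) (insert k U) else 0 := by
      refine encode_congr fun U _ => ?_
      by_cases h : k ∈ U
      · rw [if_pos h, if_neg fun h' => by simpa using h' h]
      · rw [if_neg h]
    rw [e2, encode_shift hk, encode_add]
    refine encode_congr fun U _ => ?_
    by_cases h : k ∈ U
    · have h1 : ¬ U ⊆ Finset.range k := fun h' => by simpa using h' h
      rw [if_pos h, Finset.insert_erase h]
      nth_rewrite 1 [blockValue]
      rw [if_neg h1, zero_add]
      split_ifs with h2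
      · rfl
      · rw [blockValue, if_neg]
        refine fun h3 => h2 fun i hi => ?_
        rw [Finset.mem_erase] at hi
        have := Finset.mem_range.mp (h3 hi.2)
        exact Finset.mem_range.mpr (by omega)
    · rw [if_neg h, add_zero, blockValue, blockValue, blockPoly, if_neg h]
      congr 1
      rw [Finset.range_add_one, Finset.subset_insert_iff_of_notMem h]

theorem digitFinset_succ_of_lt {k m : ℕ} (hm : m < 2 ^ k) : digitFinset (k + 1) m = digitFinset k m := by
  ext i
  rw [mem_digitFinset, mem_digitFinset]
  refine ⟨fun ⟨h1, h2⟩ => ⟨?_, h2⟩, fun ⟨h1, h2⟩ => ⟨by omega, h2⟩⟩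
  by_contra hi
  have : i = k := by omega
  rw [this, Nat.testBit_lt_two_pow hm] at h2
  exact absurd h2 (by simp)

theorem digitFinset_two_pow_add {k m : ℕ} (hm : m < 2 ^ k) :
    digitFinset (k + 1) (2 ^ k + m) = insert k (digitFinset k m) := by
  ext i
  rw [Finset.mem_insert, mem_digitFinset, mem_digitFinset]
  rcases lt_trichotomy i k with h | rfl | h
  · rw [Nat.testBit_two_pow_add_gt h]
    constructor
    · exact fun ⟨_, h2⟩ => Or.inr ⟨h, h2⟩
    · exact fun h2 => ⟨by omega, (h2.resolve_left h.ne).2⟩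
  · rw [Nat.testBit_two_pow_add_eq, Nat.testBit_lt_two_pow hm]
    simp
  · constructor <;> intro h1 <;> omega

theorem encode_succ (W k : ℕ) (t : Finset ℕ → ℕ) : encode W (k + 1) t =
    2 ^ (W * 2 ^ k) * encode W k (fun U => t (insert k U)) + encode W k t := by
  have h2 : 2 ^ (k + 1) = 2 ^ k + 2 ^ k := by rw [pow_succ, mul_two]
  rw [encode, h2, Finset.sum_range_add, add_comm, encode, encode, Finset.mul_sum]
  congr 1
  · refine Finset.sum_congr rfl fun m hm => ?_
    rw [digitFinset_two_pow_add (Finset.mem_range.mp hm), mul_add, pow_add]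
    ring
  · exact Finset.sum_congr rfl fun m hm => by rw [digitFinset_succ_of_lt (Finset.mem_range.mp hm)]

theorem encode_lt {k : ℕ} {t : Finset ℕ → ℕ} (ht : ∀ U, t U < 2 ^ W) :
    encode W k t < 2 ^ (W * 2 ^ k) :=
  sum_blocks_lt (fun m => ht (digitFinset k m)) _

theorem topSum_eq (k : ℕ) : ∀ (cs zs : List ℕ) (t : Finset ℕ → ℕ) (cand : ℕ), k ≤ N →
    Candidates G k cs → (∀ U, t U < 2 ^ W) → (∀ i, cand.testBit i = true → i < k) →
    topSum (tableItems (tableVertices W N k) cs) zs (encode W k t) cand =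
      ∑ A ∈ stableSubsets G (digitFinset N cand), listPower zs A.card * t (Finset.range k \ A) := by
  have hnil : ∀ (f : Finset ℕ → ℕ) (s : Finset (Finset ℕ)),
      0 = ∑ A ∈ s, listPower [] A.card * f A := fun f s =>
    (Finset.sum_eq_zero fun A _ => by simp [listPower]).symm
  induction k with
  | zero =>
    intro cs zs t cand _ _ ht hc
    have hc0 : cand = 0 := Nat.eq_of_testBit_eq fun i => by
      rw [Nat.zero_testBit, Bool.eq_false_iff]
      exact fun h => absurd (hc i h) (by omega)
    subst hc0
    rcases zs with _ | ⟨z, zs⟩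
    · simpa [tableVertices, tableItems, topSum] using hnil _ _
    · have h0 : digitFinset N 0 = ∅ := by simp [digitFinset]
      have e : topSum (tableItems (tableVertices W N 0) cs) (z :: zs) (encode W 0 t) 0 =
        encode W 0 t <<< z := by cases cs <;> rfl
      rw [e, h0, stableSubsets_empty, Nat.shiftLeft_eq]
      simp [encode, digitFinset, listPower, mul_comm]
  | succ k ih =>
    intro cs zs t cand hk hcs ht hc
    rcases cs with _ | ⟨c, cs⟩
    · exact hcs.elim
    obtain ⟨hcb, hcs⟩ := hcs
    have ih := fun zs t cand => ih cs zs t cand (by omega) hcs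
    rcases zs with _ | ⟨z, zs⟩
    · simpa [tableVertices, tableItems, topSum] using hnil _ _
    have e : topSum (tableItems (tableVertices W N (k + 1)) (c :: cs)) (z :: zs) (encode W (k + 1) t)
        cand = bif bitOf cand k then
          topSum (tableItems (tableVertices W N k) cs) (z :: zs)
            (encode W (k + 1) t >>> (W * 2 ^ k)) (cand ^^^ 2 ^ k) +
          topSum (tableItems (tableVertices W N k) cs) zs
            (encode W (k + 1) t &&& (2 ^ (W * 2 ^ k) - 1)) (cand &&& c)
        else topSum (tableItems (tableVertices W N k) cs) (z :: zs)
          (encode W (k + 1) t >>> (W * 2 ^ k)) cand := rfl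
    have hhi : encode W (k + 1) t >>> (W * 2 ^ k) = encode W k fun U => t (insert k U) := by
      rw [encode_succ, Nat.shiftRight_eq_div_pow, Nat.mul_add_div (by positivity),
        Nat.div_eq_of_lt (encode_lt ht), add_zero]
    have hlo : encode W (k + 1) t &&& (2 ^ (W * 2 ^ k) - 1) = encode W k t := by
      rw [encode_succ, Nat.and_two_pow_sub_one_eq_mod, Nat.mul_add_mod, Nat.mod_eq_of_lt (encode_lt ht)]
    have hrange : ∀ A : Finset ℕ, k ∉ A →
        insert k (Finset.range k \ A) = Finset.range (k + 1) \ A := fun A hA => by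
      rw [Finset.range_add_one, Finset.insert_sdiff_of_notMem _ hA]
    rw [e, hhi, hlo, bitOf_eq]
    rcases hck : cand.testBit k with _ | _
    · have hc' : ∀ i, cand.testBit i = true → i < k := fun i hi => by
        have h1 := hc i hi
        have : i ≠ k := by rintro rfl; rw [hi] at hck; exact absurd hck (by simp)
        omega
      rw [cond_false, ih (z :: zs) _ cand (fun U => ht _) hc']
      refine Finset.sum_congr rfl fun A hA => ?_
      rw [hrange A fun h => ?_]
      have := hc' k (mem_digitFinset.mp ((mem_stableSubsets.mp hA).1 h)).2
      omega
    · have hx : ∀ i, (cand ^^^ 2 ^ k).testBit i = (cand.testBit i && decide (i ≠ k)) := fun i => by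
        rw [Nat.testBit_xor, Nat.testBit_two_pow]
        by_cases h : k = i
        · subst h; simp [hck]
        · simp [h, Ne.symm h]
      have hins : digitFinset N cand = insert k (digitFinset N (cand ^^^ 2 ^ k)) := by
        ext j
        rw [Finset.mem_insert, mem_digitFinset, mem_digitFinset, hx]
        by_cases h : j = k
        · subst h; simp [hck]; omega
        · simp [h]
      have hnk : k ∉ digitFinset N (cand ^^^ 2 ^ k) := by
        rw [mem_digitFinset, hx]; simp
      rw [cond_true, ih (z :: zs) _ _ (fun U => ht _), ih zs t _ ht, hins,
        sum_stableSubsets_insert hnk (S' := digitFinset N (cand &&& c))]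
      · congr 1
        · refine Finset.sum_congr rfl fun A hA => ?_
          rw [hrange A fun h => hnk ((mem_stableSubsets.mp hA).1 h)]
        · refine Finset.sum_congr rfl fun A hA => ?_
          have hkA : k ∉ A := fun h => by
            have := (mem_digitFinset.mp ((mem_stableSubsets.mp hA).1 h)).2
            rw [Nat.testBit_land, Bool.and_eq_true, hcb] at this
            omega
          have hl : listPower (z :: zs) (A.card + 1) = listPower zs A.card := by simp [listPower]
          rw [Finset.card_insert_of_notMem hkA, hl]
          congr 2
          ext j
          simp only [Finset.mem_sdiff, Finset.mem_range, Finset.mem_insert]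
          constructor
          · exact fun ⟨h1, h2⟩ => ⟨by omega, fun h => h.elim (by omega) h2⟩
          · rintro ⟨h1, h2⟩
            rw [not_or] at h2
            exact ⟨by omega, h2.2⟩
      · intro j
        rw [mem_digitFinset, mem_digitFinset, hx, Nat.testBit_land, Bool.and_eq_true,
          Bool.and_eq_true, hcb, decide_eq_true_eq]
        constructor
        · exact fun ⟨h1, h2, h3, h4⟩ => ⟨⟨h1, h2, by omega⟩, h4⟩
        · exact fun ⟨⟨h1, h2, h3⟩, h4⟩ => ⟨h1, h2, by have := hc j h2; omega, h4⟩
      · intro i hi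
        rw [Nat.testBit_land, Bool.and_eq_true, hcb] at hi
        exact hi.2.1
      · intro i hi
        rw [hx, Bool.and_eq_true, decide_eq_true_eq] at hi
        have := hc i hi.1
        omega

theorem topValue_eq (hW : 0 < W) {cs : List ℕ} (hcs : Candidates G (N + 1) cs)
    (hb : ∀ j ≤ N + 1, ∀ U, blockValue zs G j U < 2 ^ W) :
    topValue zs (tableVertices W N N) cs =
      eval (sizeValue zs) (blockPoly G (N + 1) (Finset.range (N + 1))) := by
  rcases cs with _ | ⟨c, cs⟩
  · exact hcs.elim
  obtain ⟨hc, hcs⟩ := hcs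
  have e : topValue zs (tableVertices W N N) (c :: cs) =
      topSum (tableItems (tableVertices W N N) cs) zs (table zs (tableVertices W N N) cs) c := rfl
  have h1 : ∀ i, c.testBit i = true → i < N := fun i hi => ((hc i).mp hi).1
  have h2 := sum_blockValue (zs := zs) le_rfl hc (Finset.range N)
  rw [if_pos subset_rfl, ← Finset.range_add_one, blockValue, if_pos subset_rfl] at h2
  rw [e, table_eq hW N cs le_rfl hcs fun j hj => hb j (by omega),
    topSum_eq N cs zs _ c le_rfl hcs (hb N (by omega)) h1, ← h2]
  refine Finset.sum_congr rfl fun A hA => (if_pos fun i hi => ?_).symm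
  exact Finset.mem_range.mpr (h1 i (mem_digitFinset.mp ((mem_stableSubsets.mp hA).1 hi)).2)

end Evaluate

/-! ### Stability numbers -/

section Check

/-- Whether there is a stable set of `k` candidates. -/
def hasStable : List TableItem → ℕ → ℕ → Bool
  | _, 0, _ => true
  | [], _, _ => false
  | i :: l, k+1, cand =>
    bif Nat.beq cand 0 then false else
    bif bitOf cand i.vertex.ix then
      (bif hasStable l k (Nat.land cand i.cand) then true
        else hasStable l (k+1) (Nat.xor cand (Nat.pow 2 i.vertex.ix)))
    else hasStable l (k+1) cand

/-- Whether there is a stable set of `k + 1` vertices. -/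
def hasStableAbove (k : ℕ) : List TableVertex → List ℕ → Bool
  | _ :: vs, c :: cs => bif hasStable (tableItems vs cs) k c then true else hasStableAbove k vs cs
  | _, _ => false

variable {W N : ℕ} {G : SimpleGraph ℕ}

theorem card_lt_of_hasStable : ∀ (k : ℕ), k ≤ N → ∀ (cs : List ℕ) (a cand : ℕ), Candidates G k cs →
    (∀ i, cand.testBit i = true → i < k) →
    hasStable (tableItems (tableVertices W N k) cs) a cand = false →
    ∀ A : Finset ℕ, (∀ i ∈ A, cand.testBit i = true) → IsStable G A → A.card < a := by
  intro k
  induction k with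
  | zero =>
    intro _ cs a cand _ hc h A hA _
    have hA0 : A = ∅ := Finset.eq_empty_of_forall_notMem fun i hi => absurd (hc i (hA i hi)) (by omega)
    rcases a with _ | a
    · simp [tableVertices, tableItems, hasStable] at h
    · simp [hA0]
  | succ k ih =>
    intro hk cs a cand hcs hc h A hA hst
    rcases a with _ | a
    · simp [hasStable] at h
    rcases cs with _ | ⟨c, cs⟩
    · exact hcs.elim
    obtain ⟨hcb, hcs⟩ := hcs
    have e : hasStable (tableItems (tableVertices W N (k + 1)) (c :: cs)) (a + 1) cand =
      bif Nat.beq cand 0 then false else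
      bif bitOf cand k then
        (bif hasStable (tableItems (tableVertices W N k) cs) a (cand &&& c) then true
          else hasStable (tableItems (tableVertices W N k) cs) (a + 1) (cand ^^^ 2 ^ k))
      else hasStable (tableItems (tableVertices W N k) cs) (a + 1) cand := rfl
    rw [e] at h
    have ih := ih (by omega) cs
    rcases hb : Nat.beq cand 0 with _ | _
    · rw [hb, cond_false, bitOf_eq] at h
      rcases hck : cand.testBit k with _ | _
      · rw [hck, cond_false] at h
        refine ih (a + 1) cand hcs (fun i hi => ?_) h A hA hst
        have h1 := hc i hi
        have : i ≠ k := by rintro rfl; rw [hi] at hck; exact absurd hck (by simp)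
        omega
      · rw [hck, cond_true] at h
        rcases h1 : hasStable (tableItems (tableVertices W N k) cs) a (cand &&& c) with _ | _
        · rw [h1, cond_false] at h
          have hx : ∀ i, (cand ^^^ 2 ^ k).testBit i = (cand.testBit i && decide (i ≠ k)) := fun i => by
            rw [Nat.testBit_xor, Nat.testBit_two_pow]
            by_cases h : k = i
            · subst h; simp [hck]
            · simp [h, Ne.symm h]
          by_cases hkA : k ∈ A
          · have h2 := ih a (cand &&& c) hcs (fun i hi => by
              rw [Nat.testBit_land, Bool.and_eq_true, hcb] at hi
              exact hi.2.1) h1 (A.erase k) (fun i hi => by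
              rw [Finset.mem_erase] at hi
              rw [Nat.testBit_land, Bool.and_eq_true, hcb]
              have := hc i (hA i hi.2)
              exact ⟨hA i hi.2, by omega, hst k hkA i hi.2⟩) (hst.mono (Finset.erase_subset _ _))
            have := Finset.card_erase_add_one hkA
            omega
          · refine ih (a + 1) _ hcs (fun i hi => ?_) h A (fun i hi => ?_) hst
            · rw [hx, Bool.and_eq_true, decide_eq_true_eq] at hi
              have := hc i hi.1
              omega
            · rw [hx, Bool.and_eq_true, decide_eq_true_eq]
              exact ⟨hA i hi, fun h => hkA (h ▸ hi)⟩
        · rw [h1, cond_true] at h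
          exact absurd h (by simp)
    · have hc0 := Nat.eq_of_beq_eq_true hb
      subst hc0
      have hA0 : A = ∅ := Finset.eq_empty_of_forall_notMem fun i hi => by simpa using hA i hi
      simp [hA0]

theorem card_le_of_hasStableAbove {a : ℕ} : ∀ (k : ℕ), k ≤ N → ∀ (v : TableVertex) (cs : List ℕ),
    Candidates G (k + 1) cs → hasStableAbove a (v :: tableVertices W N k) cs = false →
    ∀ A ⊆ Finset.range (k + 1), IsStable G A → A.card ≤ a := by
  intro k
  induction k with
  | zero =>
    intro _ v cs hcs h A hA hst
    rcases cs with _ | ⟨c, cs⟩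
    · exact hcs.elim
    rcases a with _ | a
    · simp [hasStableAbove, hasStable] at h
    · have := Finset.card_le_card hA
      simp at this
      omega
  | succ k ih =>
    intro hk v cs hcs h A hA hst
    rcases cs with _ | ⟨c, cs⟩
    · exact hcs.elim
    obtain ⟨hcb, hcs⟩ := hcs
    have e : hasStableAbove a (v :: tableVertices W N (k + 1)) (c :: cs) =
      bif hasStable (tableItems (tableVertices W N (k + 1)) cs) a c then true
      else hasStableAbove a (⟨k, lack W N k, Nat.mul W (Nat.pow 2 k)⟩ :: tableVertices W N k) cs := rfl
    rw [e] at h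
    rcases h1 : hasStable (tableItems (tableVertices W N (k + 1)) cs) a c with _ | _
    · rw [h1, cond_false] at h
      by_cases hkA : k + 1 ∈ A
      · have h2 := card_lt_of_hasStable (k + 1) hk cs a c hcs (fun i hi => ((hcb i).mp hi).1) h1
          (A.erase (k + 1)) (fun i hi => by
            rw [Finset.mem_erase] at hi
            have := Finset.mem_range.mp (hA hi.2)
            exact (hcb i).mpr ⟨by omega, hst _ hkA i hi.2⟩) (hst.mono (Finset.erase_subset _ _))
        have := Finset.card_erase_add_one hkA
        omega
      · refine ih (by omega) _ cs hcs h A (fun i hi => ?_) hst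
        have := Finset.mem_range.mp (hA hi)
        have : i ≠ k + 1 := fun h => hkA (h ▸ hi)
        exact Finset.mem_range.mpr (by omega)
    · rw [h1, cond_true] at h
      exact absurd h (by simp)

/-- The sets of smaller non-neighbours of the vertices `k - 1, …, 0` of the graph with the code `R`. -/
def candidatesOf (R : ℕ) : ℕ → List ℕ
  | 0 => []
  | k+1 => Nat.mod (Nat.xor (Nat.sub (Nat.pow 2 k) 1)
      (Nat.mod (Nat.shiftRight R (Nat.mul 32 k)) (Nat.pow 2 k))) (Nat.pow 2 k) :: candidatesOf R k

theorem Codes.candidates {n R : ℕ} (h : Codes n R G) : ∀ k ≤ n, Candidates G k (candidatesOf R k) := by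
  intro k
  induction k with
  | zero => exact fun _ => trivial
  | succ k ih =>
    intro hk
    refine ⟨fun i => ?_, ih (by omega)⟩
    have e : Nat.mod (Nat.xor (Nat.sub (Nat.pow 2 k) 1) (Nat.mod (Nat.shiftRight R (Nat.mul 32 k))
        (Nat.pow 2 k))) (Nat.pow 2 k) = ((2 ^ k - 1) ^^^ ((R >>> (32 * k)) % 2 ^ k)) % 2 ^ k := rfl
    rw [e, Nat.testBit_mod_two_pow, Nat.testBit_xor, Nat.testBit_two_pow_sub_one,
      Nat.testBit_mod_two_pow, Nat.testBit_shiftRight]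
    by_cases hi : i < k
    · have := h.le
      have h1 := h.adj k i (by omega)
      cases hb : R.testBit (32 * k + i) <;> simp_all
    · simp [hi]

/-- The list `cs`, extended by `k` vertices that are adjacent to each other but not to the `m` vertices
of `cs`. -/
def addClique (m : ℕ) (cs : List ℕ) : ℕ → List ℕ
  | 0 => cs
  | k+1 => Nat.sub (Nat.pow 2 m) 1 :: addClique m cs k

/-- The sets of smaller non-neighbours in a disjoint union of cliques. -/
def cliqueCandidates : List ℕ → List ℕ
  | [] => []
  | a :: l =>
    let cs := cliqueCandidates l
    addClique cs.length cs a

theorem Candidates.length_eq : ∀ (k : ℕ) (cs : List ℕ), Candidates G k cs → cs.length = k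
  | 0, [], _ => rfl
  | 0, _ :: _, h => h.elim
  | _+1, [], h => h.elim
  | k+1, _ :: cs, h => by rw [List.length_cons, Candidates.length_eq k cs h.2]

theorem Candidates.congr {G G' : SimpleGraph ℕ} : ∀ (k : ℕ) (cs : List ℕ),
    (∀ i < k, ∀ j, j < i → (G.Adj i j ↔ G'.Adj i j)) → Candidates G k cs → Candidates G' k cs
  | 0, [], _, _ => trivial
  | 0, _ :: _, _, h => h.elim
  | _+1, [], _, h => h.elim
  | k+1, c :: cs, hG, h => by
    refine ⟨fun i => (h.1 i).trans ?_, Candidates.congr k cs (fun i hi => hG i (by omega)) h.2⟩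
    exact and_congr_right fun hi => not_congr (hG k (by omega) i hi)

theorem candidates_cliqueUnion (l : List ℕ) :
    Candidates (cliqueUnion l) l.sum (cliqueCandidates l) := by
  induction l with
  | nil => trivial
  | cons a l ih =>
    have hlen := Candidates.length_eq _ _ ih
    have h0 : Candidates (cliqueUnion (a :: l)) l.sum (cliqueCandidates l) := by
      refine Candidates.congr _ _ (fun i hi j hj => ?_) ih
      constructor
      · exact fun h => Or.inl h
      · exact fun h => h.resolve_right fun h => by omega
    have h1 : ∀ k ≤ a, Candidates (cliqueUnion (a :: l)) (l.sum + k)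
        (addClique l.sum (cliqueCandidates l) k) := by
      intro k
      induction k with
      | zero => exact fun _ => h0
      | succ k ihk =>
        intro hk
        refine ⟨fun i => ?_, ihk (by omega)⟩
        change (2 ^ l.sum - 1).testBit i = true ↔ i < l.sum + k ∧ ¬ (cliqueUnion (a :: l)).Adj (l.sum + k) i
        rw [Nat.testBit_two_pow_sub_one, decide_eq_true_eq]
        constructor
        · refine fun hi => ⟨by omega, fun h => ?_⟩
          rcases h with h | h
          · have := cliqueUnion_lt l _ _ h
            omega
          · omega
        · rintro ⟨hi, h⟩
          by_contra hil
          exact h (Or.inr ⟨by omega, ⟨by omega, by omega⟩, by omega, by omega⟩)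
    have h2 := h1 a le_rfl
    rw [List.sum_cons, add_comm]
    have e : cliqueCandidates (a :: l) =
      addClique (cliqueCandidates l).length (cliqueCandidates l) a := rfl
    rwa [e, hlen]

end Check

/-! ### Certifying positivity -/

section Positivity

open MvPolynomial

/-- The weakly decreasing lists of `a` numbers with sum `m`, each increased by `b`; the first argument
is `a`, the last argument is `b`. -/
def sizeLists : ℕ → ℕ → ℕ → List (List ℕ)
  | 0, m, _ => bif Nat.beq m 0 then [[]] else []
  | 1, m, b => [[Nat.add b m]]
  | a+1, m, b => (List.range (Nat.succ (Nat.div m (a+1)))).reverse.flatMap fun c =>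
      (sizeLists a (Nat.sub m (Nat.mul c (a+1))) (Nat.add b c)).map fun l => Nat.add b c :: l

def fact : ℕ → ℕ
  | 0 => 1
  | k+1 => Nat.mul (k+1) (fact k)

def factProd : List ℕ → ℕ
  | [] => 1
  | a :: l => Nat.mul (fact a) (factProd l)

/-- The data that depend only on the number of vertices and on the stability number: the logarithms of
the values of the variables, the vertices other than the largest one, and for each disjoint union of
cliques the value of its block polynomial, multiplied by its `multiplier`, and this factor. -/
structure Basis where
  logs : List ℕ
  vertices : List TableVertex
  elements : List (ℕ × ℕ)

/-- The quotient of `n!` by the product of the factorials of the members of `l`, which is the factor by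
which `n! • e_l` exceeds the chromatic symmetric function of the disjoint union of cliques. -/
def multiplier (n : ℕ) (l : List ℕ) : ℕ := Nat.div (fact n) (factProd l)

/-- Weights of the block sizes `1, …, a` that tell the types of the partitions of at most eleven
elements into blocks of at most `a` elements apart. They are convex, so that the weight of a type
increases when an element is moved from a block to a block that is not smaller. -/
def sizeWeights : ℕ → List ℕ
  | 3 => [0, 1, 6]
  | 4 => [0, 1, 7, 17]
  | 5 => [0, 1, 9, 21, 35]
  | _ => [0, 1, 6, 20, 36, 53]

/-- The logarithms of the values of the variables. -/
def logValues (a : ℕ) : List ℕ := (sizeWeights a).map fun w => Nat.mul 48 w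

/-- The sizes of the disjoint unions of cliques with `n` vertices and no stable set of more than `a`
vertices. -/
def cliqueSizes (n a : ℕ) (vs : List TableVertex) : List (List ℕ) :=
  (sizeLists a n 0).filter fun l => Nat.beq l.sum n &&
    Bool.not (hasStableAbove a (⟨0, 0, 0⟩ :: vs) (cliqueCandidates l))

/-- Inserts an element into a list that is sorted by decreasing keys. -/
def insertByKey (key : List ℕ → ℕ) (l : List ℕ) : List (List ℕ) → List (List ℕ)
  | [] => [l]
  | l' :: ls => bif Nat.ble (key l') (key l) then l :: l' :: ls else l' :: insertByKey key l ls

def sortByKey (key : List ℕ → ℕ) : List (List ℕ) → List (List ℕ)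
  | [] => []
  | l :: ls => insertByKey key l (sortByKey key ls)

theorem mem_insertByKey {key : List ℕ → ℕ} {l l' : List ℕ} {ls : List (List ℕ)}
    (h : l' ∈ insertByKey key l ls) : l' = l ∨ l' ∈ ls := by
  induction ls with
  | nil => exact Or.inl (by simpa [insertByKey] using h)
  | cons l₀ ls ih =>
    rw [insertByKey] at h
    rcases hb : Nat.ble (key l₀) (key l) with _ | _ <;> rw [hb] at h
    · rcases List.mem_cons.mp h with h | h
      · exact Or.inr (h ▸ List.mem_cons_self)
      · exact (ih h).imp_right (List.mem_cons_of_mem _)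
    · exact List.mem_cons.mp h

theorem mem_of_mem_sortByKey {key : List ℕ → ℕ} {l : List ℕ} {ls : List (List ℕ)}
    (h : l ∈ sortByKey key ls) : l ∈ ls := by
  induction ls with
  | nil => exact h
  | cons l₀ ls ih =>
    rcases mem_insertByKey h with rfl | h
    · exact List.mem_cons_self
    · exact List.mem_cons_of_mem _ (ih h)

/-- The data for `n` vertices and stability number at most `a`.
The disjoint unions of cliques are sorted by decreasing value, which is the order in which the greedy
algorithm tries them. The blocks of the tables have `20 + n * κ` digits, enough for at most `2 ^ 20`
partitions and values of at most `(2 ^ κ) ^ j` at the size `j`. -/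
def mkBasis (n a κ : ℕ) : Basis :=
  let W := Nat.add 20 (Nat.mul n κ)
  let zs := logValues a
  let vs := tableVertices W (Nat.pred n) (Nat.pred n)
  let key := fun l => topValue zs vs (cliqueCandidates l)
  ⟨zs, vs, (sortByKey key (cliqueSizes n a vs)).map fun l =>
    (Nat.mul (multiplier n l) (topValue zs vs (cliqueCandidates l)), multiplier n l)⟩

/-- Whether the greedy algorithm writes `v` as a combination of the first components of the list, such
that the same combination of the second components is at most `s`. The bound limits the coefficients of
the combination of polynomials, so that it can be recovered from its value. -/
def greedy : List (ℕ × ℕ) → ℕ → ℕ → Bool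
  | [], v, _ => Nat.beq v 0
  | p :: l, v, s =>
    let d := Nat.mul p.2 (Nat.div v p.1)
    bif Nat.ble d s then greedy l (Nat.mod v p.1) (Nat.sub s d) else false

/-- Whether `n!` times the value of the block polynomial of the graph with the candidates `cs` is found to
be a combination of the values for disjoint unions of cliques. -/
def checkWith (n : ℕ) (B : Basis) (cs : List ℕ) : Bool :=
  greedy B.elements (Nat.mul (fact n) (topValue B.logs B.vertices cs)) (fact n)

/-- Whether the chromatic symmetric function of the graph with the code `R` is found to be
`e`-positive. -/
def checkCode (n : ℕ) (B₃ B₄ B₅ B₆ : Basis) (R : ℕ) : Bool :=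
  let cs := candidatesOf R n
  let v : TableVertex := ⟨0, 0, 0⟩
  bif hasStableAbove 3 (v :: B₃.vertices) cs then
    bif hasStableAbove 4 (v :: B₃.vertices) cs then
      bif hasStableAbove 5 (v :: B₃.vertices) cs then
        bif hasStableAbove 6 (v :: B₃.vertices) cs then false else checkWith n B₆ cs
      else checkWith n B₅ cs
    else checkWith n B₄ cs
  else checkWith n B₃ cs

/-- Whether all graphs with codes in `L` are found to be `e`-positive. -/
def checkCodes (n : ℕ) (L : List ℕ) : Bool :=
  let B₃ := mkBasis n 3 96
  let B₄ := mkBasis n 4 204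
  let B₅ := mkBasis n 5 336
  let B₆ := mkBasis n 6 424
  L.all (checkCode n B₃ B₄ B₅ B₆)

theorem fact_eq (n : ℕ) : fact n = n.factorial := by
  induction n with
  | zero => rfl
  | succ n ih =>
    rw [Nat.factorial_succ, ← ih]
    rfl

theorem exists_of_greedy (t f : List ℕ → ℕ) : ∀ (ls : List (List ℕ)) (v s : ℕ),
    greedy (ls.map fun l => (Nat.mul (f l) (t l), f l)) v s = true →
    ∃ L : List (ℕ × List ℕ), (∀ p ∈ L, p.2 ∈ ls) ∧ (L.map fun p => p.1 * t p.2).sum = v ∧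
      (L.map fun p => p.1).sum ≤ s
  | [], v, s, h => ⟨[], by simp, (Nat.eq_of_beq_eq_true h).symm, Nat.zero_le _⟩
  | l :: ls, v, s, h => by
    set q := v / (f l * t l) with hq
    have e : greedy ((l :: ls).map fun l => (Nat.mul (f l) (t l), f l)) v s =
      bif Nat.ble (f l * q) s then greedy (ls.map fun l => (Nat.mul (f l) (t l), f l))
        (v % (f l * t l)) (s - f l * q) else false := rfl
    rw [e] at h
    rcases hb : Nat.ble (f l * q) s with _ | _
    · rw [hb, cond_false] at h
      exact absurd h (by simp)
    · rw [hb, cond_true] at h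
      obtain ⟨L, h1, h2, h3⟩ := exists_of_greedy t f ls _ _ h
      refine ⟨(f l * q, l) :: L, ?_, ?_, ?_⟩
      · intro p hp
        rcases List.mem_cons.mp hp with rfl | hp
        · exact List.mem_cons_self
        · exact List.mem_cons_of_mem _ (h1 p hp)
      · rw [List.map_cons, List.sum_cons, h2]
        have := Nat.div_add_mod v (f l * t l)
        rw [← hq] at this
        dsimp only
        rw [← this, Nat.mul_add_mod, Nat.mod_mod]
        ring
      · rw [List.map_cons, List.sum_cons]
        have := Nat.le_of_ble_eq_true hb
        dsimp only
        omega

variable {n : ℕ} {G : SimpleGraph ℕ}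

/-- The choice `a` of weights, with `κ` as a bound for the logarithms, is suitable for `n` vertices. -/
structure Suitable (n a κ : ℕ) : Prop where
  length : (sizeWeights a).length = a
  zero : (sizeWeights a).getD 0 1 = 0
  bound : ∀ j ≤ a, 48 * (sizeWeights a).getD (j - 1) 0 ≤ κ * j
  nodup : ((partTypes a n).map (typeWeight (sizeWeights a))).Nodup

theorem sizeValue_eq {a j : ℕ} (hlen : (sizeWeights a).length = a) (hj : j - 1 < a) :
    sizeValue (logValues a) j = (2 ^ 48) ^ (sizeWeights a).getD (j - 1) 0 := by
  have h1 : j - 1 < (logValues a).length := by rwa [logValues, List.length_map, hlen]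
  rw [sizeValue, listPower, dif_pos h1, ← pow_mul, List.getD_eq_getElem _ _ (by omega)]
  congr 1
  exact List.getElem_map _

theorem Suitable.sizeValue_le {a κ : ℕ} (h : Suitable n a κ) (j : ℕ) :
    sizeValue (logValues a) j ≤ (2 ^ κ) ^ j := by
  by_cases hj : j - 1 < a
  · rw [sizeValue_eq h.length hj, ← pow_mul, ← pow_mul]
    refine Nat.pow_le_pow_right two_pos ?_
    rcases Nat.eq_zero_or_pos j with rfl | hj0
    · have h1 := h.zero
      rw [List.getD_eq_getElem _ _ (by rw [h.length]; omega)] at h1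
      rw [List.getD_eq_getElem _ _ (by rw [h.length]; omega)]
      simp [h1]
    · exact h.bound j (by omega)
  · rw [sizeValue, listPower, dif_neg (by rw [logValues, List.length_map, h.length]; omega)]
    exact Nat.zero_le _

theorem isEPositive_of_checkWith {a κ : ℕ} (hn : 0 < n) (hn11 : n ≤ 11) (ha : Suitable n a κ)
    {cs : List ℕ} (hcs : Candidates G n cs)
    (hG : ∀ A ⊆ Finset.range n, IsStable G A → A.card ≤ a)
    (h : checkWith n (mkBasis n a κ) cs = true) : IsEPositive (onFin n G) := by
  obtain ⟨N, rfl⟩ := Nat.exists_eq_succ_of_ne_zero hn.ne'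
  have hz := ha.sizeValue_le
  set zs := logValues a with hzs
  set W := 20 + (N + 1) * κ with hW
  set vs := tableVertices W N N with hvs
  have hW0 : 0 < W := by omega
  have hlt : ∀ G : SimpleGraph ℕ, ∀ j ≤ N + 1, ∀ U, blockValue zs G j U < 2 ^ W := fun G j hj U =>
    (blockValue_lt hz (by omega) rfl U).trans_le
      (Nat.pow_le_pow_right two_pos (by rw [hW]; gcongr))
  have htop : ∀ (G : SimpleGraph ℕ) (cs : List ℕ), Candidates G (N + 1) cs →
      topValue zs vs cs = eval (sizeValue zs) (blockPoly G (N + 1) (Finset.range (N + 1))) :=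
    fun G cs hcs => topValue_eq hW0 hcs (hlt G)
  have e : checkWith (N + 1) (mkBasis (N + 1) a κ) cs =
      greedy ((sortByKey (fun l => topValue zs vs (cliqueCandidates l)) (cliqueSizes (N + 1) a vs)).map fun l => (Nat.mul (multiplier (N + 1) l)
        (topValue zs vs (cliqueCandidates l)), multiplier (N + 1) l))
        (fact (N + 1) * topValue zs vs cs) (fact (N + 1)) := rfl
  rw [e] at h
  obtain ⟨L, hL, hv, hs⟩ := exists_of_greedy _ _ _ _ _ h
  have hL : ∀ p ∈ L, p.2.sum = N + 1 ∧ ∀ A ⊆ Finset.range (N + 1), IsStable (cliqueUnion p.2) A →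
      A.card ≤ a := by
    intro p hp
    have h1 := mem_of_mem_sortByKey (hL p hp)
    rw [cliqueSizes, List.mem_filter, Bool.and_eq_true] at h1
    have h2 : p.2.sum = N + 1 := Nat.eq_of_beq_eq_true h1.2.1
    refine ⟨h2, card_le_of_hasStableAbove N le_rfl _ _ ?_ (by simpa using h1.2.2)⟩
    have := candidates_cliqueUnion p.2
    rwa [h2] at this
  rw [fact_eq] at hv hs
  refine isEPositive_of_blockPoly (Nat.factorial_ne_zero (N + 1)) L (fun p hp => (hL p hp).1) ?_
  have hsum : ∀ {M : Type} [AddCommMonoid M] (φ : MvPolynomial ℕ ℕ →+ M) (L : List (ℕ × List ℕ)),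
      φ (L.map fun p => p.1 • blockPoly (cliqueUnion p.2) (N + 1) (Finset.range (N + 1))).sum =
      (L.map fun p => p.1 • φ (blockPoly (cliqueUnion p.2) (N + 1) (Finset.range (N + 1)))).sum := by
    intro M _ φ L
    rw [map_list_sum, List.map_map]
    congr 1
    exact List.map_congr_left fun p _ => map_nsmul φ _ _
  have hbig : (N + 1).factorial * 2 ^ 20 < 2 ^ 48 := by
    have h1 := Nat.factorial_le hn11
    have h2 : Nat.factorial 11 * 2 ^ 20 < 2 ^ 48 := by decide
    calc _ ≤ _ := Nat.mul_le_mul_right _ h1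
      _ < _ := h2
  have hcoeff : ∀ (G : SimpleGraph ℕ) d,
      coeff d (blockPoly G (N + 1) (Finset.range (N + 1))) ≤ 2 ^ 20 := fun G d => by
    have h1 := coeff_blockPoly_le G (N + 1) (Finset.range (N + 1)) subset_rfl d
    rw [Finset.card_range] at h1
    exact h1.trans (bell_lt _ hn11).le
  have hsupp := blockPoly_support G (N + 1) hG (Finset.range (N + 1)) subset_rfl
  rw [Finset.card_range] at hsupp
  have hsuppL : ∀ L : List (ℕ × List ℕ), (∀ p ∈ L, p.2.sum = N + 1 ∧ ∀ A ⊆ Finset.range (N + 1),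
      IsStable (cliqueUnion p.2) A → A.card ≤ a) →
      (L.map fun p => p.1 • blockPoly (cliqueUnion p.2) (N + 1)
        (Finset.range (N + 1))).sum.IsWeightedHomogeneous (fun i : ℕ => i) (N + 1) ∧
      (L.map fun p => p.1 • blockPoly (cliqueUnion p.2) (N + 1) (Finset.range (N + 1))).sum ∈
        supported ℕ (Set.Icc 1 a) := by
    intro L
    induction L with
    | nil => exact fun _ => ⟨isWeightedHomogeneous_zero ℕ _ _, zero_mem _⟩
    | cons p L ih =>
      intro hL
      obtain ⟨h1, h2⟩ := ih fun p hp => hL p (List.mem_cons_of_mem _ hp)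
      obtain ⟨h3, h4⟩ := blockPoly_support (cliqueUnion p.2) (N + 1) (hL p List.mem_cons_self).2
        (Finset.range (N + 1)) subset_rfl
      rw [Finset.card_range] at h3
      rw [List.map_cons, List.sum_cons]
      exact ⟨((weightedHomogeneousSubmodule ℕ _ _).nsmul_mem h3 p.1).add h1,
        add_mem (nsmul_mem h4 _) h2⟩
  refine eq_of_eval_eq ha.nodup (z := sizeValue zs) (fun i hi hia => sizeValue_eq ha.length (by omega))
    ((weightedHomogeneousSubmodule ℕ _ _).nsmul_mem hsupp.1 _) (nsmul_mem hsupp.2 _) (fun d => ?_)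
    (hsuppL L hL).1 (hsuppL L hL).2 (fun d => ?_) ?_
  · rw [coeff_smul, smul_eq_mul]
    exact (Nat.mul_le_mul_left _ (hcoeff G d)).trans_lt hbig
  · have h1 := hsum (coeffAddMonoidHom d) L
    simp only [coeffAddMonoidHom_apply] at h1
    rw [h1]
    refine lt_of_le_of_lt ?_ hbig
    calc _ ≤ (L.map fun p => p.1 * 2 ^ 20).sum := List.sum_le_sum fun p _ => by
            rw [smul_eq_mul]
            exact Nat.mul_le_mul_left _ (hcoeff _ d)
      _ = (L.map fun p => p.1).sum * 2 ^ 20 := List.sum_map_mul_right _ _ _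
      _ ≤ _ := Nat.mul_le_mul_right _ hs
  · rw [map_nsmul, smul_eq_mul, ← htop G cs hcs, ← hv]
    have h1 := hsum (eval (sizeValue zs)).toAddMonoidHom L
    simp only [RingHom.toAddMonoidHom_eq_coe, AddMonoidHom.coe_coe] at h1
    rw [h1]
    congr 1
    refine List.map_congr_left fun p hp => ?_
    rw [smul_eq_mul, htop (cliqueUnion p.2)]
    have := candidates_cliqueUnion p.2
    rwa [(hL p hp).1] at this

theorem isEPositive_of_checkCode {R : ℕ} (hR : Codes n R G) (hn : 0 < n) (hn11 : n ≤ 11)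
    (h3 : Suitable n 3 96) (h4 : Suitable n 4 204) (h5 : Suitable n 5 336) (h6 : Suitable n 6 424)
    (h : checkCode n (mkBasis n 3 96) (mkBasis n 4 204) (mkBasis n 5 336) (mkBasis n 6 424) R = true) :
    IsEPositive (onFin n G) := by
  have hcs := hR.candidates n le_rfl
  obtain ⟨N, rfl⟩ := Nat.exists_eq_succ_of_ne_zero hn.ne'
  have hst : ∀ a, hasStableAbove a (⟨0, 0, 0⟩ :: (mkBasis (N + 1) 3 96).vertices)
      (candidatesOf R (N + 1)) = false → ∀ A ⊆ Finset.range (N + 1), IsStable G A → A.card ≤ a :=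
    fun a ha => card_le_of_hasStableAbove N le_rfl _ _ hcs ha
  unfold checkCode at h
  dsimp only at h
  rcases hs : hasStableAbove 3 (⟨0, 0, 0⟩ :: (mkBasis (N + 1) 3 96).vertices)
    (candidatesOf R (N + 1)) with _ | _
  · rw [hs, cond_false] at h
    exact isEPositive_of_checkWith hn hn11 h3 hcs (hst 3 hs) h
  rw [hs, cond_true] at h
  clear hs
  rcases hs : hasStableAbove 4 (⟨0, 0, 0⟩ :: (mkBasis (N + 1) 3 96).vertices)
    (candidatesOf R (N + 1)) with _ | _
  · rw [hs, cond_false] at h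
    exact isEPositive_of_checkWith hn hn11 h4 hcs (hst 4 hs) h
  rw [hs, cond_true] at h
  clear hs
  rcases hs : hasStableAbove 5 (⟨0, 0, 0⟩ :: (mkBasis (N + 1) 3 96).vertices)
    (candidatesOf R (N + 1)) with _ | _
  · rw [hs, cond_false] at h
    exact isEPositive_of_checkWith hn hn11 h5 hcs (hst 5 hs) h
  rw [hs, cond_true] at h
  clear hs
  rcases hs : hasStableAbove 6 (⟨0, 0, 0⟩ :: (mkBasis (N + 1) 3 96).vertices)
    (candidatesOf R (N + 1)) with _ | _
  · rw [hs, cond_false] at h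
    exact isEPositive_of_checkWith hn hn11 h6 hcs (hst 6 hs) h
  · rw [hs, cond_true] at h
    exact absurd h (by simp)

theorem suitable {n : ℕ} (hn : n = 10 ∨ n = 11) :
    Suitable n 3 96 ∧ Suitable n 4 204 ∧ Suitable n 5 336 ∧ Suitable n 6 424 := by
  rcases hn with rfl | rfl <;>
    exact ⟨⟨rfl, rfl, by decide, by decide +kernel⟩, ⟨rfl, rfl, by decide, by decide +kernel⟩,
      ⟨rfl, rfl, by decide, by decide +kernel⟩, ⟨rfl, rfl, by decide, by decide +kernel⟩⟩

end Positivity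

/-! ### Two disjoint complete graphs -/

section TwoCliques

open MvPolynomial

/-- The block polynomial of the disjoint union of complete graphs on `i` and `j` vertices. -/
noncomputable def twoCliquePoly : ℕ → ℕ → MvPolynomial ℕ ℕ
  | 0, j => X 1 ^ j
  | i+1, j => X 1 * twoCliquePoly i j + j • (X 2 * twoCliquePoly i (j - 1))

theorem cliqueUnion_pair_adj {a b i j : ℕ} : (cliqueUnion [a, b]).Adj i j ↔
    i ≠ j ∧ ((i < b ∧ j < b) ∨ ((b ≤ i ∧ i < b + a) ∧ b ≤ j ∧ j < b + a)) := by
  simp only [cliqueUnion, List.sum_cons, List.sum_nil, SimpleGraph.bot_adj, false_or, add_zero,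
    Nat.zero_le, true_and, zero_add]
  tauto

theorem blockPoly_cliqueUnion_pair {a b : ℕ} (k : ℕ) : k ≤ a + b → ∀ S : Finset ℕ,
    blockPoly (cliqueUnion [a, b]) k S =
      twoCliquePoly (S.filter fun x => b ≤ x ∧ x < k).card (S.filter fun x => x < b ∧ x < k).card := by
  induction k with
  | zero => intro _ S; simp [blockPoly, twoCliquePoly]
  | succ k ih =>
    intro hk S
    have ih := ih (by omega)
    rw [blockPoly]
    by_cases hkS : k ∈ S
    · rw [if_pos hkS]
      by_cases hkb : k < b
      · have h1 : blocksBelow (cliqueUnion [a, b]) k S = {∅} := by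
          ext A
          rw [mem_blocksBelow, Finset.mem_singleton]
          constructor
          · rintro ⟨h1, h2⟩
            refine Finset.eq_empty_of_forall_notMem fun i hi => ?_
            have h3 := Finset.mem_range.mp (Finset.mem_inter.mp (h1 hi)).2
            refine h2 k (Finset.mem_insert_self _ _) i (Finset.mem_insert_of_mem hi) ?_
            rw [cliqueUnion_pair_adj]
            omega
          · rintro rfl
            refine ⟨Finset.empty_subset _, ?_⟩
            intro x hx y hy h
            simp at hx hy
            exact h.ne (hx.trans hy.symm)
        have h2 : (S.filter fun x => b ≤ x ∧ x < k) = ∅ :=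
          Finset.filter_eq_empty_iff.mpr fun x _ => by omega
        have h3 : (S.filter fun x => b ≤ x ∧ x < k + 1) = ∅ :=
          Finset.filter_eq_empty_iff.mpr fun x _ => by omega
        have h4 : (S.filter fun x => x < b ∧ x < k + 1) =
            insert k (S.filter fun x => x < b ∧ x < k) := by
          ext x
          simp only [Finset.mem_filter, Finset.mem_insert]
          constructor
          · rintro ⟨h, _, _⟩
            by_cases hx : x = k
            · exact Or.inl hx
            · exact Or.inr ⟨h, by omega⟩
          · rintro (rfl | ⟨h, _, _⟩)
            · exact ⟨hkS, by omega⟩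
            · exact ⟨h, by omega⟩
        rw [h1, Finset.sum_singleton, Finset.sdiff_empty, ih, h2, h3, h4,
          Finset.card_insert_of_notMem (by simp)]
        simp [twoCliquePoly, pow_succ, mul_comm]
      · have h4 : (S.filter fun x => b ≤ x ∧ x < k + 1) =
            insert k (S.filter fun x => b ≤ x ∧ x < k) := by
          ext x
          simp only [Finset.mem_filter, Finset.mem_insert]
          constructor
          · rintro ⟨h, _, _⟩
            by_cases hx : x = k
            · exact Or.inl hx
            · exact Or.inr ⟨h, by omega⟩
          · rintro (rfl | ⟨h, _, _⟩)
            · exact ⟨hkS, by omega⟩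
            · exact ⟨h, by omega⟩
        have h5 : (S.filter fun x => x < b ∧ x < k + 1) = S.filter fun x => x < b ∧ x < k :=
          Finset.filter_congr fun x _ => by omega
        have h1 : blocksBelow (cliqueUnion [a, b]) k S =
            insert ∅ ((S.filter fun x => x < b ∧ x < k).map ⟨singleton, Finset.singleton_injective⟩) := by
          ext A
          rw [mem_blocksBelow, Finset.mem_insert, Finset.mem_map]
          simp only [Finset.mem_filter, Function.Embedding.coeFn_mk]
          constructor
          · rintro ⟨h1, h2⟩
            rcases A.eq_empty_or_nonempty with rfl | ⟨x, hx⟩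
            · exact Or.inl rfl
            · have h3 : ∀ x ∈ A, x ∈ S ∧ x < k ∧ x < b := fun x hx => by
                have h3 := Finset.mem_inter.mp (h1 hx)
                rw [Finset.mem_range] at h3
                have h4 := h2 k (Finset.mem_insert_self _ _) x (Finset.mem_insert_of_mem hx)
                rw [cliqueUnion_pair_adj] at h4
                exact ⟨h3.1, h3.2, by omega⟩
              refine Or.inr ⟨x, ⟨(h3 x hx).1, (h3 x hx).2.2, (h3 x hx).2.1⟩, ?_⟩
              symm
              rw [Finset.eq_singleton_iff_unique_mem]
              refine ⟨hx, fun y hy => ?_⟩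
              by_contra hxy
              refine h2 x (Finset.mem_insert_of_mem hx) y (Finset.mem_insert_of_mem hy) ?_
              rw [cliqueUnion_pair_adj]
              exact ⟨Ne.symm hxy, Or.inl ⟨(h3 x hx).2.2, (h3 y hy).2.2⟩⟩
          · rintro (rfl | ⟨x, ⟨h1, h2, h3⟩, rfl⟩)
            · refine ⟨Finset.empty_subset _, ?_⟩
              intro x hx y hy h
              simp at hx hy
              exact h.ne (hx.trans hy.symm)
            · refine ⟨by simp [h1, h3], ?_⟩
              intro y hy z hz h
              simp only [Finset.mem_insert, Finset.mem_singleton] at hy hz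
              rw [cliqueUnion_pair_adj] at h
              omega
        have h6 : ∀ x ∈ S.filter (fun x => x < b ∧ x < k), blockPoly (cliqueUnion [a, b]) k (S \ {x}) =
            twoCliquePoly (S.filter fun x => b ≤ x ∧ x < k).card
              ((S.filter fun x => x < b ∧ x < k).card - 1) := fun x hx => by
          rw [ih, ← Finset.card_erase_of_mem hx]
          rw [Finset.mem_filter] at hx
          congr 2
          · ext y
            simp only [Finset.mem_filter, Finset.mem_sdiff, Finset.mem_singleton]
            exact ⟨fun h => ⟨h.1.1, h.2⟩, fun h => ⟨⟨h.1, by omega⟩, h.2⟩⟩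
          · ext y
            simp only [Finset.mem_filter, Finset.mem_sdiff, Finset.mem_singleton, Finset.mem_erase]
            tauto
        rw [h1, Finset.sum_insert (by simp), Finset.sum_map, Finset.sdiff_empty, ih, h4, h5,
          Finset.card_insert_of_notMem (by simp), twoCliquePoly]
        congr 1
        refine (Finset.sum_congr rfl fun x hx => ?_).trans (Finset.sum_const _)
        rw [Function.Embedding.coeFn_mk, h6 x hx, Finset.card_singleton]
    · rw [if_neg hkS, ih]
      congr 2
      · refine Finset.filter_congr fun x hx => ?_
        have : x ≠ k := fun h => hkS (h ▸ hx)
        omega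
      · refine Finset.filter_congr fun x hx => ?_
        have : x ≠ k := fun h => hkS (h ▸ hx)
        omega

theorem blockPoly_cliqueUnion_pair_range (i j : ℕ) :
    blockPoly (cliqueUnion [i, j]) (i + j) (Finset.range (i + j)) = twoCliquePoly i j := by
  rw [blockPoly_cliqueUnion_pair _ le_rfl]
  congr 1
  · have : ((Finset.range (i + j)).filter fun x => j ≤ x ∧ x < i + j) = Finset.Ico j (i + j) := by
      ext x
      simp only [Finset.mem_filter, Finset.mem_range, Finset.mem_Ico]
      omega
    rw [this, Nat.card_Ico]
    omega
  · have : ((Finset.range (i + j)).filter fun x => x < j ∧ x < i + j) = Finset.range j := by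
      ext x
      simp only [Finset.mem_filter, Finset.mem_range]
      omega
    rw [this, Finset.card_range]

theorem pderiv_one_twoCliquePoly (i : ℕ) : ∀ j, pderiv 1 (twoCliquePoly i j) =
    i • twoCliquePoly (i - 1) j + j • twoCliquePoly i (j - 1) := by
  induction i with
  | zero =>
    intro j
    simp [twoCliquePoly]
  | succ i ih =>
    intro j
    have h21 : pderiv 1 (X 2 : MvPolynomial ℕ ℕ) = 0 := pderiv_X_of_ne (by norm_num)
    have h2 : i • twoCliquePoly i j = i • (X 1 * twoCliquePoly (i - 1) j +
        j • (X 2 * twoCliquePoly (i - 1) (j - 1))) := by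
      rcases i with _ | i
      · simp
      · rfl
    simp only [twoCliquePoly, map_add, map_nsmul, Derivation.leibniz, pderiv_X_self, smul_eq_mul, ih, h21,
      Nat.add_sub_cancel, add_smul, one_smul, h2]
    simp only [nsmul_eq_mul]
    ring

theorem pderiv_two_twoCliquePoly (i : ℕ) : ∀ j, pderiv 2 (twoCliquePoly i j) =
    (i * j) • twoCliquePoly (i - 1) (j - 1) := by
  induction i with
  | zero =>
    intro j
    have h12 : pderiv 2 (X 1 : MvPolynomial ℕ ℕ) = 0 := pderiv_X_of_ne (by norm_num)
    simp [twoCliquePoly, h12]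
  | succ i ih =>
    intro j
    have h12 : pderiv 2 (X 1 : MvPolynomial ℕ ℕ) = 0 := pderiv_X_of_ne (by norm_num)
    have h2 : i • twoCliquePoly i (j - 1) = i • (X 1 * twoCliquePoly (i - 1) (j - 1) +
        (j - 1) • (X 2 * twoCliquePoly (i - 1) (j - 1 - 1))) := by
      rcases i with _ | i
      · simp
      · rfl
    simp only [twoCliquePoly, map_add, map_nsmul, Derivation.leibniz, pderiv_X_self, smul_eq_mul, ih, h12,
      Nat.add_sub_cancel]
    have h3 : ((i + 1) * j) • twoCliquePoly i (j - 1) =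
        j • twoCliquePoly i (j - 1) + j • (i • twoCliquePoly i (j - 1)) := by
      rw [add_mul, add_smul, one_mul, add_comm, mul_comm i j, mul_smul]
    rw [h3, h2]
    simp only [nsmul_eq_mul, Nat.cast_mul]
    ring

theorem twoCliquePoly_mem (i : ℕ) : ∀ j, twoCliquePoly i j ∈ supported ℕ (Set.Icc 1 2) := by
  have h1 : (X 1 : MvPolynomial ℕ ℕ) ∈ supported ℕ (Set.Icc 1 2) :=
    Algebra.subset_adjoin ⟨1, by simp, rfl⟩
  have h2 : (X 2 : MvPolynomial ℕ ℕ) ∈ supported ℕ (Set.Icc 1 2) :=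
    Algebra.subset_adjoin ⟨2, by simp, rfl⟩
  induction i with
  | zero => exact fun j => pow_mem h1 j
  | succ i ih => exact fun j => add_mem (mul_mem h1 (ih j)) (nsmul_mem (mul_mem h2 (ih _)) j)

theorem constantCoeff_twoCliquePoly (i j : ℕ) (h : i + j ≠ 0) :
    constantCoeff (twoCliquePoly i j) = 0 := by
  rcases i with _ | i
  · have : j ≠ 0 := by omega
    simp [twoCliquePoly, this]
  · simp [twoCliquePoly]

/-- A polynomial in `X 1` and `X 2` is determined by its constant coefficient and its derivatives. -/
theorem eq_of_pderiv_eq {P Q : MvPolynomial ℕ ℤ} (hP : P ∈ supported ℤ (Set.Icc 1 2))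
    (hQ : Q ∈ supported ℤ (Set.Icc 1 2)) (h0 : constantCoeff P = constantCoeff Q)
    (h1 : pderiv 1 P = pderiv 1 Q) (h2 : pderiv 2 P = pderiv 2 Q) : P = Q := by
  ext d
  by_cases hd : d = 0
  · subst hd
    exact h0
  obtain ⟨i, hi⟩ := Finsupp.ne_iff.mp hd
  rw [Finsupp.coe_zero, Pi.zero_apply] at hi
  have hco : ∀ P : MvPolynomial ℕ ℤ, P ∈ supported ℤ (Set.Icc 1 2) → ¬ (i = 1 ∨ i = 2) →
      coeff d P = 0 := by
    intro P hP h
    by_contra hc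
    have := Set.mem_Icc.mp (mem_supported.mp hP ((mem_vars_iff_mem_support i).mpr
      ⟨d, mem_support_iff.mpr hc, Finsupp.mem_support_iff.mpr hi⟩))
    omega
  by_cases hi' : i = 1 ∨ i = 2
  · have h : pderiv i P = pderiv i Q := by
      rcases hi' with rfl | rfl
      · exact h1
      · exact h2
    have h3 := congrArg (coeff (d - Finsupp.single i 1)) h
    have h4 : d - Finsupp.single i 1 + Finsupp.single i 1 = d := by
      refine tsub_add_cancel_of_le ?_
      rw [Finsupp.single_le_iff]
      omega
    rw [coeff_pderiv, coeff_pderiv, h4] at h3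
    refine mul_right_cancel₀ ?_ h3
    positivity
  · rw [hco P hP hi', hco Q hQ hi']

end TwoCliques

/-! ### Graphs without three independent vertices -/

section TwoBlocks

open MvPolynomial

variable (G : SimpleGraph ℕ)

/-- The sum of the values of `f` at the sets obtained by removing a vertex. -/
def removeOne (f : Finset ℕ → ℤ) (W : Finset ℕ) : ℤ := ∑ u ∈ W, f (W.erase u)

/-- The sum of the values of `f` at the sets obtained by removing a pair of nonadjacent vertices. -/
noncomputable def removePair (f : Finset ℕ → ℤ) (W : Finset ℕ) : ℤ :=
  ∑ B ∈ stableOfSize G W 2, f (W \ B)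

theorem stableOfSize_eq_empty {G : SimpleGraph ℕ} {W : Finset ℕ} {a : ℕ} (h : W.card < a) :
    stableOfSize G W a = ∅ :=
  Finset.eq_empty_of_forall_notMem fun B hB => by
    obtain ⟨⟨h1, _⟩, h2⟩ := mem_stableOfSize.mp hB
    have := Finset.card_le_card h1
    omega

theorem removePair_removeOne (f : Finset ℕ → ℤ) (W : Finset ℕ) :
    removeOne (removePair G f) W = removePair G (removeOne f) W := by
  simp only [removeOne, removePair]
  rw [Finset.sum_comm' (t' := stableOfSize G W 2) (s' := fun B => W \ B)]
  · refine Finset.sum_congr rfl fun B _ => Finset.sum_congr rfl fun u _ => ?_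
    rw [Finset.erase_sdiff_comm]
  · intro u B
    simp only [mem_stableOfSize, Finset.mem_sdiff]
    constructor
    · rintro ⟨h1, ⟨h2, h3⟩, h4⟩
      exact ⟨⟨h1, fun h => by simpa using h2 h⟩, ⟨h2.trans (Finset.erase_subset _ _), h3⟩, h4⟩
    · rintro ⟨⟨h1, h2⟩, ⟨h3, h4⟩, h5⟩
      exact ⟨h1, ⟨fun x hx => Finset.mem_erase.mpr ⟨fun h => h2 (h ▸ hx), h3 hx⟩, h4⟩, h5⟩

theorem removePair_congr {f g : Finset ℕ → ℤ} {m : ℕ} (h : ∀ W, W.card = m → f W = g W) (W : Finset ℕ)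
    (hW : W.card = m + 2) : removePair G f W = removePair G g W := by
  refine Finset.sum_congr rfl fun B hB => h _ ?_
  obtain ⟨⟨h1, _⟩, h2⟩ := mem_stableOfSize.mp hB
  rw [Finset.card_sdiff_of_subset h1, h2, hW, Nat.add_sub_cancel]

/-- The signed number of ways to remove all vertices of a set of `m` vertices, one by one or in pairs of
nonadjacent vertices, where a pair counts with the sign `-1`. -/
noncomputable def removalCountAux : ℕ → Finset ℕ → ℤ
  | 0, _ => 1
  | 1, W => ∑ u ∈ W, removalCountAux 0 (W.erase u)
  | m+2, W => ∑ u ∈ W, removalCountAux (m+1) (W.erase u) -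
      ∑ B ∈ stableOfSize G W 2, removalCountAux m (W \ B)

/-- The signed number of ways to remove all vertices of `W`, one by one or in nonadjacent pairs. -/
noncomputable def removalCount (W : Finset ℕ) : ℤ := removalCountAux G W.card W

theorem removalCount_eq (W : Finset ℕ) : removalCount G W =
    removeOne (removalCount G) W - removePair G (removalCount G) W + if W = ∅ then 1 else 0 := by
  have h1 : ∀ u ∈ W, (W.erase u).card = W.card - 1 := fun u hu => Finset.card_erase_of_mem hu
  have h2 : ∀ B ∈ stableOfSize G W 2, (W \ B).card = W.card - 2 ∧ 2 ≤ W.card := fun B hB => by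
    obtain ⟨⟨h1, _⟩, h2⟩ := mem_stableOfSize.mp hB
    rw [Finset.card_sdiff_of_subset h1, h2]
    exact ⟨rfl, h2 ▸ Finset.card_le_card h1⟩
  have e1 : removeOne (removalCount G) W = ∑ u ∈ W, removalCountAux G (W.card - 1) (W.erase u) :=
    Finset.sum_congr rfl fun u hu => by rw [removalCount, h1 u hu]
  have e2 : removePair G (removalCount G) W =
      ∑ B ∈ stableOfSize G W 2, removalCountAux G (W.card - 2) (W \ B) :=
    Finset.sum_congr rfl fun B hB => by rw [removalCount, (h2 B hB).1]
  rw [e1, e2, removalCount]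
  rcases hc : W.card with _ | _ | m
  · have hW : W = ∅ := Finset.card_eq_zero.mp hc
    subst hW
    rw [stableOfSize_eq_empty (by simp)]
    simp [removalCountAux]
  · have hW : W ≠ ∅ := fun h => by simp [h] at hc
    rw [stableOfSize_eq_empty (by omega)]
    simp [removalCountAux, hW]
  · have hW : W ≠ ∅ := fun h => by simp [h] at hc
    rw [removalCountAux, if_neg hW, add_zero]
    rfl

/-- Twice the coefficient of `e_m` in the chromatic symmetric function of the graph induced on a
nonempty set of `m` vertices. -/
noncomputable def topCoeff (W : Finset ℕ) : ℤ :=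
  removeOne (removalCount G) W - 2 * removePair G (removalCount G) W + if W = ∅ then 2 else 0

/-- Coefficients of the expansion of the chromatic symmetric function in terms of the products
`e_i * e_j`; since the products are symmetric in `i` and `j`, so are the coefficients. -/
noncomputable def pairCoeff : ℕ → ℕ → Finset ℕ → ℤ
  | 0, _ => topCoeff G
  | _+1, 0 => topCoeff G
  | i+1, j+1 => removePair G (pairCoeff i j)

theorem pairCoeff_zero_left (j : ℕ) : pairCoeff G 0 j = topCoeff G := by cases j <;> rfl

theorem pairCoeff_zero_right (i : ℕ) : pairCoeff G i 0 = topCoeff G := by cases i <;> rfl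

theorem removeOne_add (f g : Finset ℕ → ℤ) (W : Finset ℕ) :
    removeOne (fun W => f W + g W) W = removeOne f W + removeOne g W := Finset.sum_add_distrib

theorem removePair_add (f g : Finset ℕ → ℤ) (W : Finset ℕ) :
    removePair G (fun W => f W + g W) W = removePair G f W + removePair G g W := Finset.sum_add_distrib

theorem removeOne_mul (c : ℤ) (f : Finset ℕ → ℤ) (W : Finset ℕ) :
    removeOne (fun W => c * f W) W = c * removeOne f W := (Finset.mul_sum _ _ _).symm

theorem removePair_mul (c : ℤ) (f : Finset ℕ → ℤ) (W : Finset ℕ) :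
    removePair G (fun W => c * f W) W = c * removePair G f W := (Finset.mul_sum _ _ _).symm

theorem topCoeff_eq (W : Finset ℕ) (hW : 2 ≤ W.card) :
    topCoeff G W = removeOne (topCoeff G) W - removePair G (topCoeff G) W := by
  set A := removalCount G with hA
  set δ : Finset ℕ → ℤ := fun W => if W = ∅ then 1 else 0 with hδ
  have hA' : A = fun W => removeOne A W + ((-1) * removePair G A W + δ W) := by
    funext W
    rw [hA, removalCount_eq G W]
    ring
  have hT : topCoeff G = fun W => removeOne A W + ((-2) * removePair G A W + 2 * δ W) := by
    funext W
    simp only [topCoeff, hδ]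
    split_ifs <;> ring
  have hWe : W ≠ ∅ := fun h => by simp [h] at hW
  have hδ0 : δ W = 0 := if_neg hWe
  have hδ1 : removeOne δ W = 0 := Finset.sum_eq_zero fun u hu => if_neg fun h => by
    have := Finset.card_erase_of_mem hu
    rw [h, Finset.card_empty] at this
    omega
  -- the operators commute, so applying them to the equation of `A` gives that of the coefficients
  have d1 : removeOne A W = removeOne (removeOne A) W + ((-1) * removeOne (removePair G A) W +
      removeOne δ W) := by
    conv_lhs => rw [hA']
    rw [removeOne_add, removeOne_add, removeOne_mul]
  have d2 : removePair G A W = removePair G (removeOne A) W +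
      ((-1) * removePair G (removePair G A) W + removePair G δ W) := by
    conv_lhs => rw [hA']
    rw [removePair_add, removePair_add, removePair_mul]
  have d3 : removeOne (topCoeff G) W = removeOne (removeOne A) W +
      ((-2) * removeOne (removePair G A) W + 2 * removeOne δ W) := by
    rw [hT, removeOne_add, removeOne_add, removeOne_mul, removeOne_mul]
  have d4 : removePair G (topCoeff G) W = removePair G (removeOne A) W +
      ((-2) * removePair G (removePair G A) W + 2 * removePair G δ W) := by
    rw [hT, removePair_add, removePair_add, removePair_mul, removePair_mul]
  have d5 := removePair_removeOne G A W
  have d6 : topCoeff G W = removeOne A W + ((-2) * removePair G A W + 2 * δ W) := congrFun hT W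
  rw [d3, d4, d6, hδ0, d1, d2, hδ1, d5]
  ring

theorem pairCoeff_add (i : ℕ) : ∀ (j : ℕ) (W : Finset ℕ), W.card = i + j + 1 →
    pairCoeff G (i + 1) j W + pairCoeff G i (j + 1) W = removeOne (pairCoeff G i j) W := by
  induction i with
  | zero =>
    intro j W hW
    rw [pairCoeff_zero_left, pairCoeff_zero_left]
    rcases j with _ | j
    · rw [pairCoeff_zero_right]
      obtain ⟨u, rfl⟩ := Finset.card_eq_one.mp hW
      have h1 : stableOfSize G {u} 2 = ∅ := stableOfSize_eq_empty (by simp)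
      have h2 : stableOfSize G ∅ 2 = ∅ := stableOfSize_eq_empty (by simp)
      simp [topCoeff, removeOne, removePair, h1, h2, removalCount, removalCountAux]
    · have := topCoeff_eq G W (by omega)
      change removePair G (pairCoeff G 0 j) W + _ = _
      rw [pairCoeff_zero_left]
      linarith
  | succ i ih =>
    intro j W hW
    rcases j with _ | j
    · have := topCoeff_eq G W (by omega)
      rw [pairCoeff_zero_right, pairCoeff_zero_right]
      change _ + removePair G (pairCoeff G i 0) W = _
      rw [pairCoeff_zero_right]
      linarith
    · change removePair G (pairCoeff G (i + 1) j) W + removePair G (pairCoeff G i (j + 1)) W =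
        removeOne (removePair G (pairCoeff G i j)) W
      rw [removePair_removeOne, ← removePair_add]
      exact removePair_congr G (ih j) W (by omega)

/-- If the members of `s` are mapped to `t` in such a way that at least `c` of them are mapped to every
member, then the sum of a nonnegative function over `s` is at least `c` times its sum over `t`. -/
theorem mul_sum_le_sum_of_fiber {ι κ : Type*} [DecidableEq κ] (s : Finset ι) (t : Finset κ) (φ : ι → κ)
    (f : κ → ℤ) (c : ℕ) (hφ : ∀ p ∈ s, φ p ∈ t) (hf : ∀ e ∈ t, 0 ≤ f e)
    (hc : ∀ e ∈ t, c ≤ (s.filter fun p => φ p = e).card) :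
    (c : ℤ) * ∑ e ∈ t, f e ≤ ∑ p ∈ s, f (φ p) := by
  rw [← Finset.sum_fiberwise_of_maps_to hφ, Finset.mul_sum]
  refine Finset.sum_le_sum fun e he => ?_
  have h1 : ∑ p ∈ s.filter (fun p => φ p = e), f (φ p) = ∑ p ∈ s.filter (fun p => φ p = e), f e :=
    Finset.sum_congr rfl fun p hp => by rw [(Finset.mem_filter.mp hp).2]
  rw [h1, Finset.sum_const, nsmul_eq_mul]
  exact mul_le_mul_of_nonneg_right (by exact_mod_cast hc e he) (hf e he)

variable {G}

theorem isStable_pair {x y : ℕ} (h : ¬ G.Adj x y) : IsStable G {x, y} := by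
  intro a ha b hb hab
  simp only [Finset.mem_insert, Finset.mem_singleton] at ha hb
  rcases ha with ea | ea <;> rcases hb with eb | eb
  · exact hab.ne (ea.trans eb.symm)
  · exact h (ea ▸ eb ▸ hab)
  · exact h (ea ▸ eb ▸ hab.symm)
  · exact hab.ne (ea.trans eb.symm)

theorem pair_mem {W : Finset ℕ} {x y : ℕ} (hx : x ∈ W) (hy : y ∈ W) (hxy : x ≠ y) (h : ¬ G.Adj x y) :
    {x, y} ∈ stableOfSize G W 2 :=
  mem_stableOfSize.mpr ⟨⟨Finset.insert_subset hx (Finset.singleton_subset_iff.mpr hy), isStable_pair h⟩,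
    Finset.card_pair hxy⟩

theorem exists_pair {W B : Finset ℕ} (hB : B ∈ stableOfSize G W 2) :
    ∃ x y, x ∈ W ∧ y ∈ W ∧ x ≠ y ∧ ¬ G.Adj x y ∧ B = {x, y} := by
  obtain ⟨⟨h1, h2⟩, h3⟩ := mem_stableOfSize.mp hB
  obtain ⟨x, y, hxy, rfl⟩ := Finset.card_eq_two.mp h3
  exact ⟨x, y, h1 (by simp), h1 (by simp), hxy, h2 x (by simp) y (by simp), rfl⟩

theorem sdiff_pair (W : Finset ℕ) (x y : ℕ) : W \ {x, y} = (W.erase x).erase y := by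
  ext z
  simp only [Finset.mem_sdiff, Finset.mem_insert, Finset.mem_singleton, Finset.mem_erase]
  tauto

/-- Without stable sets of three vertices, the vertices not adjacent to `v` form a clique. -/
theorem adj_of_not_adj {W₀ : Finset ℕ} (h2 : ∀ A ⊆ W₀, IsStable G A → A.card ≤ 2) {v x y : ℕ}
    (hv : v ∈ W₀) (hx : x ∈ W₀) (hy : y ∈ W₀) (hxv : x ≠ v) (hyv : y ≠ v) (hxy : x ≠ y)
    (hvx : ¬ G.Adj v x) (hvy : ¬ G.Adj v y) : G.Adj x y := by
  by_contra h
  have hst : IsStable G {v, x, y} := by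
    intro a ha b hb hab
    simp only [Finset.mem_insert, Finset.mem_singleton] at ha hb
    rcases ha with ea | ea | ea <;> rcases hb with eb | eb | eb <;> rw [ea, eb] at hab
    · exact hab.ne rfl
    · exact hvx hab
    · exact hvy hab
    · exact hvx hab.symm
    · exact hab.ne rfl
    · exact h hab
    · exact hvy hab.symm
    · exact h hab.symm
    · exact hab.ne rfl
  have h3 := h2 {v, x, y} (by
    intro z hz
    simp only [Finset.mem_insert, Finset.mem_singleton] at hz
    rcases hz with rfl | rfl | rfl <;> assumption) hst
  rw [Finset.card_eq_three.mpr ⟨v, x, y, hxv.symm, hyv.symm, hxy, rfl⟩] at h3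
  omega

open Classical in
/-- Without stable sets of three vertices, the removal count of `W` is at least the sum of the removal
counts of the sets obtained by removing a member of a clique `K`. Every nonadjacent pair has a member
outside `K`; grouping the pairs by such a member `u`, their other members form a clique in `W \ {u}`,
since they are not adjacent to `u`. -/
theorem sum_removalCount_le {W₀ : Finset ℕ} (h2 : ∀ A ⊆ W₀, IsStable G A → A.card ≤ 2) (m : ℕ) :
    ∀ W ⊆ W₀, W.card = m → ∀ K ⊆ W, (∀ x ∈ K, ∀ y ∈ K, x ≠ y → G.Adj x y) →
    ∑ u ∈ K, removalCount G (W.erase u) ≤ removalCount G W := by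
  induction m using Nat.strong_induction_on with
  | _ m ih =>
    intro W hW₀ hW K hK hKc
    have hnonneg : ∀ W' ⊆ W, W'.card < m → 0 ≤ removalCount G W' := fun W' h1 h2 => by
      have := ih _ h2 W' (h1.trans hW₀) rfl ∅ (by simp) (by simp)
      simpa using this
    rcases Nat.eq_zero_or_pos m with rfl | hm
    · have hWe : W = ∅ := Finset.card_eq_zero.mp hW
      subst hWe
      rw [Finset.subset_empty.mp hK, Finset.sum_empty, removalCount, Finset.card_empty, removalCountAux]
      norm_num
    have hWe : W ≠ ∅ := fun h => by simp [h] at hW; omega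
    -- the other members of the pairs assigned to `u`
    let N : ℕ → Finset ℕ := fun u => W.filter fun x => x ≠ u ∧ ¬ G.Adj u x ∧ (x ∈ K ∨ x < u)
    have hN : ∀ u ∈ W \ K, ∑ x ∈ N u, removalCount G ((W.erase u).erase x) ≤
        removalCount G (W.erase u) := by
      intro u hu
      rw [Finset.mem_sdiff] at hu
      have hc := Finset.card_erase_of_mem hu.1
      refine ih (m - 1) (by omega) _ ((Finset.erase_subset _ _).trans hW₀) (by omega) (N u) ?_ ?_
      · intro x hx
        have := Finset.mem_filter.mp hx
        exact Finset.mem_erase.mpr ⟨this.2.1, this.1⟩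
      · intro x hx y hy hxy
        obtain ⟨hx1, hx2, hx3, _⟩ := Finset.mem_filter.mp hx
        obtain ⟨hy1, hy2, hy3, _⟩ := Finset.mem_filter.mp hy
        exact adj_of_not_adj h2 (hW₀ hu.1) (hW₀ hx1) (hW₀ hy1) hx2 hy2 hxy hx3 hy3
    have hpairs : removePair G (removalCount G) W ≤
        ∑ u ∈ W \ K, ∑ x ∈ N u, removalCount G ((W.erase u).erase x) := by
      have := mul_sum_le_sum_of_fiber ((W \ K).sigma N) (stableOfSize G W 2) (fun p => {p.1, p.2})
        (fun B => removalCount G (W \ B)) 1 ?_ ?_ ?_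
      · rw [Finset.sum_sigma, Nat.cast_one, one_mul] at this
        refine this.trans (le_of_eq ?_)
        refine Finset.sum_congr rfl fun u _ => Finset.sum_congr rfl fun x _ => ?_
        rw [sdiff_pair]
      · rintro ⟨u, x⟩ hp
        rw [Finset.mem_sigma, Finset.mem_sdiff, Finset.mem_filter] at hp
        exact pair_mem hp.1.1 hp.2.1 hp.2.2.1.symm hp.2.2.2.1
      · intro B hB
        obtain ⟨⟨h1, _⟩, h3⟩ := mem_stableOfSize.mp hB
        refine hnonneg _ Finset.sdiff_subset ?_
        rw [Finset.card_sdiff_of_subset h1]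
        omega
      · intro B hB
        obtain ⟨x, y, hx, hy, hxy, hadj, rfl⟩ := exists_pair hB
        refine Finset.card_pos.mpr ?_
        have hmem : ∀ u x, u ∈ W → x ∈ W → x ≠ u → ¬ G.Adj u x → u ∉ K → (x ∈ K ∨ x < u) →
            (⟨u, x⟩ : (_ : ℕ) × ℕ) ∈ (W \ K).sigma N := fun u x hu hx h3 h4 h5 h6 =>
          Finset.mem_sigma.mpr ⟨Finset.mem_sdiff.mpr ⟨hu, h5⟩, Finset.mem_filter.mpr ⟨hx, h3, h4, h6⟩⟩
        have hadj' : ¬ G.Adj y x := fun h => hadj h.symm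
        by_cases hxK : x ∈ K
        · have hyK : y ∉ K := fun h => hadj (hKc x hxK y h hxy)
          exact ⟨⟨y, x⟩, Finset.mem_filter.mpr ⟨hmem y x hy hx hxy hadj' hyK (Or.inl hxK),
            Finset.pair_comm _ _⟩⟩
        · by_cases hyK : y ∈ K
          · exact ⟨⟨x, y⟩, Finset.mem_filter.mpr ⟨hmem x y hx hy hxy.symm hadj hxK (Or.inl hyK), rfl⟩⟩
          · rcases lt_or_gt_of_ne hxy with hlt | hlt
            · exact ⟨⟨y, x⟩, Finset.mem_filter.mpr ⟨hmem y x hy hx hxy hadj' hyK (Or.inr hlt),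
                Finset.pair_comm _ _⟩⟩
            · exact ⟨⟨x, y⟩, Finset.mem_filter.mpr ⟨hmem x y hx hy hxy.symm hadj hxK (Or.inr hlt), rfl⟩⟩
    rw [removalCount_eq, if_neg hWe, add_zero, removeOne, ← Finset.sum_sdiff hK]
    have := Finset.sum_le_sum hN
    linarith

theorem removalCount_nonneg {W₀ W : Finset ℕ} (h2 : ∀ A ⊆ W₀, IsStable G A → A.card ≤ 2)
    (hW : W ⊆ W₀) : 0 ≤ removalCount G W := by
  have := sum_removalCount_le h2 _ W hW rfl ∅ (by simp) (by simp)
  simpa using this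

open Classical in
theorem topCoeff_nonneg {W₀ W : Finset ℕ} (h2 : ∀ A ⊆ W₀, IsStable G A → A.card ≤ 2)
    (hW : W ⊆ W₀) : 0 ≤ topCoeff G W := by
  let N : ℕ → Finset ℕ := fun v => W.filter fun x => x ≠ v ∧ ¬ G.Adj v x
  have hN : ∀ v ∈ W, ∑ x ∈ N v, removalCount G ((W.erase v).erase x) ≤
      removalCount G (W.erase v) := by
    intro v hv
    refine sum_removalCount_le h2 _ _ ((Finset.erase_subset _ _).trans hW) rfl (N v) ?_ ?_
    · intro x hx
      have := Finset.mem_filter.mp hx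
      exact Finset.mem_erase.mpr ⟨this.2.1, this.1⟩
    · intro x hx y hy hxy
      obtain ⟨hx1, hx2, hx3⟩ := Finset.mem_filter.mp hx
      obtain ⟨hy1, hy2, hy3⟩ := Finset.mem_filter.mp hy
      exact adj_of_not_adj h2 (hW hv) (hW hx1) (hW hy1) hx2 hy2 hxy hx3 hy3
  have hpairs : 2 * removePair G (removalCount G) W ≤
      ∑ v ∈ W, ∑ x ∈ N v, removalCount G ((W.erase v).erase x) := by
    have := mul_sum_le_sum_of_fiber (W.sigma N) (stableOfSize G W 2) (fun p => {p.1, p.2})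
      (fun B => removalCount G (W \ B)) 2 ?_ ?_ ?_
    · rw [Finset.sum_sigma] at this
      refine this.trans (le_of_eq ?_)
      refine Finset.sum_congr rfl fun u _ => Finset.sum_congr rfl fun x _ => ?_
      rw [sdiff_pair]
    · rintro ⟨u, x⟩ hp
      rw [Finset.mem_sigma, Finset.mem_filter] at hp
      exact pair_mem hp.1 hp.2.1 hp.2.2.1.symm hp.2.2.2
    · exact fun B _ => removalCount_nonneg h2 (Finset.sdiff_subset.trans hW)
    · intro B hB
      obtain ⟨x, y, hx, hy, hxy, hadj, rfl⟩ := exists_pair hB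
      have hne : (⟨x, y⟩ : (_ : ℕ) × ℕ) ≠ ⟨y, x⟩ := fun h => hxy (congrArg Sigma.fst h)
      rw [← Finset.card_pair hne]
      refine Finset.card_le_card (Finset.insert_subset ?_ (Finset.singleton_subset_iff.mpr ?_))
      · exact Finset.mem_filter.mpr ⟨Finset.mem_sigma.mpr ⟨hx, Finset.mem_filter.mpr
          ⟨hy, hxy.symm, hadj⟩⟩, rfl⟩
      · exact Finset.mem_filter.mpr ⟨Finset.mem_sigma.mpr ⟨hy, Finset.mem_filter.mpr
          ⟨hx, hxy, fun h => hadj h.symm⟩⟩, Finset.pair_comm _ _⟩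
  have := Finset.sum_le_sum hN
  have h0 : (0 : ℤ) ≤ if W = ∅ then 2 else 0 := by split_ifs <;> norm_num
  rw [topCoeff, removeOne]
  linarith

theorem pairCoeff_nonneg {W₀ : Finset ℕ} (h2 : ∀ A ⊆ W₀, IsStable G A → A.card ≤ 2) (i : ℕ) :
    ∀ (j : ℕ) (W : Finset ℕ), W ⊆ W₀ → 0 ≤ pairCoeff G i j W := by
  induction i with
  | zero => exact fun j W hW => by rw [pairCoeff_zero_left]; exact topCoeff_nonneg h2 hW
  | succ i ih =>
    intro j W hW
    rcases j with _ | j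
    · exact topCoeff_nonneg h2 hW
    · exact Finset.sum_nonneg fun B _ => ih j _ (Finset.sdiff_subset.trans hW)

/-- The integral version of a polynomial with natural coefficients. -/
noncomputable abbrev toInt (P : MvPolynomial ℕ ℕ) : MvPolynomial ℕ ℤ := map (Nat.castRingHom ℤ) P

theorem toInt_mem {P : MvPolynomial ℕ ℕ} {s : Set ℕ} (h : P ∈ supported ℕ s) :
    toInt P ∈ supported ℤ s :=
  mem_supported.mpr fun _ hi => mem_supported.mp h (vars_map _ _ hi)

theorem stableOfSize_one_sum {M : Type*} [AddCommMonoid M] (W : Finset ℕ) (f : Finset ℕ → M) :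
    ∑ B ∈ stableOfSize G W 1, f (W \ B) = ∑ u ∈ W, f (W.erase u) := by
  have : stableOfSize G W 1 = W.map ⟨singleton, Finset.singleton_injective⟩ := by
    ext B
    rw [mem_stableOfSize, Finset.mem_map]
    constructor
    · rintro ⟨⟨h1, _⟩, h2⟩
      obtain ⟨u, rfl⟩ := Finset.card_eq_one.mp h2
      exact ⟨u, h1 (by simp), rfl⟩
    · rintro ⟨u, hu, rfl⟩
      refine ⟨⟨by simpa using hu, ?_⟩, by simp⟩
      intro a ha b hb hab
      simp at ha hb
      exact hab.ne (ha.trans hb.symm)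
  rw [this, Finset.sum_map]
  refine Finset.sum_congr rfl fun u _ => ?_
  rw [Function.Embedding.coeFn_mk, Finset.sdiff_singleton_eq_erase]

/-- The expansion of the block polynomial in terms of those of two disjoint cliques. Both sides have the
same derivatives, since their coefficients satisfy the same recursions. -/
theorem blockPoly_eq_sum (n : ℕ) (h2 : ∀ A ⊆ Finset.range n, IsStable G A → A.card ≤ 2) (m : ℕ) :
    ∀ W ⊆ Finset.range n, W.card = m → (2 * m.factorial) • toInt (blockPoly G n W) =
      ∑ p ∈ Finset.HasAntidiagonal.antidiagonal m,
        (pairCoeff G p.1 p.2 W * m.choose p.1) • toInt (twoCliquePoly p.1 p.2) := by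
  induction m using Nat.strong_induction_on with
  | _ m ih =>
    intro W hW hc
    have hpd : ∀ a, a ≠ 0 → pderiv a (toInt (blockPoly G n W)) =
        ∑ B ∈ stableOfSize G W a, toInt (blockPoly G n (W \ B)) := fun a ha => by
      rw [toInt, pderiv_map, pderiv_blockPoly G ha n W hW, map_sum]
    rcases m with _ | m
    · have hWe : W = ∅ := Finset.card_eq_zero.mp hc
      subst hWe
      have h3 : blockPoly G n ∅ = 1 := by
        clear hpd h2 hW hc ih
        induction n with
        | zero => rfl
        | succ n ih => rw [blockPoly, if_neg (by simp), ih]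
      have h4 : topCoeff G ∅ = 2 := by
        have h5 : stableOfSize G ∅ 2 = ∅ := stableOfSize_eq_empty (by simp)
        simp [topCoeff, removeOne, removePair, h5]
      rw [h3]
      simp [pairCoeff, h4, twoCliquePoly, toInt]
    have hsupp := (blockPoly_support G n h2 W hW).2
    refine eq_of_pderiv_eq ?_ ?_ ?_ ?_ ?_
    · exact nsmul_mem (toInt_mem hsupp) _
    · exact sum_mem fun p _ => zsmul_mem (toInt_mem (twoCliquePoly_mem _ _)) _
    · have h3 : W ≠ ∅ := fun h => by simp [h] at hc
      rw [map_nsmul, toInt, constantCoeff_map, constantCoeff_blockPoly G n W hW, if_neg h3, map_sum,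
        Finset.sum_eq_zero]
      · simp
      · intro p hp
        rw [map_zsmul, constantCoeff_map, constantCoeff_twoCliquePoly, map_zero, smul_zero]
        rw [Finset.HasAntidiagonal.mem_antidiagonal] at hp
        omega
    · rw [map_nsmul, hpd 1 one_ne_zero,
        stableOfSize_one_sum W fun S => toInt (blockPoly G n S), map_sum]
      have hl : (2 * (m + 1).factorial) • ∑ u ∈ W, toInt (blockPoly G n (W.erase u)) =
          ((m + 1 : ℕ) : ℤ) • ∑ p ∈ Finset.HasAntidiagonal.antidiagonal m,
            (removeOne (pairCoeff G p.1 p.2) W * m.choose p.1) • toInt (twoCliquePoly p.1 p.2) := by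
        have e1 : 2 * (m + 1).factorial = (m + 1) * (2 * m.factorial) := by
          rw [Nat.factorial_succ]; ring
        rw [e1, mul_smul, natCast_zsmul, Finset.smul_sum]
        congr 1
        rw [Finset.sum_congr rfl fun u hu => ih m (by omega) _ ((Finset.erase_subset _ _).trans hW)
          (by rw [Finset.card_erase_of_mem hu, hc]; rfl), Finset.sum_comm]
        refine Finset.sum_congr rfl fun p _ => ?_
        rw [removeOne, Finset.sum_mul, Finset.sum_smul]
      rw [hl]
      have hr : ∀ p : ℕ × ℕ, pderiv 1 ((pairCoeff G p.1 p.2 W * (m + 1).choose p.1) •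
          toInt (twoCliquePoly p.1 p.2)) =
          (pairCoeff G p.1 p.2 W * (m + 1).choose p.1 * p.1) • toInt (twoCliquePoly (p.1 - 1) p.2) +
          (pairCoeff G p.1 p.2 W * (m + 1).choose p.1 * p.2) • toInt (twoCliquePoly p.1 (p.2 - 1)) := by
        intro p
        rw [map_zsmul, toInt, pderiv_map, pderiv_one_twoCliquePoly, map_add, map_nsmul, map_nsmul,
          smul_add, ← natCast_zsmul, ← natCast_zsmul, smul_smul, smul_smul]
      rw [Finset.sum_congr rfl fun p _ => hr p, Finset.sum_add_distrib,
        Finset.Nat.sum_antidiagonal_succ (f := fun p =>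
          (pairCoeff G p.1 p.2 W * (m + 1).choose p.1 * p.1) • toInt (twoCliquePoly (p.1 - 1) p.2)),
        Finset.Nat.sum_antidiagonal_succ' (f := fun p =>
          (pairCoeff G p.1 p.2 W * (m + 1).choose p.1 * p.2) • toInt (twoCliquePoly p.1 (p.2 - 1)))]
      simp only [Nat.cast_zero, mul_zero, zero_smul, zero_add, Nat.add_sub_cancel]
      rw [← Finset.sum_add_distrib, Finset.smul_sum]
      refine Finset.sum_congr rfl fun p hp => ?_
      rw [Finset.HasAntidiagonal.mem_antidiagonal] at hp
      rw [← pairCoeff_add G p.1 p.2 W (by omega), ← add_smul, smul_smul]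
      congr 1
      have c1 : ((m + 1 : ℕ) : ℤ) * m.choose p.1 = (m + 1).choose (p.1 + 1) * ((p.1 + 1 : ℕ) : ℤ) := by
        exact_mod_cast Nat.add_one_mul_choose_eq m p.1
      have c2 : ((m + 1 : ℕ) : ℤ) * m.choose p.1 = (m + 1).choose p.1 * ((p.2 + 1 : ℕ) : ℤ) := by
        have := Nat.choose_mul_succ_eq m p.1
        rw [show m + 1 - p.1 = p.2 + 1 by omega] at this
        rw [mul_comm]
        exact_mod_cast this
      linear_combination (pairCoeff G (p.1 + 1) p.2 W) * c1 + (pairCoeff G p.1 (p.2 + 1) W) * c2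
    · rw [map_nsmul, hpd 2 two_ne_zero, map_sum]
      have hr : ∀ p : ℕ × ℕ, pderiv 2 ((pairCoeff G p.1 p.2 W * (m + 1).choose p.1) •
          toInt (twoCliquePoly p.1 p.2)) = (pairCoeff G p.1 p.2 W * (m + 1).choose p.1 * (p.1 * p.2)) •
          toInt (twoCliquePoly (p.1 - 1) (p.2 - 1)) := by
        intro p
        rw [map_zsmul, toInt, pderiv_map, pderiv_two_twoCliquePoly, map_nsmul, ← natCast_zsmul, smul_smul,
          Nat.cast_mul]
      rw [Finset.sum_congr rfl fun p _ => hr p]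
      rcases m with _ | m
      · have h3 : stableOfSize G W 2 = ∅ := stableOfSize_eq_empty (by omega)
        simp [h3, Finset.Nat.antidiagonal_succ]
      · have hl : (2 * (m + 1 + 1).factorial) • ∑ B ∈ stableOfSize G W 2, toInt (blockPoly G n (W \ B)) =
            (((m + 2) * (m + 1) : ℕ) : ℤ) • ∑ p ∈ Finset.HasAntidiagonal.antidiagonal m,
              (removePair G (pairCoeff G p.1 p.2) W * m.choose p.1) • toInt (twoCliquePoly p.1 p.2) := by
          have e1 : 2 * (m + 1 + 1).factorial = ((m + 2) * (m + 1)) * (2 * m.factorial) := by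
            rw [Nat.factorial_succ, Nat.factorial_succ]; ring
          rw [e1, mul_smul, natCast_zsmul, Finset.smul_sum]
          congr 1
          rw [Finset.sum_congr rfl fun B hB => ih m (by omega) _ (Finset.sdiff_subset.trans hW) (by
            obtain ⟨⟨h1, _⟩, h2⟩ := mem_stableOfSize.mp hB
            rw [Finset.card_sdiff_of_subset h1, h2, hc]; rfl), Finset.sum_comm]
          refine Finset.sum_congr rfl fun p _ => ?_
          rw [removePair, Finset.sum_mul, Finset.sum_smul]
        rw [hl, Finset.Nat.sum_antidiagonal_succ, Finset.Nat.sum_antidiagonal_succ']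
        simp only [Nat.cast_zero, mul_zero, zero_mul, zero_smul, zero_add, Nat.add_sub_cancel]
        rw [Finset.smul_sum]
        refine Finset.sum_congr rfl fun p hp => ?_
        rw [Finset.HasAntidiagonal.mem_antidiagonal] at hp
        rw [smul_smul]
        congr 1
        change _ = removePair G (pairCoeff G p.1 p.2) W * _ * _
        have c1 := Nat.add_one_mul_choose_eq (m + 1) p.1
        have c2 := Nat.choose_mul_succ_eq m p.1
        rw [show m + 1 - p.1 = p.2 + 1 by omega] at c2
        have c3 : (((m + 2) * (m + 1) : ℕ) : ℤ) * m.choose p.1 =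
            (m + 1 + 1).choose (p.1 + 1) * (((p.1 + 1 : ℕ) : ℤ) * ((p.2 + 1 : ℕ) : ℤ)) := by
          have : (m + 2) * (m + 1) * m.choose p.1 =
              (m + 1 + 1).choose (p.1 + 1) * ((p.1 + 1) * (p.2 + 1)) := by
            calc _ = (m + 1 + 1) * (m.choose p.1 * (m + 1)) := by ring
              _ = ((m + 1 + 1) * (m + 1).choose p.1) * (p.2 + 1) := by rw [c2]; ring
              _ = _ := by rw [c1]; ring
          exact_mod_cast this
        linear_combination (removePair G (pairCoeff G p.1 p.2) W) * c3

/-- A graph without stable sets of three vertices is `e`-positive. -/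
theorem isEPositive_of_card_le_two (n : ℕ) (h2 : ∀ A ⊆ Finset.range n, IsStable G A → A.card ≤ 2) :
    IsEPositive (onFin n G) := by
  have hD : 2 * n.factorial ≠ 0 := mul_ne_zero two_ne_zero (Nat.factorial_ne_zero n)
  refine isEPositive_of_blockPoly hD ((Finset.HasAntidiagonal.antidiagonal n).toList.map fun p =>
    ((pairCoeff G p.1 p.2 (Finset.range n)).toNat * n.choose p.1, [p.1, p.2])) ?_ ?_
  · intro q hq
    obtain ⟨p, hp, rfl⟩ := List.mem_map.mp hq
    have := Finset.HasAntidiagonal.mem_antidiagonal.mp (Finset.mem_toList.mp hp)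
    simpa using this
  · refine map_injective (Nat.castRingHom ℤ) Nat.cast_injective ?_
    have h3 := blockPoly_eq_sum n h2 n (Finset.range n) subset_rfl (Finset.card_range n)
    rw [map_nsmul, h3, List.map_map, Finset.sum_map_toList, map_sum]
    refine Finset.sum_congr rfl fun p hp => ?_
    rw [Finset.HasAntidiagonal.mem_antidiagonal] at hp
    subst hp
    rw [Function.comp_apply, map_nsmul, blockPoly_cliqueUnion_pair_range, ← natCast_zsmul]
    congr 1
    push_cast
    rw [Int.toNat_of_nonneg (pairCoeff_nonneg h2 _ _ _ subset_rfl)]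

end TwoBlocks

/-! ### The graphs on ten and eleven vertices -/

section Verification

/-- The code of the graph with `n` vertices whose adjacencies, ordered by the larger vertex, are the
digits of `m`. -/
def graphCode : ℕ → ℕ → ℕ
  | 0, _ => 0
  | n+1, m => addVertex n (graphCode n m)
      (Nat.mod (Nat.shiftRight m (Nat.div (Nat.mul n (Nat.pred n)) 2)) (Nat.pow 2 n))

/-- The good graphs on ten vertices, in rows that are treated separately. -/
def rows10 : List (List ℕ) :=
  [[15538588746529, 21455658270753, 25318864715892, 31389919632833, 31813059231807,
    31813059232831, 31941839600692, 32993071663978, 33045679981055, 33045680235007,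
    33114400228340, 33183119705002, 33320558658553, 33595436564961, 33597567016391,
    33597584049095, 33874643533887, 33874643534015, 34012082487359, 34145192379187,
    34145192379327, 34147339862527, 34149315919935, 34149402656831, 34149487345977,
    34149487346231, 34149487346483, 34149487346495, 34149520261183, 34149520900409,
    34149520900663, 34149520900671, 34149520900915, 34149521166591, 34149521170707,
    34149521432615, 34149521432631, 34149521432639, 34149521432851, 34149521432863,
    34149521432895, 34149521436723, 34564002832903, 34694948193043, 34699276984595,
    34699277246739, 34699277254693, 34699277254695, 34699277254711, 34700350996499,
    34700350996511, 34701390643987, 34701424730387, 34701424738341, 34701424738343,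
    34701424738359, 34701433126931, 34701433126943, 34701433258003, 34701433258015],
   [34701441108483, 34701441507603, 34701441515557, 34701441515559, 34701441515575,
    34701441646611, 34701441646623, 34701441650707, 34701441650719, 34701441650963,
    34701441767943, 34701441773767, 34701441777701, 34701441777703, 34701441781779,
    34701441781891, 34701441781903, 34701441782035, 34701441786117, 34701441786119,
    34701441786131, 34701441786135, 34974155161651, 34976319688979, 34976319693075,
    34976319693317, 34976856564227, 34977376387123, 34977393430803, 34977393434899,
    34977393435141, 34977397629443, 34977397694979, 34977401552947, 34977401823507,
    34977401823749, 34977401889283, 34977401891331, 34977401891459, 34977401948257,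
    34977401954579, 34977401954821, 34977401956867, 34977401956995, 34977401958917,
    34977401959043, 34977401959049, 34977401959185, 13757988225043, 20077009832001,
    20350813997121, 20351879350337, 24232373788947, 26974552213569, 27530757390369,
    28608861835395, 28613240430867, 28625974050849, 28625975050316, 28630286008417],
   [30799361560673, 30799361624161, 30799361757315, 30829309200481, 30837932826899,
    31112877337226, 31112877339273, 31937511045217, 31946117875850, 31946117890067,
    32495924937491, 33006907689475, 33006924599315, 33021890791939, 33024021365011,
    33024021498371, 33024038408211, 33036956082451, 33037022675493, 33037022683923,
    33041317634323, 33041334550547, 33045529756435, 33045612596138, 33045612601825,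
    33045612610085, 33045612610355, 33045646156051, 33045646410003, 33045646680339,
    33045679768490, 33045679964641, 33045680226853, 33045680227123, 33045680234771,
    34136534311187, 34145191862547, 34145192378917, 34147339862291, 34149436112915,
    34149486829843, 34149487346213, 34149504123155, 34149504385299, 34149520900645,
    34149521162515, 34149521166355, 34149521432613, 26397003751693, 26405526577426,
    30820686381605, 30829275783443, 30829277880596, 30829309071444, 30829309071521,
    30829309075717, 30829309854245, 30837932311077]]

/-- The good graphs on eleven vertices, in rows that are treated separately. The graphs of one row lead
to the same weights of the block sizes. -/
def rows11 : List (List ℕ) :=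
  [[16925873610425268, 17766381530383359, 22244823064928775, 25946352635610036,
    30987566436073535, 33843019576802209, 33843019576802226, 33878203948889889,
    33878341387844458, 34089859937230305, 34303727935963199, 34303727935964223,
    34371884669746292, 34654467816166399, 34930975512436231, 34934838952213567,
    34935942724716532, 34935942724719609, 34935942724731839, 34935942791857140,
    34935942791955449, 34935942792348607, 34935942792356351, 34935942792356863,
    34971127164961780, 35006311537050538, 35076680281228281, 35359259098628159,
    35359259098628287, 35429627842805823, 35493097586150625, 35493097586150643,
    35497236985306567, 35498892746293561, 35498892746294067, 35498892746294207,
    35499442502107647, 35499992257921337, 35499992257921591, 35499992257921599,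
    35499992257921843, 35499992257921855, 35499992257921983, 35499994405405183,
    35499994422182399, 35499996381462591, 35499996468199487, 35499996535856191,
    35499996552888633, 35499996552888887, 35499996552888895, 35499996552889139,
    35499996552889151],
   [35499996569936147, 35499996585803839, 35499996586443303, 35499996586443319,
    35499996586443327, 35499996586443571, 35499996586709247, 35499996586713363,
    35499996586975271, 35499996586975287, 35499996586975295, 35499996586975507,
    35499996586975519, 35499996586975551, 35499996586979379, 35711654739862023,
    35778436001853145, 35778436001853149, 35780367723004691, 35781471563424019,
    35781471563686163, 35781471563694117, 35781471563694119, 35781471563694135,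
    35781746441601043, 35781746441601055, 35782016990446355, 35782021319237907,
    35782021319500051, 35782021319508005, 35782021319508007, 35782021319508023,
    35782022393249811, 35782022393249823, 35782022401638419, 35782022401638431,
    35782023432897299, 35782023466983699, 35782023466991653, 35782023466991655,
    35782023466991671, 35782023475380243, 35782023475380255, 35782023475511315,
    35782023475511327, 35782023475515411, 35782023475515423, 35782023483361795,
    35782023483760915, 35782023483768869, 35782023483768871, 35782023483768887,
    35782023483899923],
   [35782023483899935, 35782023483904019, 35782023483904031, 35782023483904275,
    35782023484021255, 35782023484031013, 35782023484031015, 35782023484035091,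
    35782023484035103, 35782023484035203, 35782023484035215, 35782023484035347,
    35782023484039429, 35782023484039431, 35782023484039443, 35782023484039447,
    35919035510126442, 35922209052049459, 35922760972259603, 35922760972390675,
    35922760972394771, 35922760972395013, 35922898411348483, 35923033685770291,
    35923035850297619, 35923035850301715, 35923035850301957, 35923036387172867,
    35923036391367171, 35923036906995763, 35923036924039443, 35923036924043539,
    35923036924043781, 35923036928238083, 35923036928303619, 35923036928305667,
    35923036932161587, 35923036932432147, 35923036932432389, 35923036932497923,
    35923036932499971, 35923036932500099, 35923036932556897, 35923036932563219,
    35923036932563461, 35923036932565507, 35923036932565635, 35923036932567557,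
    35923036932567683, 35923036932567689, 35923036932567825],
   [15907373587653123, 21539749060674051, 27744257373972552, 31692357520613507,
    31833095008831585, 31833095008964739, 32115673794033697, 32677519938161155,
    32679718961481505, 32679727555576609, 33244885251285267, 33803419845681427,
    33807796550000915, 33807817890689801, 33807817890755209, 33807817891133537,
    33807817891668755, 33807826548171027, 33807835078879882, 33807835104032865,
    33807835104047155, 33807835137598227, 33807835138105619, 33948572693064330,
    34370785158117473, 34929319752507667, 34933735044948243, 34933735111541285,
    34933735111541555, 34933735111549715, 34934834623160595, 34935921133486355,
    34935934068203795, 34935934134782890, 34935934134796601, 34935934134796837,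
    34935934134797107],
   [34935934134805267, 34935938429755667, 34935938463310099, 34935942724717482,
    34935942724723169, 34935942724731429, 34935942724731699, 34935942724739859,
    34935942758277395, 34935942758531347, 34935942758801683, 34935942791889834,
    34935942792085985, 34935942792348197, 34935942792348467, 34935942792356115,
    34935942792610579, 35496685064970515, 35498892712222995, 35498892745777427,
    35498892746293797, 35499442502107411, 35499983599853843, 35499992257405203,
    35499992257921573, 35499994405404947, 35499994422182163, 35499996501655571,
    35499996552372499, 35499996552888869, 35499996569665811, 35499996569927955,
    35499996586443301, 35499996586705171, 35499996586709011, 35499996586975269],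
   [14080930021900563, 14081481929524257, 14081481933653025, 20553218186676227,
    20834143407572995, 20834691015903235, 24791831200407827, 27026030238109809,
    27603240708277266, 27603241773598753, 27603241773630497, 27603241782085635,
    29284414253042179, 29284414269952019, 29286634734756115, 29292097895138372,
    29293193111798852, 29293193112584289, 29293193241561185, 29299785924616467],
   [31531831003318787, 31531833134025219, 31531833150935059, 31542789712921125,
    31547187691790611, 31547187960226068, 31547189872443411, 31547196247901460,
    31547196247902497, 31547196247904773, 31547196248170533, 31547196348318245,
    31551594261514755, 31551602851594789, 31551602918170899, 32681922295632009,
    32681922296545555, 33782537730001034, 33786918596657171, 33788013805045898],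
   [33788013813303434, 33788013813317651, 33788018125177107, 33795697644013706,
    33795697644027923, 33796792843772179, 33796792860688403, 33796797172547859,
    33799021865214227, 33803402731856147, 33803419845149221, 33805618867872019,
    33805623179219081, 33805623180132627, 33807817891660325, 33807826481062163,
    33807826514092307, 33807835137589797],
   [27030411104755986]]

def codesOfRow (n : ℕ) (rows : List (List ℕ)) (i : ℕ) : List ℕ := (rows.getD i []).map (graphCode n)

def codesOfRows (n : ℕ) (rows : List (List ℕ)) : List ℕ := rows.flatten.map (graphCode n)

/-- Whether all codes obtained from `L` belong to `L'`. -/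
def checkStep (n : ℕ) (L L' : List ℕ) : Bool := (step n L).all fun R => memCode R L'

theorem step_subset {n : ℕ} {L L' : List ℕ} (h : checkStep n L L' = true) : step n L ⊆ L' :=
  fun _ hR => mem_of_memCode (List.all_eq_true.mp h _ hR)

theorem exists_row {n R : ℕ} {rows : List (List ℕ)} (h : R ∈ codesOfRows n rows) :
    ∃ i < rows.length, R ∈ codesOfRow n rows i := by
  obtain ⟨m, hm, rfl⟩ := List.mem_map.mp h
  obtain ⟨l, hl, hml⟩ := List.mem_flatten.mp hm
  obtain ⟨i, hi, rfl⟩ := List.getElem_of_mem hl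
  refine ⟨i, hi, List.mem_map.mpr ⟨m, ?_, rfl⟩⟩
  rwa [List.getD_eq_getElem _ _ hi]

set_option maxRecDepth 100000

theorem checkStep_codes9 : checkStep 9 codes9 (codesOfRows 10 rows10) = true := by decide +kernel

theorem complete10 : Complete 10 (codesOfRows 10 rows10) :=
  complete9.step (by norm_num) (by norm_num) fun _ hR => ⟨_, hR, step_subset checkStep_codes9⟩

theorem checkStep_rows10 (i : ℕ) (hi : i < rows10.length) :
    checkStep 10 (codesOfRow 10 rows10 i) (codesOfRows 11 rows11) = true := by
  have hi : i < 3 := hi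
  interval_cases i <;> decide +kernel

theorem complete11 : Complete 11 (codesOfRows 11 rows11) := by
  refine complete10.step (by norm_num) (by norm_num) fun R hR => ?_
  obtain ⟨i, hi, hRi⟩ := exists_row hR
  exact ⟨_, hRi, step_subset (checkStep_rows10 i hi)⟩

theorem checkCodes_rows10 (i : ℕ) (hi : i < rows10.length) :
    checkCodes 10 (codesOfRow 10 rows10 i) = true := by
  have hi : i < 3 := hi
  interval_cases i <;> decide +kernel

theorem checkCodes_rows11 (i : ℕ) (hi : i < rows11.length) :
    checkCodes 11 (codesOfRow 11 rows11 i) = true := by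
  have hi : i < 9 := hi
  interval_cases i <;> decide +kernel

theorem isEPositive_of_complete {n : ℕ} {rows : List (List ℕ)} (hn : n = 10 ∨ n = 11)
    (hc : Complete n (codesOfRows n rows))
    (h : ∀ i < rows.length, checkCodes n (codesOfRow n rows i) = true) {H : SimpleGraph (Fin n)}
    (hH : IsGood H) : IsEPositive H := by
  obtain ⟨R, hR, G, hG, ⟨e⟩⟩ := hc H hH
  obtain ⟨i, hi, hRi⟩ := exists_row hR
  obtain ⟨h3, h4, h5, h6⟩ := suitable hn
  exact (isEPositive_of_checkCode hG (by omega) (by omega) h3 h4 h5 h6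
    (List.all_eq_true.mp (h i hi) R hRi)).of_iso e

theorem isEPositive_of_isGood {n : ℕ} (hn : n = 10 ∨ n = 11) {H : SimpleGraph (Fin n)}
    (hH : IsGood H) : IsEPositive H := by
  rcases id hn with rfl | rfl
  · exact isEPositive_of_complete hn complete10 checkCodes_rows10 hH
  · exact isEPositive_of_complete hn complete11 checkCodes_rows11 hH

end Verification

/-! ### Conclusion -/

section Conclusion

theorem isEPositive_of_not_indepTriple {n : ℕ} {H : SimpleGraph (Fin n)}
    (ht : ¬ ∃ x y z, IndepTriple H x y z) : IsEPositive H := by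
  let e : Fin n ↪ ℕ := ⟨Fin.val, Fin.val_injective⟩
  have he : onFin n (H.map e) = H := SimpleGraph.comap_map_eq e H
  rw [← he]
  refine isEPositive_of_card_le_two n fun A hA hst => ?_
  by_contra hc
  obtain ⟨B, hB, hB3⟩ := Finset.exists_subset_card_eq (show 3 ≤ A.card by omega)
  obtain ⟨x, y, z, hxy, hxz, hyz, rfl⟩ := Finset.card_eq_three.mp hB3
  have hx := hB (show x ∈ _ by simp)
  have hy := hB (show y ∈ _ by simp)
  have hz := hB (show z ∈ _ by simp)
  have hlt : ∀ i ∈ A, i < n := fun i hi => Finset.mem_range.mp (hA hi)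
  have hadj : ∀ i (hi : i ∈ A) j (hj : j ∈ A), ¬ H.Adj ⟨i, hlt i hi⟩ ⟨j, hlt j hj⟩ := by
    intro i hi j hj h
    refine hst i hi j hj ?_
    exact (SimpleGraph.map_adj_apply (G := H) (f := e) (a := ⟨i, hlt i hi⟩)
      (b := ⟨j, hlt j hj⟩)).mpr h
  exact ht ⟨⟨x, hlt x hx⟩, ⟨y, hlt y hy⟩, ⟨z, hlt z hz⟩, by simpa using hxy, by simpa using hxz,
    by simpa using hyz, hadj x hx y hy, hadj x hx z hz, hadj y hy z hz⟩

end Conclusion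

theorem mainTheorem2 {V : Type*} [Fintype V] (G : SimpleGraph V)
    (hcard : Fintype.card V = 10 ∨ Fintype.card V = 11) (hconn : G.Connected)
    (hclaw : IsClawFree G) (hcontr : IsClawContractibleFree G) :
    IsEPositive G := by
  have hc : ConnOn G Set.univ := connOn_univ_iff.mpr hconn
  let f := SimpleGraph.Iso.map (Fintype.equivFin V) G
  refine IsEPositive.of_iso f.symm ?_
  by_cases ht : ∃ x y z, IndepTriple G x y z
  · have hH := IsGood.of_iso f ⟨hc, hclaw.noClaw, hcontr.cut hc, ht⟩
    exact isEPositive_of_isGood hcard hH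
  · refine isEPositive_of_not_indepTriple fun ⟨x, y, z, h⟩ => ht ?_
    exact ⟨f.symm x, f.symm y, f.symm z, (IndepTriple.map f.symm.toEmbedding).mpr h⟩
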